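/- Let $\Lambda=\{m+n\,e^{i\pi/3}: m,n\in\mathbb Z\}\subset\mathbb C=\mathbb R^2$ be the triangular lattice and let $\Omega$ be a simple closed polygon with vertices in $\Lambda$. An *edge* in $\Omega$ is a segment in the closed region bounded by $\Omega$, not crossing $\Omega$, that joins two distinct points of $\Lambda$ and contains no other point of $\Lambda$. A *triangulation* of $\Omega$ is a set of edges in $\Omega$, any two of which meet at most at lattice points, that covers the polygon $\Omega$ and divides the region into triangular facets containing no lattice points other than their corners (so that all lattice points of the region are vertices). A *flip* transforms one triangulation into another by replacing one diagonal of a convex quadrilateral, whose sides are edges of the triangulation and whose interior meets no edge other than this diagonal, by the other diagonal. A *flip path from $T$ that generates $E$* is a sequence of flips, starting at the triangulation $T$, that leads to a triangulation containing the set of edges $E$; it is *minimum* if no flip path from $T$ that generates $E$ has fewer flips. A *flip plan that generates $E$ from $T$* is a finite partially ordered set $\pi$ of flips whose linear orderings are exactly the flip paths from $T$ that generate $E$ and contain exactly the flips in $\pi$, once each; it is *minimum* if each of its linear orderings is a minimum flip path from $T$ that generates $E$. **Theorem (Minimum Flip Plans Yield Minimum Triangulations).** Suppose that $\Omega$ admits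 an equilateral triangulation $T_0$, i.e. a triangulation all of whose edges, including those along $\Omega$, have the same length. Let $E$ be a finite set of edges in $\Omega$, any two of which meet at most at lattice points. Then there is a unique minimum flip plan $\pi_E$ that generates $E$ from $T_0$, and performing the flips in $\pi_E$ on $T_0$, in any linear ordering of $\pi_E$, yields one and the same triangulation $T$, which is a minimum triangulation of $\Omega$ constrained by $E$: $T$ contains $E$, and the sum of the Euclidean lengths of the edges of $T$ is at most that of any triangulation of $\Omega$ that contains $E$. -/

import Mathlib

noncomputable section

namespace LatticeFlip

/-! ### The triangular lattice and its edges -/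

/-- Integer coordinates of a point of the triangular lattice. -/
abbrev LatticePoint : Type := ℤ × ℤ

/-- The point `m + n * exp (i * π / 3)` of the Euclidean plane, which we take to be `ℂ`; the
range of `pt` is the triangular lattice. -/
def pt (v : LatticePoint) : ℂ :=
  (v.1 : ℂ) + (v.2 : ℂ) * ((1 / 2 : ℂ) + ((Real.sqrt 3 / 2 : ℝ) : ℂ) * Complex.I)

/-- The closed straight-line segment joining the two ends of `e`. -/
def seg (e : Sym2 LatticePoint) : Set ℂ :=
  Sym2.lift ⟨fun a b => segment ℝ (pt a) (pt b), fun a b => segment_symm ℝ (pt a) (pt b)⟩ e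

/-- The segment joining the two ends of `e`, without the ends. -/
def openSeg (e : Sym2 LatticePoint) : Set ℂ :=
  Sym2.lift ⟨fun a b => openSegment ℝ (pt a) (pt b),
    fun a b => openSegment_symm ℝ (pt a) (pt b)⟩ e

/-- The Euclidean length of `e`. -/
def edgeLength (e : Sym2 LatticePoint) : ℝ :=
  Sym2.lift ⟨fun a b => dist (pt a) (pt b), fun a b => dist_comm (pt a) (pt b)⟩ e

/-- The coordinates of the vector from one end of `e` to the other are relatively prime, i.e. the
ends are distinct and there is no lattice point between them. -/
def IsPrimitive (e : Sym2 LatticePoint) : Prop :=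
  ∃ a b : LatticePoint, e = s(a, b) ∧ IsCoprime (b.1 - a.1) (b.2 - a.2)

/-- Two different edges meet at most at lattice points (hence, for primitive edges, at most at
common ends). -/
def NonCrossing (T : Finset (Sym2 LatticePoint)) : Prop :=
  ∀ e ∈ T, ∀ f ∈ T, e ≠ f → Disjoint (openSeg e) (openSeg f)

/-! ### Lattice polygons and their triangulations -/

/-- A simple closed polygon with vertices in the triangular lattice: the vertices are distinct, and
two different sides have no point in common except a common vertex. Sides may contain further
lattice points. -/
structure IsSimpleLatticePolygon {n : ℕ} (Ω : Polygon ℂ n) : Prop where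
  three_le : 3 ≤ n
  vertex_mem : ∀ i, Ω i ∈ Set.range pt
  vertex_injective : Function.Injective Ω.vertices
  side_inter : ∀ i j, i ≠ j → Ω.edgeSet ℝ i ∩ Ω.edgeSet ℝ j ⊆
    ({Ω i, Ω (finRotate n i)} : Set ℂ) ∩ {Ω j, Ω (finRotate n j)}

/-- The closed region bounded by the polygon: the polygon itself and the bounded components of its
complement. -/
def region {n : ℕ} (Ω : Polygon ℂ n) : Set ℂ :=
  Ω.boundary ℝ ∪
    {x | x ∉ Ω.boundary ℝ ∧ Bornology.IsBounded (connectedComponentIn (Ω.boundary ℝ)ᶜ x)}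

/-- `e` is an edge of the lattice point-set of the polygon `Ω`: it is a primitive lattice segment
in the closed region bounded by `Ω` which does not cross the polygon, i.e. it runs either along a
side of the polygon or, except possibly for its ends, in the interior. -/
structure IsEdge {n : ℕ} (Ω : Polygon ℂ n) (e : Sym2 LatticePoint) : Prop where
  primitive : IsPrimitive e
  seg_subset : seg e ⊆ region Ω
  boundary : openSeg e ⊆ Ω.boundary ℝ ∨ Disjoint (openSeg e) (Ω.boundary ℝ)

/-- A set of constraints: edges in `Ω` that pairwise intersect at most at lattice points. -/
structure IsConstraintSet {n : ℕ} (Ω : Polygon ℂ n) (E : Finset (Sym2 LatticePoint)) : Prop where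
  isEdge : ∀ e ∈ E, IsEdge Ω e
  nonCrossing : NonCrossing E

/-- The corners of a triangle. -/
def corners (a b c : LatticePoint) : Set LatticePoint := {a, b, c}

/-- `a`, `b`, `c` span a triangular facet of the graph with edge set `T`: a nondegenerate triangle,
with sides in `T`, which contains no lattice point other than its corners. -/
structure IsFacet (T : Finset (Sym2 LatticePoint)) (a b c : LatticePoint) : Prop where
  mem_ab : s(a, b) ∈ T
  mem_bc : s(b, c) ∈ T
  mem_ca : s(c, a) ∈ T
  not_collinear : ¬ Collinear ℝ (pt '' corners a b c)
  empty : ∀ v : LatticePoint, pt v ∈ convexHull ℝ (pt '' corners a b c) → v ∈ corners a b c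

/-- `T` is the edge set of a (lattice) triangulation of the polygon `Ω`: a straight-line graph on
the set of all the lattice points in the closed region bounded by `Ω`, with non-crossing edges,
containing the polygon, and with triangular interior facets. (As the facets cover the region and
contain no lattice points other than their corners, every lattice point in the region is a vertex
of the graph.) -/
structure IsTriangulation {n : ℕ} (Ω : Polygon ℂ n) (T : Finset (Sym2 LatticePoint)) : Prop where
  isEdge : ∀ e ∈ T, IsEdge Ω e
  nonCrossing : NonCrossing T
  boundary_subset : Ω.boundary ℝ ⊆ ⋃ e ∈ T, seg e
  facets_cover : ∀ x ∈ region Ω, ∃ a b c : LatticePoint,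
    IsFacet T a b c ∧ x ∈ convexHull ℝ (pt '' corners a b c)

/-- The equilateral triangulation: all the edges, including those along the polygon, have the same
length. -/
def IsEquilateralTriangulation {n : ℕ} (Ω : Polygon ℂ n) (T : Finset (Sym2 LatticePoint)) : Prop :=
  IsTriangulation Ω T ∧ ∃ l : ℝ, ∀ e ∈ T, edgeLength e = l

/-- The total edge length. -/
def totalLength (T : Finset (Sym2 LatticePoint)) : ℝ := ∑ e ∈ T, edgeLength e

/-- `T` is a minimum triangulation of `Ω` constrained by `E`. -/
structure IsMinimumTriangulation {n : ℕ} (Ω : Polygon ℂ n) (E T : Finset (Sym2 LatticePoint)) :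
    Prop where
  isTriangulation : IsTriangulation Ω T
  constrained : E ⊆ T
  minimum : ∀ T' : Finset (Sym2 LatticePoint),
    IsTriangulation Ω T' → E ⊆ T' → totalLength T ≤ totalLength T'

/-! ### Diagonal flips and flip paths -/

/-- A diagonal flip, given by the diagonal that it removes and the diagonal that it adds; together
these determine the quadrilateral on which the flip is performed. -/
@[ext]
structure Flip where
  removed : Sym2 LatticePoint
  added : Sym2 LatticePoint

/-- `a b c d` is a (strictly) convex quadrilateral with diagonals `a c` and `b d`: the diagonals
cross at a point inside both, and do not lie on one line. -/
def IsConvexQuad (a b c d : LatticePoint) : Prop :=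
  (openSegment ℝ (pt a) (pt c) ∩ openSegment ℝ (pt b) (pt d)).Nonempty ∧
    ¬ Collinear ℝ ({pt a, pt b, pt c, pt d} : Set ℂ)

/-- The flip `f` transforms the triangulation `T` of `Ω` into the triangulation `T'`: some convex
quadrilateral `a b c d` of `T`, whose interior meets no edge of `T` other than the diagonal `a c`,
has this diagonal replaced by the other one, `b d`. -/
structure IsFlip {n : ℕ} (Ω : Polygon ℂ n) (T : Finset (Sym2 LatticePoint)) (f : Flip)
    (T' : Finset (Sym2 LatticePoint)) : Prop where
  source : IsTriangulation Ω T
  target : IsTriangulation Ω T'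
  eq_insert_erase : T' = insert f.added (T.erase f.removed)
  quad : ∃ a b c d : LatticePoint, f.removed = s(a, c) ∧ f.added = s(b, d) ∧
    IsConvexQuad a b c d ∧
    s(a, b) ∈ T ∧ s(b, c) ∈ T ∧ s(c, d) ∈ T ∧ s(d, a) ∈ T ∧ s(a, c) ∈ T ∧
    ∀ e ∈ T, e ≠ s(a, c) →
      Disjoint (seg e) (interior (convexHull ℝ ({pt a, pt b, pt c, pt d} : Set ℂ)))

/-- `FlipPath Ω T L T'`: performing the flips in the list `L`, in this order, transforms the
triangulation `T` of `Ω` into the triangulation `T'`. -/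
inductive FlipPath {n : ℕ} (Ω : Polygon ℂ n) :
    Finset (Sym2 LatticePoint) → List Flip → Finset (Sym2 LatticePoint) → Prop
  | nil (T : Finset (Sym2 LatticePoint)) : IsTriangulation Ω T → FlipPath Ω T [] T
  | cons (T T' T'' : Finset (Sym2 LatticePoint)) (f : Flip) (L : List Flip) :
      IsFlip Ω T f T' → FlipPath Ω T' L T'' → FlipPath Ω T (f :: L) T''

/-- `L` is a flip path, starting at `T`, that generates the edges in `E`: its target
triangulation contains `E`. -/
def Generates {n : ℕ} (Ω : Polygon ℂ n) (T E : Finset (Sym2 LatticePoint)) (L : List Flip) :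
    Prop :=
  ∃ T' : Finset (Sym2 LatticePoint), FlipPath Ω T L T' ∧ E ⊆ T'

/-! ### Flip plans -/

/-- A finite partially ordered set of flips. -/
@[ext]
structure FlipPoset where
  flips : Finset Flip
  le : Flip → Flip → Prop
  mem_of_le : ∀ f g, le f g → f ∈ flips ∧ g ∈ flips
  le_refl : ∀ f ∈ flips, le f f
  le_trans : ∀ f g h, le f g → le g h → le f h
  le_antisymm : ∀ f g, le f g → le g f → f = g

namespace FlipPoset

/-- `L` contains exactly the flips in `π`, once each. -/
def IsListing (π : FlipPoset) (L : List Flip) : Prop :=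
  L.Nodup ∧ ∀ f, f ∈ L ↔ f ∈ π.flips

/-- `L` is a valid linear ordering of `π`: it lists the flips in `π`, and no flip in `L` is above
a later one. -/
def IsLinearOrdering (π : FlipPoset) (L : List Flip) : Prop :=
  π.IsListing L ∧ L.Pairwise fun f g => ¬ π.le g f

/-- `π` is a flip plan that generates `E` from `T`: its valid linear orderings are exactly the flip
paths that generate `E` from `T` and contain exactly the flips in `π`. -/
def IsFlipPlan {n : ℕ} (Ω : Polygon ℂ n) (T E : Finset (Sym2 LatticePoint)) (π : FlipPoset) :
    Prop :=
  ∀ L : List Flip, π.IsListing L → (π.IsLinearOrdering L ↔ Generates Ω T E L)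

/-- `π` is a minimum flip plan that generates `E` from `T`: every valid linear ordering of it is a
flip path with the least number of flips among all the flip paths that generate `E` from `T`. -/
def IsMinimumFlipPlan {n : ℕ} (Ω : Polygon ℂ n) (T E : Finset (Sym2 LatticePoint))
    (π : FlipPoset) : Prop :=
  π.IsFlipPlan Ω T E ∧ ∀ L : List Flip, π.IsLinearOrdering L →
    ∀ L' : List Flip, Generates Ω T E L' → L.length ≤ L'.length

/-- Applying `π` to `T` yields `T'`: performing its flips on `T`, in any valid linear ordering,
transforms `T` into `T'`. -/
def Yields {n : ℕ} (Ω : Polygon ℂ n) (π : FlipPoset) (T T' : Finset (Sym2 LatticePoint)) : Prop :=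
  ∀ L : List Flip, π.IsLinearOrdering L → FlipPath Ω T L T'

end FlipPoset

end LatticeFlip

end

open LatticeFlip

namespace LatticeFlip

/-! ### Lattice coordinates on the plane -/

/-! A flip exchanges the diagonals of a unimodular lattice parallelogram (`IsFlip.applies`), so the
new edge has the same midpoint as the old one. Every triangulation has exactly one edge at the
midpoint of each edge in `Ω`, because its facets are unimodular and contain no half-lattice points
except corners and midpoints of sides (`IsTriangulation.exists_mid_eq`, `IsDrawing.eq_of_mid_eq`).
The two diagonals never have equal length, so either the flip or its reverse lengthens; call a
lengthening flip "up".

The heart of the matter is that an up flip is determined by the edge that it adds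
(`Flip.IsUp.eq_of_added_eq`): a primitive vector is in only one way the sum of a lattice basis of
given orientation with an acute angle (`eq_of_bil_pos`). Producing an edge by an up flip thus needs
one particular removed edge and four particular sides; descending recursively from `E` gives `Needed
E`.

The same uniqueness shows that every triangulation is reached from `T₀` by up flips
(`exists_up_path`). A longest edge that is not a unit edge faces an obtuse angle in both adjacent
triangles (`Tri.bil_pos`), so these form a parallelogram and the edge can be flipped to a shorter
one. Repetition ends at a triangulation with unit edges only, and `T₀` is the only such
triangulation.

Call an up flip required if the edge that it adds is needed. Any flip path from `T₀` that generates
`E`, up or not, contains all required flips (`FlipPath.mem_of_needed`). Conversely, let `T` contain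
`E`; such a `T` exists, since a missing constraint can be created by flipping a widest edge that
crosses it (`IsTriangulation.exists_constrained`). Deleting the flips that are not required from an
up path to `T` leaves a legal path that generates `E` and whose end is no longer than `T`
(`FlipPath.filter_needed`). So a minimum path performs each required flip once and nothing else. Its
end depends only on the set of its flips (`FlipPath.target_unique`), hence is the same for every
choice of `T`, and is a minimum triangulation.

For the plan, the required flips are ordered by precedence in all generating listings. A flip
applies when certain edges are present; each is added by at most one up flip and never returns after
its removal, so every linear ordering is again a path (`flipPath_of_compatible`). A finite poset is
recovered from its linear orderings (`FlipPoset.le_iff`), which makes the plan unique. -/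

/-- The first coordinate with respect to the basis `1`, `exp (i * π / 3)`. -/
noncomputable def coordX : ℂ →L[ℝ] ℝ := Complex.reCLM - (1 / Real.sqrt 3) • Complex.imCLM

/-- The second coordinate with respect to the basis `1`, `exp (i * π / 3)`. -/
noncomputable def coordY : ℂ →L[ℝ] ℝ := (2 / Real.sqrt 3) • Complex.imCLM

lemma pt_re (v : LatticePoint) : (pt v).re = v.1 + v.2 / 2 := by
  simp [pt]; ring

lemma pt_im (v : LatticePoint) : (pt v).im = v.2 * (Real.sqrt 3 / 2) := by
  simp [pt]

@[simp] lemma coordX_pt (v : LatticePoint) : coordX (pt v) = v.1 := by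
  have h : Real.sqrt 3 ≠ 0 := by positivity
  simp [coordX, pt_re, pt_im]; field_simp; ring

@[simp] lemma coordY_pt (v : LatticePoint) : coordY (pt v) = v.2 := by
  have h : Real.sqrt 3 ≠ 0 := by positivity
  simp [coordY, pt_im]; field_simp

lemma ext_coord {z w : ℂ} (hX : coordX z = coordX w) (hY : coordY z = coordY w) : z = w := by
  have h : Real.sqrt 3 ≠ 0 := by positivity
  have him : z.im = w.im := by
    simp only [coordY, smul_apply, Complex.imCLM_apply, smul_eq_mul] at hY
    exact mul_left_cancel₀ (by positivity) hY
  have hre : z.re = w.re := by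
    simp only [coordX, sub_apply, smul_apply,
      Complex.imCLM_apply, Complex.reCLM_apply, smul_eq_mul, him] at hX
    linarith
  exact Complex.ext hre him

lemma pt_injective : Function.Injective pt := by
  intro v w h
  have h1 := congrArg coordX h
  have h2 := congrArg coordY h
  simp only [coordX_pt, coordY_pt, Int.cast_inj] at h1 h2
  exact Prod.ext h1 h2

/-- Twice the signed area of a lattice triangle, in units of the fundamental parallelogram. -/
def area (a b c : LatticePoint) : ℤ := (b.1 - a.1) * (c.2 - a.2) - (b.2 - a.2) * (c.1 - a.1)

/-- The affine extension of `area a b`. -/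
noncomputable def orient (a b : LatticePoint) (z : ℂ) : ℝ :=
  (b.1 - a.1) * (coordY z - a.2) - (b.2 - a.2) * (coordX z - a.1)

@[simp] lemma orient_pt (a b c : LatticePoint) : orient a b (pt c) = area a b c := by
  simp [orient, area]

lemma orient_comb (a b : LatticePoint) (x y : ℂ) {s t : ℝ} (h : s + t = 1) :
    orient a b (s • x + t • y) = s * orient a b x + t * orient a b y := by
  obtain rfl : s = 1 - t := by linarith
  simp only [orient, map_add, map_smul, smul_eq_mul]; ring

lemma continuous_orient (a b : LatticePoint) : Continuous (orient a b) := by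
  unfold orient; fun_prop

lemma orient_swap (a b : LatticePoint) (z : ℂ) : orient b a z = - orient a b z := by
  simp only [orient]; ring

lemma orient_sum (a b c : LatticePoint) (z : ℂ) :
    orient a b z + orient b c z + orient c a z = area a b c := by
  simp only [orient, area]; push_cast; ring

lemma area_rotate (a b c : LatticePoint) : area b c a = area a b c := by
  simp only [area]; ring

lemma area_swap (a b c : LatticePoint) : area b a c = - area a b c := by
  simp only [area]; ring

@[simp] lemma area_left (a b : LatticePoint) : area a b a = 0 := by simp [area]

@[simp] lemma area_right (a b : LatticePoint) : area a b b = 0 := by simp only [area]; ring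

@[simp] lemma area_same (a b : LatticePoint) : area a a b = 0 := by simp [area]

/-- The heights over two sides of a nondegenerate triangle are affine coordinates of the plane. -/
lemma eq_of_orient {a b c : LatticePoint} (h : area a b c ≠ 0) {z w : ℂ}
    (h1 : orient a b z = orient a b w) (h2 : orient b c z = orient b c w) : z = w := by
  have h' : (area a b c : ℝ) ≠ 0 := by exact_mod_cast h
  simp only [orient] at h1 h2
  have hD : (area a b c : ℝ) = (b.1 - a.1) * (c.2 - a.2) - (b.2 - a.2) * (c.1 - a.1) := by
    simp [area]
  apply ext_coord
  · apply mul_left_cancel₀ h'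
    rw [hD]
    linear_combination ((c.1:ℝ) - b.1) * h1 - ((b.1:ℝ) - a.1) * h2
  · apply mul_left_cancel₀ h'
    rw [hD]
    linear_combination ((c.2:ℝ) - b.2) * h1 - ((b.2:ℝ) - a.2) * h2

lemma eq_of_area {a b c : LatticePoint} (h : area a b c ≠ 0) {v w : LatticePoint}
    (h1 : area a b v = area a b w) (h2 : area b c v = area b c w) : v = w :=
  pt_injective (eq_of_orient h (by simpa using h1) (by simpa using h2))

/-! ### Segments -/

@[simp] lemma seg_mk (a b : LatticePoint) : seg s(a, b) = segment ℝ (pt a) (pt b) := rfl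

@[simp] lemma openSeg_mk (a b : LatticePoint) :
    openSeg s(a, b) = openSegment ℝ (pt a) (pt b) := rfl

lemma openSeg_subset_seg (e : Sym2 LatticePoint) : openSeg e ⊆ seg e := by
  induction e with | h a b => exact openSegment_subset_segment _ _ _

lemma mem_seg_iff (a b : LatticePoint) (z : ℂ) :
    z ∈ seg s(a, b) ↔ z = pt a ∨ z = pt b ∨ z ∈ openSeg s(a, b) := by
  rw [seg_mk, openSeg_mk, ← insert_endpoints_openSegment]; simp

/-- The midpoint of an edge. -/
noncomputable def mid (e : Sym2 LatticePoint) : ℂ :=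
  Sym2.lift ⟨fun a b => (1 / 2 : ℝ) • pt a + (1 / 2 : ℝ) • pt b, fun _ _ => add_comm _ _⟩ e

@[simp] lemma mid_mk (a b : LatticePoint) :
    mid s(a, b) = (1 / 2 : ℝ) • pt a + (1 / 2 : ℝ) • pt b := rfl

lemma mid_mem (e : Sym2 LatticePoint) : mid e ∈ openSeg e := by
  induction e with | h a b => exact ⟨1/2, 1/2, by norm_num, by norm_num, by norm_num, rfl⟩

lemma isPrimitive_mk {a b : LatticePoint} :
    IsPrimitive s(a, b) ↔ IsCoprime (b.1 - a.1) (b.2 - a.2) := by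
  constructor
  · rintro ⟨c, d, h, hc⟩
    rcases Sym2.eq_iff.1 h with ⟨rfl, rfl⟩ | ⟨rfl, rfl⟩
    · exact hc
    · simpa using hc.neg_neg
  · exact fun h => ⟨a, b, rfl, h⟩

lemma isPrimitive_of_area {a b c : LatticePoint} (h : area a b c = 1) : IsPrimitive s(a, b) := by
  rw [isPrimitive_mk]
  refine ⟨c.2 - a.2, -(c.1 - a.1), ?_⟩
  rw [← h, area]; ring

lemma IsPrimitive.ne {a b : LatticePoint} (h : IsPrimitive s(a, b)) : a ≠ b := by
  rintro rfl
  rw [isPrimitive_mk] at h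
  simp [isCoprime_zero_left] at h

/-- A Bézout relation for the direction gives an affine function with integer values at lattice
points that equals the parameter along the segment; no integer lies strictly between 0 and 1. -/
lemma pt_notMem_openSeg {e : Sym2 LatticePoint} (he : IsPrimitive e) (p : LatticePoint) :
    pt p ∉ openSeg e := by
  induction e with | h a b =>
  rintro ⟨s, t, hs, ht, hst, h⟩
  obtain ⟨x, y, hxy⟩ := isPrimitive_mk.1 he
  have h1 := congrArg coordX h
  have h2 := congrArg coordY h
  simp only [map_add, map_smul, smul_eq_mul, coordX_pt, coordY_pt] at h1 h2
  obtain rfl : s = 1 - t := by linarith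
  have : t = ((x * (p.1 - a.1) + y * (p.2 - a.2) : ℤ) : ℝ) := by
    have hxy' : (x:ℝ) * (b.1 - a.1) + y * (b.2 - a.2) = 1 := by exact_mod_cast hxy
    push_cast
    linear_combination -t * hxy' + x * h1 + y * h2
  have h0 : (0:ℤ) < x * (p.1 - a.1) + y * (p.2 - a.2) := by
    rw [this] at ht; exact_mod_cast ht
  have h3 : x * (p.1 - a.1) + y * (p.2 - a.2) < (1:ℤ) := by
    have : t < 1 := by linarith
    rw [‹t = _›] at this; exact_mod_cast this
  omega

/-- A vector parallel to a primitive one is an integer multiple of it. -/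
lemma exists_mul_of_parallel {m n m' n' : ℤ} (h : IsCoprime m n) (h' : m * n' - n * m' = 0) :
    ∃ k, m' = k * m ∧ n' = k * n := by
  obtain ⟨x, y, hxy⟩ := h
  refine ⟨x * m' + y * n', ?_, ?_⟩
  · linear_combination -m' * hxy - y * h'
  · linear_combination -n' * hxy + x * h'

/-- Two primitive segments in the same direction that meet inside coincide. -/
lemma eq_of_parallel {a b c d : LatticePoint} (h1 : IsPrimitive s(a, b))
    (h2 : IsPrimitive s(c, d))
    (hpar : (b.1 - a.1) * (d.2 - c.2) - (b.2 - a.2) * (d.1 - c.1) = 0)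
    {z : ℂ} (hz1 : z ∈ openSeg s(a, b)) (hz2 : z ∈ openSeg s(c, d)) : s(a, b) = s(c, d) := by
  rw [isPrimitive_mk] at h1 h2
  obtain ⟨k, hk1, hk2⟩ := exists_mul_of_parallel h1 hpar
  obtain ⟨l, hl1, hl2⟩ := exists_mul_of_parallel h2 (m' := b.1 - a.1) (n' := b.2 - a.2)
    (by linarith)
  have hkl : k * l = 1 := by
    obtain ⟨x, y, hxy⟩ := h1
    have e1 : (k * l - 1) * (b.1 - a.1) = 0 := by
      linear_combination -hl1 - l * hk1
    have e2 : (k * l - 1) * (b.2 - a.2) = 0 := by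
      linear_combination -hl2 - l * hk2
    linear_combination x * e1 + y * e2 - (k * l - 1) * hxy
  obtain ⟨s, t, hs, ht, hst, rfl⟩ := hz1
  obtain ⟨s', t', hs', ht', hst', h⟩ := hz2
  have e1 := congrArg coordX h
  have e2 := congrArg coordY h
  simp only [map_add, map_smul, smul_eq_mul, coordX_pt, coordY_pt] at e1 e2
  obtain rfl : s = 1 - t := by linarith
  obtain rfl : s' = 1 - t' := by linarith
  have hk1' : (d.1 - c.1 : ℝ) = k * (b.1 - a.1) := by exact_mod_cast hk1
  have hk2' : (d.2 - c.2 : ℝ) = k * (b.2 - a.2) := by exact_mod_cast hk2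
  obtain ⟨x, y, hxy⟩ := h1
  have hxy' : (x:ℝ) * (b.1 - a.1) + y * (b.2 - a.2) = 1 := by exact_mod_cast hxy
  have f1 : (c.1 - a.1 : ℝ) = (t - t' * k) * (b.1 - a.1) := by
    linear_combination e1 - t' * hk1'
  have f2 : (c.2 - a.2 : ℝ) = (t - t' * k) * (b.2 - a.2) := by
    linear_combination e2 - t' * hk2'
  have f3 : t - t' * k = ((x * (c.1 - a.1) + y * (c.2 - a.2) : ℤ) : ℝ) := by
    push_cast
    linear_combination -(t - t' * k) * hxy' - x * f1 - y * f2
  set N : ℤ := x * (c.1 - a.1) + y * (c.2 - a.2)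
  rw [f3] at f1 f2
  have g1 : c.1 - a.1 = N * (b.1 - a.1) := by exact_mod_cast f1
  have g2 : c.2 - a.2 = N * (b.2 - a.2) := by exact_mod_cast f2
  -- The segments have equal or opposite directions. The integer `N` is the offset of `c` from `a`
  -- in units of `b - a`; a common interior point leaves only 0 or 1, respectively.
  rcases Int.eq_one_or_neg_one_of_mul_eq_one hkl with rfl | rfl
  · have : N = 0 := by
      have u1 : (N:ℝ) < 1 := by rw [← f3]; push_cast; linarith
      have u2 : (-1:ℝ) < N := by rw [← f3]; push_cast; linarith
      have u1' : N < 1 := by exact_mod_cast u1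
      have u2' : -1 < N := by exact_mod_cast u2
      omega
    rw [this] at g1 g2
    obtain rfl : a = c := Prod.ext (by linarith) (by linarith)
    obtain rfl : b = d := Prod.ext (by linarith) (by linarith)
    rfl
  · have : N = 1 := by
      have u1 : (N:ℝ) < 2 := by rw [← f3]; push_cast; linarith
      have u2 : (0:ℝ) < N := by rw [← f3]; push_cast; linarith
      have u1' : N < 2 := by exact_mod_cast u1
      have u2' : 0 < N := by exact_mod_cast u2
      omega
    rw [this] at g1 g2
    obtain rfl : b = c := Prod.ext (by linarith) (by linarith)
    obtain rfl : a = d := Prod.ext (by linarith) (by linarith)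
    exact Sym2.eq_swap

/-! ### Unimodular triangles -/

/-- The closed triangle on the left of `ab`, `bc` and `ca`. -/
def triSet (a b c : LatticePoint) : Set ℂ :=
  {z | 0 ≤ orient a b z ∧ 0 ≤ orient b c z ∧ 0 ≤ orient c a z}

lemma triSet_rotate (a b c : LatticePoint) : triSet b c a = triSet a b c := by
  ext z; simp only [triSet, Set.mem_ofPred_eq]; tauto

lemma isClosed_triSet (a b c : LatticePoint) : IsClosed (triSet a b c) :=
  ((isClosed_le continuous_const (continuous_orient a b)).inter
    ((isClosed_le continuous_const (continuous_orient b c)).inter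
      (isClosed_le continuous_const (continuous_orient c a))))

lemma convex_triSet (a b c : LatticePoint) : Convex ℝ (triSet a b c) := by
  intro x hx y hy s t hs ht hst
  simp only [triSet, Set.mem_ofPred_eq, orient_comb _ _ _ _ hst] at *
  obtain ⟨h1, h2, h3⟩ := hx
  obtain ⟨h4, h5, h6⟩ := hy
  refine ⟨?_, ?_, ?_⟩ <;> positivity

lemma eq_bary {a b c : LatticePoint} (h : area a b c ≠ 0) (z : ℂ) :
    z = (orient b c z / area a b c) • pt a + (orient c a z / area a b c) • pt b +
      (orient a b z / area a b c) • pt c := by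
  have h' : (area a b c : ℝ) ≠ 0 := by exact_mod_cast h
  have hs := orient_sum a b c z
  have hD : (area a b c : ℝ) = (b.1 - a.1) * (c.2 - a.2) - (b.2 - a.2) * (c.1 - a.1) := by
    simp [area]
  apply ext_coord
  · apply mul_left_cancel₀ h'
    simp only [map_add, map_smul, smul_eq_mul, coordX_pt]
    field_simp
    rw [hD]; simp only [orient]; ring
  · apply mul_left_cancel₀ h'
    simp only [map_add, map_smul, smul_eq_mul, coordY_pt]
    field_simp
    rw [hD]; simp only [orient]; ring

lemma convexHull_eq_triSet {a b c : LatticePoint} (h : 0 < area a b c) :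
    convexHull ℝ {pt a, pt b, pt c} = triSet a b c := by
  have h' : (0:ℝ) < area a b c := by exact_mod_cast h
  have r1 : area b c a = area a b c := area_rotate _ _ _
  have r2 : area c a b = area a b c := by rw [area_rotate, area_rotate]
  apply Set.Subset.antisymm
  · apply convexHull_min _ (convex_triSet a b c)
    intro z hz
    rcases hz with rfl | rfl | rfl
    · simp [triSet, r1, h.le]
    · simp [triSet, r2, h.le]
    · simp [triSet, h.le]
  · intro z hz
    obtain ⟨h1, h2, h3⟩ := hz
    rw [eq_bary h.ne' z]
    have hconv := convex_convexHull ℝ {pt a, pt b, pt c}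
    have hsub := subset_convexHull ℝ {pt a, pt b, pt c}
    have hs := orient_sum a b c z
    have := hconv.sum_mem (t := Finset.univ)
      (w := ![orient b c z / area a b c, orient c a z / area a b c, orient a b z / area a b c])
      (z := ![pt a, pt b, pt c]) (by
        intro i _; fin_cases i <;> simp <;> positivity) (by
        simp [Fin.sum_univ_succ]; field_simp; linarith) (by
        intro i _; fin_cases i <;> apply hsub <;> simp)
    simpa [Fin.sum_univ_succ, add_assoc] using this

lemma interior_convexHull_of_pos {a b c : LatticePoint} {z : ℂ} (h1 : 0 < orient a b z)
    (h2 : 0 < orient b c z) (h3 : 0 < orient c a z) :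
    z ∈ interior (convexHull ℝ {pt a, pt b, pt c}) := by
  have hs := orient_sum a b c z
  have hpos : 0 < area a b c := by
    have : (0:ℝ) < area a b c := by linarith
    exact_mod_cast this
  rw [convexHull_eq_triSet hpos, mem_interior]
  refine ⟨{z | 0 < orient a b z ∧ 0 < orient b c z ∧ 0 < orient c a z}, ?_, ?_, h1, h2, h3⟩
  · rintro w ⟨w1, w2, w3⟩; exact ⟨w1.le, w2.le, w3.le⟩
  · exact ((isOpen_lt continuous_const (continuous_orient a b)).inter
      ((isOpen_lt continuous_const (continuous_orient b c)).inter
      (isOpen_lt continuous_const (continuous_orient c a))))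

lemma mem_openSeg_of_orient {a b c : LatticePoint} {z : ℂ} (h1 : orient a b z = 0)
    (h2 : 0 < orient b c z) (h3 : 0 < orient c a z) : z ∈ openSeg s(a, b) := by
  have hs := orient_sum a b c z
  have hpos : (0:ℝ) < area a b c := by linarith
  have hne : area a b c ≠ 0 := by intro h; simp [h] at hpos
  refine ⟨orient b c z / area a b c, orient c a z / area a b c, by positivity, by positivity,
    by field_simp; linarith, ?_⟩
  conv_rhs => rw [eq_bary hne z]
  simp [h1]

lemma mem_seg_of_orient {a b c : LatticePoint} (h : 0 < area a b c) {z : ℂ}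
    (h1 : orient a b z = 0)
    (h2 : 0 ≤ orient b c z) (h3 : 0 ≤ orient c a z) : z ∈ seg s(a, b) := by
  have hs := orient_sum a b c z
  have hpos : (0:ℝ) < area a b c := by exact_mod_cast h
  refine ⟨orient b c z / area a b c, orient c a z / area a b c, by positivity, by positivity,
    by field_simp; linarith, ?_⟩
  conv_rhs => rw [eq_bary h.ne' z]
  simp [h1]

lemma exists_comb_of_mem_openSeg {p q : LatticePoint} {z : ℂ} (hz : z ∈ openSeg s(p, q)) :
    ∃ s t : ℝ, 0 < s ∧ 0 < t ∧ s + t = 1 ∧ z = s • pt p + t • pt q ∧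
      ∀ a b, orient a b z = s * area a b p + t * area a b q := by
  obtain ⟨s, t, hs, ht, hst, rfl⟩ := hz
  exact ⟨s, t, hs, ht, hst, rfl, fun a b => by rw [orient_comb _ _ _ _ hst]; simp⟩

lemma orient_eq_zero_of_mem_seg {a b : LatticePoint} {z : ℂ} (hz : z ∈ seg s(a, b)) :
    orient a b z = 0 := by
  obtain ⟨s, t, hs, ht, hst, rfl⟩ := hz
  rw [orient_comb _ _ _ _ hst]; simp

/-- A lattice point of a unimodular triangle is a corner. -/
lemma eq_corner_of_mem_triSet {a b c v : LatticePoint} (h : area a b c = 1)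
    (hv : pt v ∈ triSet a b c) : v = a ∨ v = b ∨ v = c := by
  obtain ⟨h1, h2, h3⟩ := hv
  simp only [orient_pt] at h1 h2 h3
  have hs := orient_sum a b c (pt v)
  simp only [orient_pt] at hs
  norm_cast at h1 h2 h3 hs
  have r1 : area b c a = area a b c := area_rotate _ _ _
  have r2 : area c a b = area a b c := by rw [area_rotate, area_rotate]
  have hne : area a b c ≠ 0 := by omega
  have : (area a b v = 0 ∧ area b c v = 1) ∨ (area a b v = 0 ∧ area b c v = 0) ∨
    (area a b v = 1 ∧ area b c v = 0) := by omega
  rcases this with ⟨e1, e2⟩ | ⟨e1, e2⟩ | ⟨e1, e2⟩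
  · left; apply eq_of_area hne <;> simp [*]
  · right; left; apply eq_of_area hne <;> simp [*]
  · right; right; apply eq_of_area hne <;> simp [*]

/-- The midpoint of a primitive edge that lies in a unimodular triangle is the midpoint of one
of the sides. -/
lemma mid_eq_of_mem_triSet {a b c : LatticePoint} (h : area a b c = 1) {e : Sym2 LatticePoint}
    (he : IsPrimitive e) (hm : mid e ∈ triSet a b c) :
    mid e = mid s(a, b) ∨ mid e = mid s(b, c) ∨ mid e = mid s(c, a) := by
  induction e with | h p q =>
  have r1 : area b c a = area a b c := area_rotate _ _ _
  have r2 : area c a b = area a b c := by rw [area_rotate, area_rotate]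
  have hne : area a b c ≠ 0 := by omega
  have ho : ∀ x y, orient x y (mid s(p, q)) = (area x y p + area x y q) / 2 := by
    intro x y; rw [mid_mk, orient_comb _ _ _ _ (by norm_num)]; simp; ring
  have hoc : ∀ x y v w, orient x y (mid s(v, w)) = (area x y v + area x y w) / 2 := by
    intro x y v w; rw [mid_mk, orient_comb _ _ _ _ (by norm_num)]; simp; ring
  obtain ⟨h1, h2, h3⟩ := hm
  have hs := orient_sum a b c (mid s(p, q))
  rw [ho] at h1 h2 h3
  simp only [ho] at hs
  have k1 : 0 ≤ area a b p + area a b q := by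
    have : (0:ℝ) ≤ area a b p + area a b q := by linarith
    exact_mod_cast this
  have k2 : 0 ≤ area b c p + area b c q := by
    have : (0:ℝ) ≤ area b c p + area b c q := by linarith
    exact_mod_cast this
  have k3 : 0 ≤ area c a p + area c a q := by
    have : (0:ℝ) ≤ area c a p + area c a q := by linarith
    exact_mod_cast this
  -- Twice the barycentric coordinates of the midpoint are nonnegative integers with sum 2. Either
  -- one of them is 2, a corner, which primitivity excludes, or two of them are 1, the midpoint of a
  -- side.
  have ks : area a b p + area a b q + (area b c p + area b c q) + (area c a p + area c a q) = 2 := by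
    rw [h] at hs
    have : ((area a b p + area a b q + (area b c p + area b c q) + (area c a p + area c a q) : ℤ) : ℝ)
      = (2:ℤ) := by push_cast at *; linarith
    exact_mod_cast this
  have key : ∀ v w, area a b p + area a b q = area a b v + area a b w →
      area b c p + area b c q = area b c v + area b c w → mid s(p, q) = mid s(v, w) := by
    intro v w e1 e2
    apply eq_of_orient hne
    · rw [hoc, hoc]; congr 1; exact_mod_cast e1
    · rw [hoc, hoc]; congr 1; exact_mod_cast e2
  have vert : ∀ v, area a b p + area a b q = area a b v + area a b v →
      area b c p + area b c q = area b c v + area b c v → False := by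
    intro v e1 e2
    have := key v v e1 e2
    have h4 := mid_mem s(p, q)
    rw [this, mid_mk, ← add_smul] at h4
    norm_num at h4
    exact pt_notMem_openSeg he v h4
  generalize hA : area a b p + area a b q = A at *
  generalize hB : area b c p + area b c q = B at *
  generalize hC : area c a p + area c a q = C at *
  have : (A = 2 ∧ B = 0) ∨ (A = 0 ∧ B = 2) ∨ (A = 0 ∧ B = 0) ∨ (A = 0 ∧ B = 1) ∨
      (A = 1 ∧ B = 0) ∨ (A = 1 ∧ B = 1) := by omega
  rcases this with ⟨rfl, rfl⟩ | ⟨rfl, rfl⟩ | ⟨rfl, rfl⟩ | ⟨rfl, rfl⟩ | ⟨rfl, rfl⟩ | ⟨rfl, rfl⟩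
  · exact (vert c (by simp [h]) (by simp)).elim
  · exact (vert a (by simp) (by simp [r1, h])).elim
  · exact (vert b (by simp) (by simp)).elim
  · left; apply key <;> simp [*]
  · right; left; apply key <;> simp [*]
  · right; right; apply key <;> simp [*]

/-- A primitive segment that spans a lattice triangle without further lattice points spans a
unimodular one. -/
lemma area_eq_one_of_empty {a b c : LatticePoint} (hp : IsPrimitive s(a, b)) (h : 0 < area a b c)
    (hempty : ∀ v, pt v ∈ triSet a b c → v = a ∨ v = b ∨ v = c) : area a b c = 1 := by
  by_contra hne
  have hd : 2 ≤ area a b c := by omega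
  obtain ⟨x, y, hxy⟩ := isPrimitive_mk.1 hp
  set d := area a b c with hdef
  -- the component of `c - a` along `b - a` in the basis completed by `(-y, x)`
  set α : ℤ := x * (c.1 - a.1) + y * (c.2 - a.2) with hα
  set k : ℤ := - ((-α) / d) with hk
  have hk1 : 0 ≤ k * d - α ∧ k * d - α ≤ d - 1 := by
    have e1 := Int.mul_ediv_add_emod (-α) d
    have e2 := Int.emod_nonneg (-α) (by omega : d ≠ 0)
    have e3 := Int.emod_lt_of_pos (-α) (by omega : 0 < d)
    have : k * d = - (d * (-α / d)) := by rw [hk]; ring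
    constructor <;> linarith
  -- The lattice points at height 1 over `ab` form one coset of the multiples of `b - a`. Since `k`
  -- is `α / d` rounded up, `v` is the first of them on the inner side of `ca`; for `d ≥ 2` it is
  -- still inside `bc`.
  let v : LatticePoint := (a.1 + k * (b.1 - a.1) - y, a.2 + k * (b.2 - a.2) + x)
  have v1 : area a b v = 1 := by
    simp only [area, v]; linear_combination hxy
  have v3 : area c a v = k * d - α := by
    have : d = (b.1 - a.1) * (c.2 - a.2) - (b.2 - a.2) * (c.1 - a.1) := rfl
    rw [this, hα]; simp only [area, v]; ring
  have v2 : area b c v = d - 1 - (k * d - α) := by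
    have hs := orient_sum a b c (pt v)
    simp only [orient_pt] at hs
    norm_cast at hs
    rw [v1, v3] at hs
    linarith
  have := hempty v ⟨by rw [orient_pt, v1]; norm_num, by rw [orient_pt, v2]; exact_mod_cast (by omega),
    by rw [orient_pt, v3]; exact_mod_cast hk1.1⟩
  rcases this with hv | hv | hv
  · rw [hv, area_left] at v1; omega
  · rw [hv, area_right] at v1; omega
  · rw [hv] at v1; exact hne v1

/-! ### Unimodular triangles in a plane drawing -/

/-- A set of primitive edges, no two of which cross. -/
structure IsDrawing (T : Finset (Sym2 LatticePoint)) : Prop where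
  nonCrossing : NonCrossing T
  primitive : ∀ e ∈ T, IsPrimitive e

/-- A positively oriented unimodular triangle with sides in `T`. -/
structure Tri (T : Finset (Sym2 LatticePoint)) (a b c : LatticePoint) : Prop where
  mem_ab : s(a, b) ∈ T
  mem_bc : s(b, c) ∈ T
  mem_ca : s(c, a) ∈ T
  area_eq : area a b c = 1

variable {T T' T₀ S : Finset (Sym2 LatticePoint)} {n : ℕ} {Ω : Polygon ℂ n}

lemma Tri.rotate {a b c : LatticePoint} (h : Tri T a b c) : Tri T b c a :=
  ⟨h.mem_bc, h.mem_ca, h.mem_ab, by rw [area_rotate, h.area_eq]⟩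

lemma IsDrawing.eq_of_mem (hT : IsDrawing T) {e f : Sym2 LatticePoint} (he : e ∈ T) (hf : f ∈ T)
    {z : ℂ} (hze : z ∈ openSeg e) (hzf : z ∈ openSeg f) : e = f := by
  by_contra h
  exact Set.disjoint_left.1 (hT.nonCrossing e he f hf h) hze hzf

lemma IsDrawing.eq_of_mid_eq (hT : IsDrawing T) {e f : Sym2 LatticePoint} (he : e ∈ T)
    (hf : f ∈ T) (h : mid e = mid f) : e = f :=
  hT.eq_of_mem he hf (mid_mem e) (h ▸ mid_mem f)

/-- A segment of the drawing that passes through the interior of a triangle of the drawing does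
not leave it through the side `ab`. -/
lemma IsDrawing.false_of_exit (hT : IsDrawing T) {a b c : LatticePoint} (h : Tri T a b c)
    {p q : LatticePoint} (he : s(p, q) ∈ T) {z : ℂ} (hz : z ∈ openSeg s(p, q))
    (h1 : 0 < orient a b z) (hA : area a b p < 0)
    (hB : area a b p / orient a b z ≤ area b c p / orient b c z)
    (h2 : 0 < orient b c z)
    (hC : area a b p / orient a b z ≤ area c a p / orient c a z)
    (h3 : 0 < orient c a z) : False := by
  have hA' : (area a b p : ℝ) < 0 := by exact_mod_cast hA
  rw [div_le_div_iff₀ h1 h2] at hB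
  rw [div_le_div_iff₀ h1 h3] at hC
  -- `y` is the point where the segment from `z` to `p` meets the line `ab`. The ratio hypotheses
  -- say that it meets this line no later than the other two, so `y` lies on the side itself.
  set r := orient a b z - area a b p with hr
  have hr0 : 0 < r := by linarith
  set y := (-(area a b p) / r : ℝ) • z + (orient a b z / r) • pt p with hy
  have hst : (-(area a b p) / r : ℝ) + orient a b z / r = 1 := by
    field_simp; linarith
  have yA : orient a b y = 0 := by
    rw [hy, orient_comb _ _ _ _ hst, orient_pt]; field_simp; ring
  have yB : 0 ≤ orient b c y := by
    rw [hy, orient_comb _ _ _ _ hst, orient_pt, div_mul_eq_mul_div, div_mul_eq_mul_div, ← add_div]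
    apply div_nonneg _ hr0.le; linarith
  have yC : 0 ≤ orient c a y := by
    rw [hy, orient_comb _ _ _ _ hst, orient_pt, div_mul_eq_mul_div, div_mul_eq_mul_div, ← add_div]
    apply div_nonneg _ hr0.le; linarith
  have hys : y ∈ openSeg s(p, q) := by
    obtain ⟨s, t, hs, ht, hst', rfl⟩ := hz
    refine ⟨-(area a b p) / r * s + orient a b (s • pt p + t • pt q) / r,
      -(area a b p) / r * t, ?_, ?_, ?_, ?_⟩
    · have : 0 < -(area a b p : ℝ) := by linarith
      positivity
    · have : 0 < -(area a b p : ℝ) := by linarith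
      positivity
    · rw [← hst, add_right_comm, ← mul_add, hst', mul_one]
    · rw [hy]; simp only [smul_add, smul_smul, add_smul]; abel
  have hyseg : y ∈ seg s(a, b) := mem_seg_of_orient (by rw [h.area_eq]; norm_num) yA yB yC
  rw [mem_seg_iff] at hyseg
  have hprim := hT.primitive _ he
  rcases hyseg with h4 | h4 | h4
  · rw [h4] at hys; exact pt_notMem_openSeg hprim _ hys
  · rw [h4] at hys; exact pt_notMem_openSeg hprim _ hys
  · have := hT.eq_of_mem he h.mem_ab hys h4
    rcases Sym2.eq_iff.1 this with ⟨rfl, rfl⟩ | ⟨rfl, rfl⟩ <;> simp at hA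

/-- If `p` is outside the triangle, the segment from `z` to `p` leaves it first through the side
with the least ratio of the height of `p` to the height of `z`, and `IsDrawing.false_of_exit`
applies to that side. -/
lemma IsDrawing.eq_corner_of_mem_interior (hT : IsDrawing T) {a b c : LatticePoint}
    (h : Tri T a b c) {p q : LatticePoint} (he : s(p, q) ∈ T) {z : ℂ}
    (hz : z ∈ openSeg s(p, q)) (h1 : 0 < orient a b z) (h2 : 0 < orient b c z)
    (h3 : 0 < orient c a z) : p = a ∨ p = b ∨ p = c := by
  by_cases hin : 0 ≤ area a b p ∧ 0 ≤ area b c p ∧ 0 ≤ area c a p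
  · apply eq_corner_of_mem_triSet h.area_eq
    refine ⟨?_, ?_, ?_⟩ <;> rw [orient_pt] <;> exact_mod_cast (by tauto)
  · exfalso
    have neg : ∀ {x : ℤ} {r : ℝ}, 0 < r → (x / r : ℝ) < 0 → x < 0 := by
      intro x r hr hx
      rw [div_neg_iff] at hx
      have : (x:ℝ) < 0 := by rcases hx with h | h <;> linarith
      exact_mod_cast this
    have hmin : (area a b p / orient a b z < 0) ∨ (area b c p / orient b c z < 0) ∨
        (area c a p / orient c a z < 0) := by
      by_contra hcon
      push Not at hcon
      apply hin
      obtain ⟨k1, k2, k3⟩ := hcon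
      have pos : ∀ {x : ℤ} {r : ℝ}, 0 < r → 0 ≤ (x / r : ℝ) → 0 ≤ x := by
        intro x r hr hx
        have : (0:ℝ) ≤ x := by
          by_contra hneg; push Not at hneg
          have := div_neg_of_neg_of_pos hneg hr
          linarith
        exact_mod_cast this
      exact ⟨pos h1 k1, pos h2 k2, pos h3 k3⟩
    rcases le_total (area a b p / orient a b z) (area b c p / orient b c z) with k1 | k1
    · rcases le_total (area a b p / orient a b z) (area c a p / orient c a z) with k2 | k2
      · exact hT.false_of_exit h he hz h1 (neg h1 (by rcases hmin with k | k | k <;> linarith))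
          k1 h2 k2 h3
      · exact hT.false_of_exit h.rotate.rotate he hz h3
          (neg h3 (by rcases hmin with k | k | k <;> linarith)) k2 h1 (k2.trans k1) h2
    · rcases le_total (area b c p / orient b c z) (area c a p / orient c a z) with k2 | k2
      · exact hT.false_of_exit h.rotate he hz h2
          (neg h2 (by rcases hmin with k | k | k <;> linarith)) k2 h3 k1 h1
      · exact hT.false_of_exit h.rotate.rotate he hz h3
          (neg h3 (by rcases hmin with k | k | k <;> linarith)) (k2.trans k1) h1 k2 h2

/-- The edges of a drawing do not meet the interior of a triangle of the drawing. -/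
lemma IsDrawing.notMem_interior (hT : IsDrawing T) {a b c : LatticePoint} (h : Tri T a b c)
    {e : Sym2 LatticePoint} (he : e ∈ T) {z : ℂ} (hz : z ∈ openSeg e) (h1 : 0 < orient a b z)
    (h2 : 0 < orient b c z) (h3 : 0 < orient c a z) : False := by
  induction e with | h p q =>
  have hp := hT.eq_corner_of_mem_interior h he hz h1 h2 h3
  have hq := hT.eq_corner_of_mem_interior h (p := q) (q := p) (by rwa [Sym2.eq_swap])
    (by rwa [Sym2.eq_swap]) h1 h2 h3
  obtain ⟨s, t, hs, ht, hst, rfl, ho⟩ := exists_comb_of_mem_openSeg hz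
  rw [ho] at h1 h2 h3
  have hne := (hT.primitive _ he).ne
  rcases hp with rfl | rfl | rfl <;> rcases hq with rfl | rfl | rfl <;> simp at h1 h2 h3 hne

/-- There is at most one triangle of the drawing on each side of an edge. -/
lemma IsDrawing.tri_unique (hT : IsDrawing T) {a b c c' : LatticePoint} (h : Tri T a b c)
    (h' : Tri T a b c') : c = c' := by
  have hp := isPrimitive_mk.1 (hT.primitive _ h.mem_ab)
  have e1 := h.area_eq
  have e2 := h'.area_eq
  -- Both third corners have height 1 over `ab`, so they differ by `k * (b - a)`. If `k < 0`, the
  -- edge `bc'` enters the triangle `abc` near `b`; if `k > 0`, the edge `ac'` enters it near `a`.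
  -- The `ε` below picks a point close enough to that corner.
  obtain ⟨k, k1, k2⟩ := exists_mul_of_parallel hp (m' := c'.1 - c.1) (n' := c'.2 - c.2) (by
    simp only [area] at e1 e2; linarith)
  have a1 : area b c c' = - k := by
    simp only [area] at e1 ⊢; linear_combination (b.2 - c.2) * k1 - (b.1 - c.1) * k2 - k * e1
  have a2 : area c a c' = k := by
    simp only [area] at e1 ⊢; linear_combination (c.2 - a.2) * k1 - (c.1 - a.1) * k2 + k * e1
  have r2 : area c a b = 1 := by rw [area_rotate, area_rotate, e1]
  have r1 : area b c a = 1 := by rw [area_rotate, e1]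
  rcases lt_trichotomy k 0 with hk | hk | hk
  · exfalso
    have hk' : (k:ℝ) < 0 := by exact_mod_cast hk
    obtain ⟨ε, hε, hε1, hε2⟩ : ∃ ε : ℝ, 0 < ε ∧ ε < 1 ∧ 0 < (1 - ε) + ε * k := by
      refine ⟨1 / (2 - k), by apply div_pos <;> linarith, ?_, ?_⟩
      · rw [div_lt_one] <;> linarith
      · have : (0:ℝ) < 2 - k := by linarith
        field_simp; linarith
    have hst : (1 - ε) + ε = 1 := by ring
    refine hT.notMem_interior h h'.mem_bc (z := (1 - ε) • pt b + ε • pt c')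
      ⟨1 - ε, ε, by linarith, hε, hst, rfl⟩ ?_ ?_ ?_
    · rw [orient_comb _ _ _ _ hst]; simp [e2, hε]
    · rw [orient_comb _ _ _ _ hst]; simp only [orient_pt, area_left, a1]; push_cast
      nlinarith
    · rw [orient_comb _ _ _ _ hst]; simp only [orient_pt, r2, a2]; push_cast
      linarith
  · subst hk
    exact Prod.ext (by linarith) (by linarith)
  · exfalso
    have hk' : (0:ℝ) < k := by exact_mod_cast hk
    obtain ⟨ε, hε, hε1, hε2⟩ : ∃ ε : ℝ, 0 < ε ∧ ε < 1 ∧ 0 < (1 - ε) - ε * k := by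
      refine ⟨1 / (2 + k), by apply div_pos <;> linarith, ?_, ?_⟩
      · rw [div_lt_one] <;> linarith
      · have : (0:ℝ) < 2 + k := by linarith
        field_simp; linarith
    have hst : (1 - ε) + ε = 1 := by ring
    refine hT.notMem_interior h h'.mem_ca (z := (1 - ε) • pt a + ε • pt c')
      (by rw [Sym2.eq_swap]; exact ⟨1 - ε, ε, by linarith, hε, hst, rfl⟩) ?_ ?_ ?_
    · rw [orient_comb _ _ _ _ hst]; simp [e2, hε]
    · rw [orient_comb _ _ _ _ hst]; simp only [orient_pt, r1, a1]; push_cast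
      linarith
    · rw [orient_comb _ _ _ _ hst]; simp only [orient_pt, area_right, a2]; push_cast
      nlinarith

/-- The interior of a parallelogram of the drawing meets no edge except its diagonal. -/
lemma IsDrawing.eq_diagonal (hT : IsDrawing T) {a b c d : LatticePoint} (h : Tri T a b c)
    (h' : Tri T a c d) {e : Sym2 LatticePoint} (he : e ∈ T) {z : ℂ} (hz : z ∈ openSeg e)
    (h1 : 0 < orient a b z) (h2 : 0 < orient b c z) (h3 : 0 < orient c d z)
    (h4 : 0 < orient d a z) : e = s(a, c) := by
  have hca : orient c a z = - orient a c z := orient_swap _ _ _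
  rcases lt_trichotomy (orient a c z) 0 with hs | hs | hs
  · exact (hT.notMem_interior h he hz h1 h2 (by linarith)).elim
  · refine hT.eq_of_mem he (by rw [Sym2.eq_swap]; exact h.mem_ca) hz ?_
    exact mem_openSeg_of_orient hs h3 h4
  · exact (hT.notMem_interior h' he hz hs h3 h4).elim

/-! ### The region bounded by a polygon -/

lemma isClosed_boundary (Ω : Polygon ℂ n) : IsClosed (Ω.boundary ℝ) := by
  unfold Polygon.boundary
  apply isClosed_iUnion_of_finite
  intro i
  unfold Polygon.edgeSet
  rw [affineSegment_eq_segment, ← convexHull_pair]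
  exact (Set.Finite.isCompact_convexHull (𝕜 := ℝ) (Set.toFinite _)).isClosed

lemma isOpen_region_diff_boundary (Ω : Polygon ℂ n) : IsOpen (region Ω \ Ω.boundary ℝ) := by
  rw [isOpen_iff_mem_nhds]
  rintro x ⟨hx, hxb⟩
  have hb : Bornology.IsBounded (connectedComponentIn (Ω.boundary ℝ)ᶜ x) := by
    rcases hx with hx | hx
    · exact absurd hx hxb
    · exact hx.2
  have hopen := (isClosed_boundary Ω).isOpen_compl.connectedComponentIn (x := x)
  filter_upwards [hopen.mem_nhds (mem_connectedComponentIn hxb)] with y hy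
  have hyb := connectedComponentIn_subset _ _ hy
  refine ⟨Or.inr ⟨hyb, ?_⟩, hyb⟩
  rwa [← connectedComponentIn_eq hy]

lemma exists_mem_frontier {C K : Set ℂ} (hC : IsPreconnected C) (h1 : (C ∩ K).Nonempty)
    (h2 : (C ∩ Kᶜ).Nonempty) : (C ∩ frontier K).Nonempty := by
  by_contra hcon
  have hnot : ∀ x ∈ C, x ∉ frontier K := fun x hx hf => hcon ⟨x, hx, hf⟩
  obtain ⟨x, hx, hxK⟩ := h1
  obtain ⟨y, hy, hyK⟩ := h2
  have hx' : x ∈ interior K := by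
    by_contra h; exact hnot x hx ⟨subset_closure hxK, h⟩
  have hy' : y ∈ (closure K)ᶜ := fun h => hnot y hy ⟨h, fun h' => hyK (interior_subset h')⟩
  obtain ⟨w, -, hw1, hw2⟩ := hC (interior K) (closure K)ᶜ isOpen_interior
    isClosed_closure.isOpen_compl (fun z hz => by
      by_cases h : z ∈ interior K
      · exact Or.inl h
      · exact Or.inr fun h' => hnot z hz ⟨h', h⟩) ⟨x, hx, hx'⟩ ⟨y, hy, hy'⟩
  exact hw2 (subset_closure (interior_subset hw1))

/-- The region has no holes. -/
lemma subset_region_of_frontier {K : Set ℂ} (hK : Bornology.IsBounded K)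
    (hf : frontier K ⊆ region Ω) : K ⊆ region Ω := by
  intro x hx
  by_cases hxb : x ∈ Ω.boundary ℝ
  · exact Or.inl hxb
  refine Or.inr ⟨hxb, ?_⟩
  -- The component of `x` in the complement of the polygon either stays in the bounded set `K` or
  -- meets the frontier of `K`, at a point whose component, the same one, is bounded.
  by_cases hsub : connectedComponentIn (Ω.boundary ℝ)ᶜ x ⊆ K
  · exact hK.subset hsub
  obtain ⟨y, hy, hyK⟩ := Set.not_subset.1 hsub
  obtain ⟨w, hw, hwf⟩ := exists_mem_frontier (K := K)
    (isPreconnected_connectedComponentIn (F := (Ω.boundary ℝ)ᶜ) (x := x))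
    ⟨x, mem_connectedComponentIn hxb, hx⟩ ⟨y, hy, hyK⟩
  rw [connectedComponentIn_eq hw]
  rcases hf hwf with h | h
  · exact absurd h (connectedComponentIn_subset _ _ hw)
  · exact h.2

lemma triSet_subset_region {a b c : LatticePoint} (h : 0 < area a b c)
    (h1 : seg s(a, b) ⊆ region Ω) (h2 : seg s(b, c) ⊆ region Ω) (h3 : seg s(c, a) ⊆ region Ω) :
    triSet a b c ⊆ region Ω := by
  have hr1 : 0 < area b c a := by rwa [area_rotate]
  have hr2 : 0 < area c a b := by rwa [area_rotate, area_rotate]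
  apply subset_region_of_frontier
  · rw [← convexHull_eq_triSet h]
    exact (Set.Finite.isCompact_convexHull (𝕜 := ℝ) (Set.toFinite _)).isBounded
  · intro z hz
    rw [(isClosed_triSet a b c).frontier_eq] at hz
    obtain ⟨⟨o1, o2, o3⟩, hz2⟩ := hz
    rcases o1.eq_or_lt with k1 | k1
    · exact h1 (mem_seg_of_orient h k1.symm o2 o3)
    rcases o2.eq_or_lt with k2 | k2
    · exact h2 (mem_seg_of_orient hr1 k2.symm o3 o1)
    rcases o3.eq_or_lt with k3 | k3
    · exact h3 (mem_seg_of_orient hr2 k3.symm o1 o2)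
    · exact absurd (by rw [← convexHull_eq_triSet h]; exact interior_convexHull_of_pos k1 k2 k3) hz2

/-! ### Triangulations -/

lemma IsTriangulation.isDrawing (hT : IsTriangulation Ω T) : IsDrawing T :=
  ⟨hT.nonCrossing, fun e he => (hT.isEdge e he).primitive⟩

lemma image_corners (a b c : LatticePoint) : pt '' corners a b c = {pt a, pt b, pt c} := by
  simp [corners, Set.image_insert_eq]

/-- An empty triangle with primitive sides is unimodular. This form of the covering, with positive
orientation, is the one on which the later arguments rest. -/
lemma IsTriangulation.cover (hT : IsTriangulation Ω T) {x : ℂ} (hx : x ∈ region Ω) :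
    ∃ a b c, Tri T a b c ∧ x ∈ triSet a b c := by
  have pos : ∀ a b c, IsFacet T a b c → 0 < area a b c →
      x ∈ convexHull ℝ (pt '' corners a b c) → ∃ a b c, Tri T a b c ∧ x ∈ triSet a b c := by
    intro a b c hF hpos hx
    rw [image_corners, convexHull_eq_triSet hpos] at hx
    refine ⟨a, b, c, ⟨hF.mem_ab, hF.mem_bc, hF.mem_ca,
      area_eq_one_of_empty (hT.isEdge _ hF.mem_ab).primitive hpos ?_⟩, hx⟩
    intro v hv
    have := hF.empty v (by rwa [image_corners, convexHull_eq_triSet hpos])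
    simpa [corners] using this
  obtain ⟨a, b, c, hF, hx⟩ := hT.facets_cover x hx
  rcases lt_trichotomy (area a b c) 0 with h | h | h
  · have hcor : corners b a c = corners a b c := Set.insert_comm _ _ _
    refine pos b a c ⟨?_, ?_, ?_, ?_, ?_⟩ (by rw [area_swap]; omega) (by rwa [hcor])
    · rw [Sym2.eq_swap]; exact hF.mem_ab
    · rw [Sym2.eq_swap]; exact hF.mem_ca
    · rw [Sym2.eq_swap]; exact hF.mem_bc
    · rw [hcor]; exact hF.not_collinear
    · rw [hcor]; exact hF.empty
  · exfalso
    apply hF.not_collinear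
    obtain ⟨k, k1, k2⟩ := exists_mul_of_parallel
      (isPrimitive_mk.1 (hT.isEdge _ hF.mem_ab).primitive) h
    rw [image_corners, collinear_iff_of_mem (p₀ := pt a) (by simp)]
    refine ⟨pt b - pt a, ?_⟩
    rintro p (rfl | rfl | rfl)
    · exact ⟨0, by simp⟩
    · exact ⟨1, by simp⟩
    · refine ⟨k, ?_⟩
      have k1' : (c.1 - a.1 : ℝ) = k * (b.1 - a.1) := by exact_mod_cast k1
      have k2' : (c.2 - a.2 : ℝ) = k * (b.2 - a.2) := by exact_mod_cast k2
      apply ext_coord <;>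
        simp only [vadd_eq_add, map_add, map_sub, map_smul, smul_eq_mul, coordX_pt, coordY_pt] <;>
        linarith
  · exact pos a b c hF h hx

lemma Tri.isFacet {a b c : LatticePoint} (h : Tri T a b c) : IsFacet T a b c := by
  have hpos : 0 < area a b c := by rw [h.area_eq]; norm_num
  refine ⟨h.mem_ab, h.mem_bc, h.mem_ca, ?_, ?_⟩
  · intro hcol
    rw [image_corners, collinear_iff_of_mem (p₀ := pt a) (by simp)] at hcol
    obtain ⟨v, hv⟩ := hcol
    obtain ⟨r, hr⟩ := hv (pt b) (by simp)
    obtain ⟨s, hs⟩ := hv (pt c) (by simp)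
    have e1 := congrArg coordX hr
    have e2 := congrArg coordY hr
    have e3 := congrArg coordX hs
    have e4 := congrArg coordY hs
    simp only [vadd_eq_add, map_add, map_smul, smul_eq_mul, coordX_pt, coordY_pt] at e1 e2 e3 e4
    have : ((area a b c : ℤ) : ℝ) = 0 := by
      simp only [area]; push_cast; rw [e1, e2, e3, e4]; ring
    rw [h.area_eq] at this
    norm_num at this
  · intro v hv
    rw [image_corners, convexHull_eq_triSet hpos] at hv
    simpa [corners] using eq_corner_of_mem_triSet h.area_eq hv

/-- The midpoint of any edge in the polygon is the midpoint of an edge of the triangulation. -/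
lemma IsTriangulation.exists_mid_eq (hT : IsTriangulation Ω T) {e : Sym2 LatticePoint}
    (he : IsEdge Ω e) : ∃ a b c, Tri T a b c ∧ mid e = mid s(a, b) := by
  obtain ⟨a, b, c, h, hm⟩ := hT.cover (he.seg_subset (openSeg_subset_seg _ (mid_mem e)))
  rcases mid_eq_of_mem_triSet h.area_eq he.primitive hm with k | k | k
  · exact ⟨_, _, _, h, k⟩
  · exact ⟨_, _, _, h.rotate, k⟩
  · exact ⟨_, _, _, h.rotate.rotate, k⟩

/-- Every triangulation contains the edges along the polygon. -/
lemma IsTriangulation.mem_of_subset_boundary (hT : IsTriangulation Ω T) {e : Sym2 LatticePoint}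
    (he : IsEdge Ω e) (hb : openSeg e ⊆ Ω.boundary ℝ) : e ∈ T := by
  have hinf : (openSeg e).Infinite := by
    have hp := he.primitive
    induction e with | h a b =>
    have hne := hp.ne
    rw [openSeg_mk, openSegment_eq_image_lineMap]
    refine (Set.Ioo_infinite (by norm_num)).image ?_
    exact (AffineMap.lineMap_injective ℝ (fun h => hne (pt_injective h))).injOn
  have hcov : openSeg e ⊆ ⋃ f ∈ T, (openSeg e ∩ seg f) := by
    intro z hz
    obtain ⟨f, hf, hzf⟩ := Set.mem_iUnion₂.1 (hT.boundary_subset (hb hz))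
    exact Set.mem_iUnion₂.2 ⟨f, hf, hz, hzf⟩
  -- Finitely many edges of `T` cover the infinite set `openSeg e`. Sharing two points with one of
  -- them forces the same line, and primitive segments on one line that meet inside coincide.
  have : ∃ f ∈ T, (openSeg e ∩ seg f).Infinite := by
    by_contra hcon
    push Not at hcon
    exact hinf ((Set.Finite.biUnion T.finite_toSet hcon).subset hcov)
  obtain ⟨f, hf, hfin⟩ := this
  have hpe := he.primitive
  have hpf := (hT.isEdge f hf).primitive
  have hnt : (openSeg e ∩ openSeg f).Infinite := by
    induction f with | h c d =>
    refine (hfin.sdiff (Set.toFinite {pt c, pt d})).mono ?_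
    rintro z ⟨⟨h1, h2⟩, h3⟩
    rw [mem_seg_iff] at h2
    simp only [Set.mem_insert_iff, Set.mem_singleton_iff, not_or] at h3
    exact ⟨h1, by tauto⟩
  obtain ⟨z, hz, w, hw, hzw⟩ := hnt.nontrivial
  suffices e = f by rwa [this]
  induction e with | h a b =>
  induction f with | h c d =>
  refine eq_of_parallel hpe hpf ?_ hz.1 hz.2
  by_contra hpar
  apply hzw
  have o1 := orient_eq_zero_of_mem_seg (openSeg_subset_seg _ hz.1)
  have o2 := orient_eq_zero_of_mem_seg (openSeg_subset_seg _ hz.2)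
  have o3 := orient_eq_zero_of_mem_seg (openSeg_subset_seg _ hw.1)
  have o4 := orient_eq_zero_of_mem_seg (openSeg_subset_seg _ hw.2)
  have hpar' : ((b.1 - a.1) * (d.2 - c.2) - (b.2 - a.2) * (d.1 - c.1) : ℝ) ≠ 0 := by
    exact_mod_cast hpar
  simp only [orient] at o1 o2 o3 o4
  apply ext_coord <;> apply mul_left_cancel₀ hpar'
  · linear_combination (d.1 - c.1 : ℝ) * (o1 - o3) - (b.1 - a.1 : ℝ) * (o2 - o4)
  · linear_combination (d.2 - c.2 : ℝ) * (o1 - o3) - (b.2 - a.2 : ℝ) * (o2 - o4)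

lemma Tri.finite (T : Finset (Sym2 LatticePoint)) :
    {t : LatticePoint × LatticePoint × LatticePoint | Tri T t.1 t.2.1 t.2.2}.Finite := by
  set V := T.biUnion Sym2.toFinset
  refine (V ×ˢ V ×ˢ V).finite_toSet.subset ?_
  rintro ⟨a, b, c⟩ h
  simp only [Finset.coe_product, Set.mem_prod, Finset.mem_coe]
  refine ⟨?_, ?_, ?_⟩
  · exact Finset.mem_biUnion.2 ⟨_, h.mem_ab, by simp⟩
  · exact Finset.mem_biUnion.2 ⟨_, h.mem_ab, by simp⟩
  · exact Finset.mem_biUnion.2 ⟨_, h.mem_bc, by simp⟩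

/-- An edge of a triangulation that is not on the polygon is a side of a triangle on its left. -/
lemma IsTriangulation.exists_tri (hT : IsTriangulation Ω T) {a b : LatticePoint}
    (he : s(a, b) ∈ T) (hb : Disjoint (openSeg s(a, b)) (Ω.boundary ℝ)) : ∃ c, Tri T a b c := by
  set m := mid s(a, b) with hm
  have hmem : m ∈ openSeg s(a, b) := mid_mem _
  have hpr := (hT.isEdge _ he).primitive
  set ν : ℂ := pt (-(b.2 - a.2), b.1 - a.1) with hν
  have hlin : ∀ t : ℝ, orient a b (m + t • ν) =
      t * ((b.1 - a.1) ^ 2 + (b.2 - a.2) ^ 2) := by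
    intro t
    have : orient a b m = 0 := orient_eq_zero_of_mem_seg (openSeg_subset_seg _ hmem)
    simp only [orient] at this
    simp only [orient, map_add, map_smul, hν, coordX_pt, coordY_pt, smul_eq_mul]
    push_cast
    linear_combination this
  have hpos : (0:ℝ) < (b.1 - a.1) ^ 2 + (b.2 - a.2) ^ 2 := by
    have hne := hpr.ne
    have : (0:ℤ) < (b.1 - a.1) ^ 2 + (b.2 - a.2) ^ 2 := by
      by_contra hcon
      have h1 : b.1 - a.1 = 0 := by nlinarith
      have h2 : b.2 - a.2 = 0 := by nlinarith
      exact hne (Prod.ext (by linarith) (by linarith))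
    exact_mod_cast this
  have hclosed : IsClosed (⋃ t ∈ {t : LatticePoint × LatticePoint × LatticePoint |
      Tri T t.1 t.2.1 t.2.2 ∧ m ∉ triSet t.1 t.2.1 t.2.2}, triSet t.1 t.2.1 t.2.2) :=
    ((Tri.finite T).subset fun t ht => ht.1).isClosed_biUnion fun t _ => isClosed_triSet _ _ _
  have hnb : (⋃ t ∈ {t : LatticePoint × LatticePoint × LatticePoint |
      Tri T t.1 t.2.1 t.2.2 ∧ m ∉ triSet t.1 t.2.1 t.2.2}, triSet t.1 t.2.1 t.2.2)ᶜ ∈ nhds m := by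
    apply hclosed.isOpen_compl.mem_nhds
    intro hmU
    obtain ⟨t, ht, hmt⟩ := Set.mem_iUnion₂.1 hmU
    exact ht.2 hmt
  have hreg : region Ω \ Ω.boundary ℝ ∈ nhds m :=
    (isOpen_region_diff_boundary Ω).mem_nhds
      ⟨(hT.isEdge _ he).seg_subset (openSeg_subset_seg _ hmem), Set.disjoint_left.1 hb hmem⟩
  -- A small step from the midpoint to the left stays inside the region and avoids all triangles
  -- that do not contain `m`. The triangle covering the displaced point therefore has `m` as
  -- midpoint of a side, and lies to the left.
  have hcont : Filter.Tendsto (fun t : ℝ => m + t • ν) (nhdsWithin 0 (Set.Ioi 0)) (nhds m) := by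
    have : Continuous (fun t : ℝ => m + t • ν) := by fun_prop
    have h0 := this.tendsto 0
    simp only [zero_smul, add_zero] at h0
    exact h0.mono_left nhdsWithin_le_nhds
  obtain ⟨t, ⟨ht1, ht2⟩, ht0⟩ := ((hcont.eventually (Filter.inter_mem hreg hnb)).and
    self_mem_nhdsWithin).exists
  have ht0' : (0:ℝ) < t := ht0
  obtain ⟨a', b', c', htri, hzt⟩ := hT.cover ht1.1
  have hmt : m ∈ triSet a' b' c' := by
    by_contra hcon
    exact ht2 (Set.mem_iUnion₂.2 ⟨(a', b', c'), ⟨htri, hcon⟩, hzt⟩)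
  have key : ∀ a' b' c', Tri T a' b' c' → m + t • ν ∈ triSet a' b' c' →
      m = mid s(a', b') → ∃ c, Tri T a b c := by
    intro a' b' c' htri hzt hmid
    rcases Sym2.eq_iff.1 (hT.isDrawing.eq_of_mid_eq he htri.mem_ab hmid) with
      ⟨rfl, rfl⟩ | ⟨rfl, rfl⟩
    · exact ⟨_, htri⟩
    · exfalso
      have := hzt.1
      rw [orient_swap, hlin] at this
      have := mul_pos ht0' hpos
      linarith
  rcases mid_eq_of_mem_triSet htri.area_eq hpr hmt with k | k | k
  · exact key _ _ _ htri hzt k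
  · exact key _ _ _ htri.rotate (by rwa [triSet_rotate]) k
  · exact key _ _ _ htri.rotate.rotate (by rwa [triSet_rotate, triSet_rotate]) k

/-! ### Flips in parallelograms -/

/-- `a b c d` is a positively oriented unimodular parallelogram. -/
structure IsPar (a b c d : LatticePoint) : Prop where
  sum_eq : a + c = b + d
  area_eq : area a b c = 1

lemma IsPar.fst {a b c d : LatticePoint} (h : IsPar a b c d) : d.1 = a.1 + c.1 - b.1 := by
  have := congrArg Prod.fst h.sum_eq; simp at this; linarith

lemma IsPar.snd {a b c d : LatticePoint} (h : IsPar a b c d) : d.2 = a.2 + c.2 - b.2 := by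
  have := congrArg Prod.snd h.sum_eq; simp at this; linarith

lemma IsPar.rotate {a b c d : LatticePoint} (h : IsPar a b c d) : IsPar b c d a := by
  refine ⟨by rw [← h.sum_eq, add_comm], ?_⟩
  rw [← h.area_eq]; simp only [area, h.fst, h.snd]; ring

/-- The flip exchanges the diagonals of a unimodular parallelogram. -/
def Flip.IsPara (f : Flip) : Prop :=
  ∃ a b c d, IsPar a b c d ∧ f = ⟨s(a, c), s(b, d)⟩

/-- The sides of the quadrilateral of a flip. -/
def Flip.sides (f : Flip) : Set (Sym2 LatticePoint) :=
  {e | ∃ x ∈ f.removed, ∃ y ∈ f.added, e = s(x, y)}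

lemma sides_subset_iff {a b c d : LatticePoint} {S : Set (Sym2 LatticePoint)} :
    Flip.sides ⟨s(a, c), s(b, d)⟩ ⊆ S ↔
      s(a, b) ∈ S ∧ s(b, c) ∈ S ∧ s(c, d) ∈ S ∧ s(d, a) ∈ S := by
  constructor
  · intro h
    refine ⟨h ⟨a, by simp, b, by simp, rfl⟩, h ⟨c, by simp, b, by simp, Sym2.eq_swap⟩,
      h ⟨c, by simp, d, by simp, rfl⟩, h ⟨a, by simp, d, by simp, Sym2.eq_swap⟩⟩
  · rintro ⟨h1, h2, h3, h4⟩ e ⟨x, hx, y, hy, rfl⟩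
    simp only [Sym2.mem_iff] at hx hy
    rcases hx with rfl | rfl <;> rcases hy with rfl | rfl
    · exact h1
    · rwa [Sym2.eq_swap]
    · rwa [Sym2.eq_swap]
    · exact h3

/-- The flip can be performed on `T`. -/
structure Flip.Applies (Ω : Polygon ℂ n) (T : Finset (Sym2 LatticePoint)) (f : Flip) : Prop where
  isPara : f.IsPara
  removed_mem : f.removed ∈ T
  sides_subset : f.sides ⊆ T
  disjoint_boundary : Disjoint (openSeg f.removed) (Ω.boundary ℝ)

/-- The result of performing a flip. -/
def Flip.perform (f : Flip) (T : Finset (Sym2 LatticePoint)) : Finset (Sym2 LatticePoint) :=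
  insert f.added (T.erase f.removed)

lemma exists_normal {a b : LatticePoint} (h : a ≠ b) :
    ∃ (ν : ℂ) (δ : ℝ), 0 < δ ∧ ∀ z (t : ℝ), orient a b (z + t • ν) = orient a b z + t * δ := by
  refine ⟨pt (-(b.2 - a.2), b.1 - a.1), (b.1 - a.1) ^ 2 + (b.2 - a.2) ^ 2, ?_, ?_⟩
  · have : (0:ℤ) < (b.1 - a.1) ^ 2 + (b.2 - a.2) ^ 2 := by
      by_contra hcon
      have h1 : b.1 - a.1 = 0 := by nlinarith
      have h2 : b.2 - a.2 = 0 := by nlinarith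
      exact h (Prod.ext (by linarith) (by linarith))
    exact_mod_cast this
  · intro z t
    simp only [orient, map_add, map_smul, coordX_pt, coordY_pt, smul_eq_mul]
    push_cast
    ring

/-- An interior point can be pushed a little towards the line `ab` and stay in `S`, so its height
cannot be 0. -/
lemma orient_pos_of_mem_interior {a b : LatticePoint} (h : a ≠ b) {S : Set ℂ}
    (hS : ∀ z ∈ S, 0 ≤ orient a b z) {z : ℂ} (hz : z ∈ interior S) : 0 < orient a b z := by
  obtain ⟨ν, δ, hδ, hν⟩ := exists_normal h
  have hcont : Filter.Tendsto (fun t : ℝ => z + t • ν) (nhdsWithin 0 (Set.Iio 0)) (nhds z) := by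
    have : Continuous (fun t : ℝ => z + t • ν) := by fun_prop
    have h0 := this.tendsto 0
    simp only [zero_smul, add_zero] at h0
    exact h0.mono_left nhdsWithin_le_nhds
  obtain ⟨t, ht, ht0⟩ := ((hcont.eventually (mem_interior_iff_mem_nhds.1 hz)).and
    self_mem_nhdsWithin).exists
  have ht0' : t < (0:ℝ) := ht0
  have := hS _ ht
  rw [hν] at this
  nlinarith

section Parallelogram

variable {a b c d : LatticePoint}

lemma IsPar.tri_left (h : IsPar a b c d) (h1 : s(a, b) ∈ T) (h2 : s(b, c) ∈ T)
    (h3 : s(a, c) ∈ T) : Tri T a b c := ⟨h1, h2, by rwa [Sym2.eq_swap], h.area_eq⟩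

lemma IsPar.tri_right (h : IsPar a b c d) (h1 : s(c, d) ∈ T) (h2 : s(d, a) ∈ T)
    (h3 : s(a, c) ∈ T) : Tri T a c d :=
  ⟨h3, h1, h2, by rw [← area_rotate]; exact h.rotate.rotate.area_eq⟩

/-- Opposite sides are parallel at lattice distance 1, so no lattice point lies strictly between
their lines. -/
lemma IsPar.orient_add (h : IsPar a b c d) (z : ℂ) : orient a b z + orient c d z = 1 := by
  have h1 : ((area a b c : ℤ) : ℝ) = 1 := by exact_mod_cast h.area_eq
  rw [← h1]
  simp only [orient, area, h.fst, h.snd]; push_cast; ring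

/-- The open segment of the other diagonal lies inside the parallelogram. -/
lemma IsPar.orient_pos (h : IsPar a b c d) {z : ℂ} (hz : z ∈ openSeg s(b, d)) :
    0 < orient a b z ∧ 0 < orient b c z ∧ 0 < orient c d z ∧ 0 < orient d a z := by
  obtain ⟨s, t, hs, ht, hst, -, ho⟩ := exists_comb_of_mem_openSeg hz
  have e1 : area a b d = 1 := by
    rw [← area_rotate, ← area_rotate]; exact h.rotate.rotate.rotate.area_eq
  have e2 : area b c d = 1 := h.rotate.area_eq
  have e3 : area c d b = 1 := by rw [area_rotate]; exact e2
  have e4 : area d a b = 1 := h.rotate.rotate.rotate.area_eq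
  rw [ho, ho, ho, ho]
  simp [e1, e2, e3, e4, hs, ht]

lemma IsPar.convexHull_subset (h : IsPar a b c d) {z : ℂ}
    (hz : z ∈ convexHull ℝ ({pt a, pt b, pt c, pt d} : Set ℂ)) : 0 ≤ orient a b z := by
  have hconv : Convex ℝ {z | 0 ≤ orient a b z} := by
    intro x hx y hy s t hs ht hst
    simp only [Set.mem_ofPred_eq, orient_comb _ _ _ _ hst] at *
    positivity
  have e1 : area a b d = 1 := by
    rw [← area_rotate, ← area_rotate]; exact h.rotate.rotate.rotate.area_eq
  refine convexHull_min ?_ hconv hz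
  rintro w (rfl | rfl | rfl | rfl) <;> simp [h.area_eq, e1]

lemma insert_rotate : ({pt b, pt c, pt d, pt a} : Set ℂ) = {pt a, pt b, pt c, pt d} := by
  ext z; simp only [Set.mem_insert_iff, Set.mem_singleton_iff]; tauto

lemma IsPar.ne (h : IsPar a b c d) : a ≠ b := by
  rintro rfl; have := h.area_eq; simp at this

lemma IsPar.interior_convexHull (h : IsPar a b c d) {z : ℂ}
    (hz : z ∈ interior (convexHull ℝ ({pt a, pt b, pt c, pt d} : Set ℂ))) :
    0 < orient a b z ∧ 0 < orient b c z ∧ 0 < orient c d z ∧ 0 < orient d a z := by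
  refine ⟨orient_pos_of_mem_interior h.ne (fun _ => h.convexHull_subset) hz,
    orient_pos_of_mem_interior h.rotate.ne (fun w hw => h.rotate.convexHull_subset ?_) hz,
    orient_pos_of_mem_interior h.rotate.rotate.ne
      (fun w hw => h.rotate.rotate.convexHull_subset ?_) hz,
    orient_pos_of_mem_interior h.rotate.rotate.rotate.ne
      (fun w hw => h.rotate.rotate.rotate.convexHull_subset ?_) hz⟩
  · rwa [insert_rotate]
  · rwa [insert_rotate, insert_rotate]
  · rwa [insert_rotate, insert_rotate, insert_rotate]

/-- Lattice points do not lie inside a unimodular parallelogram. -/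
lemma IsPar.not_pos_pt (h : IsPar a b c d) {v : LatticePoint} (h1 : 0 < orient a b (pt v))
    (h3 : 0 < orient c d (pt v)) : False := by
  have := h.orient_add (pt v)
  simp only [orient_pt] at h1 h3 this
  norm_cast at h1 h3 this
  omega

/-- The midpoint is the invariant of a flip; it identifies the edge before with the edge after. -/
lemma IsPar.mid_eq (h : IsPar a b c d) : mid s(a, c) = mid s(b, d) := by
  have e1 : (d.1 : ℝ) = a.1 + c.1 - b.1 := by exact_mod_cast h.fst
  have e2 : (d.2 : ℝ) = a.2 + c.2 - b.2 := by exact_mod_cast h.snd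
  apply ext_coord <;>
    simp only [mid_mk, map_add, map_smul, smul_eq_mul, coordX_pt, coordY_pt, e1, e2] <;> ring

lemma IsPar.diag_ne (h : IsPar a b c d) : s(a, c) ≠ s(b, d) := by
  intro he
  rcases Sym2.eq_iff.1 he with ⟨rfl, rfl⟩ | ⟨rfl, rfl⟩
  · exact h.ne rfl
  · exact h.rotate.ne rfl

/-- An edge other than the diagonal does not meet the interior of a parallelogram. -/
lemma IsDrawing.notMem_parallelogram (hT : IsDrawing T) (h : IsPar a b c d) (h1 : s(a, b) ∈ T)
    (h2 : s(b, c) ∈ T) (h3 : s(c, d) ∈ T) (h4 : s(d, a) ∈ T) (h5 : s(a, c) ∈ T)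
    {e : Sym2 LatticePoint} (he : e ∈ T) (hne : e ≠ s(a, c)) {z : ℂ} (hz : z ∈ seg e)
    (ho : 0 < orient a b z ∧ 0 < orient b c z ∧ 0 < orient c d z ∧ 0 < orient d a z) : False := by
  obtain ⟨o1, o2, o3, o4⟩ := ho
  induction e with | h p q =>
  rcases (mem_seg_iff p q z).1 hz with rfl | rfl | hz
  · exact h.not_pos_pt o1 o3
  · exact h.not_pos_pt o1 o3
  · exact hne (hT.eq_diagonal (h.tri_left h1 h2 h5) (h.tri_right h3 h4 h5) he hz o1 o2 o3 o4)

/-- The polygon is covered by edges of `T`, and the only one that meets the interior of the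
parallelogram is the old diagonal, which is off the polygon. -/
lemma IsTriangulation.disjoint_added (hT : IsTriangulation Ω T) (h : IsPar a b c d)
    (h1 : s(a, b) ∈ T) (h2 : s(b, c) ∈ T) (h3 : s(c, d) ∈ T) (h4 : s(d, a) ∈ T)
    (h5 : s(a, c) ∈ T) (hb : Disjoint (openSeg s(a, c)) (Ω.boundary ℝ)) :
    Disjoint (openSeg s(b, d)) (Ω.boundary ℝ) := by
  rw [Set.disjoint_left]
  intro z hz hzb
  obtain ⟨f, hf, hzf⟩ := Set.mem_iUnion₂.1 (hT.boundary_subset hzb)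
  have ho := h.orient_pos hz
  by_cases hfa : f = s(a, c)
  · subst hfa
    rcases (mem_seg_iff _ _ z).1 hzf with rfl | rfl | hz'
    · exact h.not_pos_pt ho.1 ho.2.2.1
    · exact h.not_pos_pt ho.1 ho.2.2.1
    · exact Set.disjoint_left.1 hb hz' hzb
  · exact hT.isDrawing.notMem_parallelogram h h1 h2 h3 h4 h5 hf hfa hzf ho

/-- By `IsDrawing.tri_unique` the only triangles lost are the two on `ac`. Their union is the
parallelogram, which `bd` divides into two unimodular triangles again. -/
lemma IsTriangulation.perform_isTriangulation (hT : IsTriangulation Ω T) (h : IsPar a b c d)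
    (h1 : s(a, b) ∈ T) (h2 : s(b, c) ∈ T) (h3 : s(c, d) ∈ T) (h4 : s(d, a) ∈ T)
    (h5 : s(a, c) ∈ T) (hb : Disjoint (openSeg s(a, c)) (Ω.boundary ℝ)) :
    IsTriangulation Ω (insert s(b, d) (T.erase s(a, c))) := by
  have hD := hT.isDrawing
  have t1 := h.tri_left h1 h2 h5
  have t2 := h.tri_right h3 h4 h5
  have hsub : ∀ {x y : LatticePoint}, s(x, y) ∈ T → seg s(x, y) ⊆ region Ω :=
    fun hx => (hT.isEdge _ hx).seg_subset
  have hswap : orient a c = fun z => - orient c a z := by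
    funext z; exact orient_swap _ _ _
  have e1 : area a b d = 1 := by
    rw [← area_rotate, ← area_rotate]; exact h.rotate.rotate.rotate.area_eq
  have e2 : area b c d = 1 := h.rotate.area_eq
  have n1 : s(a, b) ≠ s(a, c) := by
    intro he; rcases Sym2.eq_iff.1 he with ⟨-, h'⟩ | ⟨-, h'⟩
    · exact h.rotate.ne h'
    · exact h.ne h'.symm
  have n2 : s(b, c) ≠ s(a, c) := by
    intro he; rcases Sym2.eq_iff.1 he with ⟨h', -⟩ | ⟨h', -⟩
    · exact h.ne h'.symm
    · exact h.rotate.ne h'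
  have n3 : s(c, d) ≠ s(a, c) := by
    intro he; rcases Sym2.eq_iff.1 he with ⟨-, h'⟩ | ⟨-, h'⟩
    · exact h.rotate.rotate.ne h'.symm
    · exact h.rotate.rotate.rotate.ne h'
  have n4 : s(d, a) ≠ s(a, c) := by
    intro he; rcases Sym2.eq_iff.1 he with ⟨h', -⟩ | ⟨h', -⟩
    · exact h.rotate.rotate.rotate.ne h'
    · exact h.rotate.rotate.ne h'.symm
  refine ⟨?_, ?_, ?_, ?_⟩
  · intro e he
    rw [Finset.mem_insert, Finset.mem_erase] at he
    rcases he with rfl | ⟨-, he⟩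
    · refine ⟨isPrimitive_of_area (c := a) (by rw [area_rotate]; exact e1), ?_,
        Or.inr (hT.disjoint_added h h1 h2 h3 h4 h5 hb)⟩
      intro z hz
      rcases (mem_seg_iff _ _ z).1 hz with rfl | rfl | hz
      · exact hsub h1 (right_mem_segment ℝ _ _)
      · exact hsub h3 (right_mem_segment ℝ _ _)
      obtain ⟨o1, o2, o3, o4⟩ := h.orient_pos hz
      rcases le_total (orient a c z) 0 with hs | hs
      · refine triSet_subset_region (by rw [t1.area_eq]; norm_num) (hsub t1.mem_ab)
          (hsub t1.mem_bc) (hsub t1.mem_ca) ⟨o1.le, o2.le, ?_⟩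
        rw [hswap] at hs; linarith
      · exact triSet_subset_region (by rw [t2.area_eq]; norm_num) (hsub t2.mem_ab)
          (hsub t2.mem_bc) (hsub t2.mem_ca) ⟨hs, o3.le, o4.le⟩
    · exact hT.isEdge e he
  · have key : ∀ e ∈ T.erase s(a, c), Disjoint (openSeg s(b, d)) (openSeg e) := by
      intro e he
      rw [Finset.mem_erase] at he
      rw [Set.disjoint_left]
      intro z hz hze
      exact hD.notMem_parallelogram h h1 h2 h3 h4 h5 he.2 he.1 (openSeg_subset_seg _ hze)
        (h.orient_pos hz)
    intro e he f hf hef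
    rw [Finset.mem_insert] at he hf
    rcases he with rfl | he <;> rcases hf with rfl | hf
    · exact absurd rfl hef
    · exact key f hf
    · exact (key e he).symm
    · exact hT.nonCrossing e (Finset.mem_of_mem_erase he) f (Finset.mem_of_mem_erase hf) hef
  · intro z hz
    obtain ⟨e, he, hze⟩ := Set.mem_iUnion₂.1 (hT.boundary_subset hz)
    by_cases hea : e = s(a, c)
    · subst hea
      rcases (mem_seg_iff _ _ z).1 hze with rfl | rfl | hz'
      · exact Set.mem_iUnion₂.2 ⟨s(a, b), by simp [n1, h1], left_mem_segment ℝ _ _⟩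
      · exact Set.mem_iUnion₂.2 ⟨s(c, d), by simp [n3, h3], left_mem_segment ℝ _ _⟩
      · exact absurd hz (Set.disjoint_left.1 hb hz')
    · exact Set.mem_iUnion₂.2 ⟨e, by simp [hea, he], hze⟩
  · have t1' : Tri (insert s(b, d) (T.erase s(a, c))) d a b := by
      refine ⟨by simp [n4, h4], by simp [n1, h1], by simp, by rw [← area_rotate]; exact e1⟩
    have t2' : Tri (insert s(b, d) (T.erase s(a, c))) b c d := by
      refine ⟨by simp [n2, h2], by simp [n3, h3], by simp [Sym2.eq_swap], e2⟩
    have fin : ∀ {x y z : LatticePoint} {w : ℂ}, Tri (insert s(b, d) (T.erase s(a, c))) x y z →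
        w ∈ triSet x y z → ∃ a' b' c', IsFacet (insert s(b, d) (T.erase s(a, c))) a' b' c' ∧
          w ∈ convexHull ℝ (pt '' corners a' b' c') := by
      intro x y z w ht hw
      refine ⟨x, y, z, ht.isFacet, ?_⟩
      rwa [image_corners, convexHull_eq_triSet (by rw [ht.area_eq]; norm_num)]
    have quad : ∀ w, 0 ≤ orient a b w → 0 ≤ orient b c w → 0 ≤ orient c d w →
        0 ≤ orient d a w → ∃ a' b' c', IsFacet (insert s(b, d) (T.erase s(a, c))) a' b' c' ∧
          w ∈ convexHull ℝ (pt '' corners a' b' c') := by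
      intro w o1 o2 o3 o4
      have hbd : orient d b w = - orient b d w := orient_swap _ _ _
      rcases le_total (orient b d w) 0 with hs | hs
      · exact fin t2' ⟨o2, o3, by linarith⟩
      · exact fin t1' ⟨o4, o1, hs⟩
    have diag : ∀ x y z w, Tri T x y z → w ∈ triSet x y z → s(x, y) = s(a, c) →
        ∃ a' b' c', IsFacet (insert s(b, d) (T.erase s(a, c))) a' b' c' ∧
          w ∈ convexHull ℝ (pt '' corners a' b' c') := by
      intro x y z w ht hw hxy
      rcases Sym2.eq_iff.1 hxy with ⟨rfl, rfl⟩ | ⟨rfl, rfl⟩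
      · obtain rfl := hD.tri_unique ht t2
        obtain ⟨o1, o2, o3⟩ := hw
        have k1 := h.orient_add w
        have k2 := h.rotate.orient_add w
        have k3 := orient_sum x y z w
        rw [ht.area_eq] at k3
        push_cast at k3
        exact quad w (by linarith) (by linarith) o2 o3
      · obtain rfl := hD.tri_unique ht t1.rotate.rotate
        obtain ⟨o1, o2, o3⟩ := hw
        have k1 := h.orient_add w
        have k2 := h.rotate.orient_add w
        have k3 := orient_sum x y z w
        rw [ht.area_eq] at k3
        push_cast at k3
        exact quad w o2 o3 (by linarith) (by linarith)
    intro x hx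
    obtain ⟨p, q, r, ht, hxt⟩ := hT.cover hx
    by_cases k1 : s(p, q) = s(a, c)
    · exact diag _ _ _ _ ht hxt k1
    by_cases k2 : s(q, r) = s(a, c)
    · exact diag _ _ _ _ ht.rotate (by rwa [triSet_rotate]) k2
    by_cases k3 : s(r, p) = s(a, c)
    · exact diag _ _ _ _ ht.rotate.rotate (by rwa [triSet_rotate, triSet_rotate]) k3
    exact fin ⟨by simp [k1, ht.mem_ab], by simp [k2, ht.mem_bc], by simp [k3, ht.mem_ca],
      ht.area_eq⟩ hxt

end Parallelogram

lemma Flip.Applies.isTriangulation_perform {f : Flip} (h : f.Applies Ω T)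
    (hT : IsTriangulation Ω T) : IsTriangulation Ω (f.perform T) := by
  obtain ⟨⟨a, b, c, d, hp, rfl⟩, h1, h2, h3⟩ := h
  obtain ⟨k1, k2, k3, k4⟩ := sides_subset_iff.1 h2
  exact hT.perform_isTriangulation hp k1 k2 k3 k4 h1 h3

lemma Flip.Applies.disjoint_added {f : Flip} (h : f.Applies Ω T)
    (hT : IsTriangulation Ω T) : Disjoint (openSeg f.added) (Ω.boundary ℝ) := by
  obtain ⟨⟨a, b, c, d, hp, rfl⟩, h1, h2, h3⟩ := h
  obtain ⟨k1, k2, k3, k4⟩ := sides_subset_iff.1 h2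
  exact hT.disjoint_added hp k1 k2 k3 k4 h1 h3

/-- Together with `IsFlip.applies`, this replaces the geometric notion of a flip by the presence of
five edges. -/
lemma Flip.Applies.isFlip {f : Flip} (h : f.Applies Ω T) (hT : IsTriangulation Ω T) :
    IsFlip Ω T f (f.perform T) := by
  refine ⟨hT, h.isTriangulation_perform hT, rfl, ?_⟩
  obtain ⟨⟨a, b, c, d, hp, rfl⟩, h1, h2, h3⟩ := h
  obtain ⟨k1, k2, k3, k4⟩ := sides_subset_iff.1 h2
  refine ⟨a, b, c, d, rfl, rfl, ⟨⟨mid s(a, c), mid_mem s(a, c), ?_⟩, ?_⟩, k1, k2, k3, k4, h1, ?_⟩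
  · rw [hp.mid_eq]; exact mid_mem s(b, d)
  · intro hcol
    apply (hp.tri_left k1 k2 h1).isFacet.not_collinear
    rw [image_corners]
    refine hcol.subset ?_
    intro z hz
    simp only [Set.mem_insert_iff, Set.mem_singleton_iff] at hz ⊢
    tauto
  · intro e he hne
    rw [Set.disjoint_left]
    intro z hz hzi
    exact hT.isDrawing.notMem_parallelogram hp k1 k2 k3 k4 h1 he hne hz (hp.interior_convexHull hzi)

/-- If a triangle on the diagonal `ac` of a quadrilateral is not a facet, then one of the edges
of the actual facet meets the interior of the quadrilateral. -/
lemma Tri.eq_of_disjoint_interior {a b c z : LatticePoint} (hpos : 0 < area a b c)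
    (h : Tri T c a z) {H : Set ℂ} (hH : convexHull ℝ {pt a, pt b, pt c} ⊆ H)
    (hdis : ∀ e ∈ T, e ≠ s(a, c) → Disjoint (seg e) (interior H)) : z = b := by
  have hca : area c a b = area a b c := by rw [area_rotate, area_rotate]
  have hzne1 : z ≠ c := by rintro rfl; have := h.area_eq; simp at this
  have hzne2 : z ≠ a := by rintro rfl; have := h.area_eq; simp at this
  have eps : ∀ (x y : ℤ), 0 < x → ∃ ε : ℝ, 0 < ε ∧ ε < 1 ∧ 0 < (1 - ε) * x + ε * y := by
    intro x y hx
    have hx' : (0:ℝ) < x := by exact_mod_cast hx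
    refine ⟨x / (2 * x + |(y:ℝ)|), by positivity, ?_, ?_⟩
    · rw [div_lt_one (by positivity)]; have := abs_nonneg (y:ℝ); linarith
    · have := neg_abs_le (y:ℝ)
      have h0 := abs_nonneg (y:ℝ)
      have hne : 2 * (x:ℝ) + |(y:ℝ)| ≠ 0 := by positivity
      have : (1 - (x:ℝ) / (2 * x + |(y:ℝ)|)) * x + x / (2 * x + |(y:ℝ)|) * y =
          x * (x + |(y:ℝ)| + y) / (2 * x + |(y:ℝ)|) := by field_simp; ring
      rw [this]
      apply div_pos _ (by positivity)
      apply mul_pos hx'; linarith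
  -- Otherwise the edge `az` enters the triangle `abc` at `a`, against `hdis`. Likewise for `zc` at
  -- `c` below.
  have c1 : area a b z ≤ 0 := by
    by_contra hcon
    push Not at hcon
    obtain ⟨ε, hε, hε1, hε2⟩ := eps (area a b c) (area b c z) hpos
    have hst : (1 - ε) + ε = 1 := by ring
    refine Set.disjoint_left.1 (hdis s(a, z) h.mem_bc ?_)
      (show (1 - ε) • pt a + ε • pt z ∈ _ from ⟨1 - ε, ε, by linarith, hε.le, hst, rfl⟩) ?_
    · intro he; rcases Sym2.eq_iff.1 he with ⟨-, h'⟩ | ⟨-, h'⟩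
      · exact hzne1 h'
      · exact hzne2 h'
    · apply interior_mono hH
      apply interior_convexHull_of_pos <;> rw [orient_comb _ _ _ _ hst]
      · have : (0:ℝ) < area a b z := by exact_mod_cast hcon
        simp; positivity
      · simpa [area_rotate] using hε2
      · simp [h.area_eq, hε]
  have c2 : area b c z ≤ 0 := by
    by_contra hcon
    push Not at hcon
    obtain ⟨ε, hε, hε1, hε2⟩ := eps (area a b c) (area a b z) hpos
    have hst : (1 - ε) + ε = 1 := by ring
    refine Set.disjoint_left.1 (hdis s(z, c) h.mem_ca ?_)
      (show (1 - ε) • pt c + ε • pt z ∈ _ from ?_) ?_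
    · intro he; rcases Sym2.eq_iff.1 he with ⟨h', -⟩ | ⟨h', -⟩
      · exact hzne2 h'
      · exact hzne1 h'
    · rw [Sym2.eq_swap]; exact ⟨1 - ε, ε, by linarith, hε.le, hst, rfl⟩
    · apply interior_mono hH
      apply interior_convexHull_of_pos <;> rw [orient_comb _ _ _ _ hst]
      · simpa using hε2
      · have : (0:ℝ) < area b c z := by exact_mod_cast hcon
        simp; positivity
      · simp [h.area_eq, hε]
  -- Now `b` lies in the facet `c a z`, whose only lattice points are its corners.
  have hb : pt b ∈ triSet c a z := by
    refine ⟨?_, ?_, ?_⟩ <;> rw [orient_pt]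
    · rw [hca]; exact_mod_cast hpos.le
    · have : area a z b = - area a b z := by simp only [area]; ring
      rw [this]; exact_mod_cast (by omega)
    · have : area z c b = - area b c z := by simp only [area]; ring
      rw [this]; exact_mod_cast (by omega)
  rcases eq_corner_of_mem_triSet h.area_eq hb with rfl | rfl | rfl
  · simp at hpos
  · simp at hpos
  · rfl

/-- Every flip takes place in a unimodular parallelogram. -/
lemma IsFlip.applies {f : Flip} (h : IsFlip Ω T f T') : f.Applies Ω T := by
  obtain ⟨hT, hT', hTT', a, b, c, d, hr, ha, ⟨⟨y, hy1, hy2⟩, hcol⟩, h1, h2, h3, h4, h5, hint⟩ := h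
  obtain ⟨r, g⟩ := f
  simp only at hr ha
  subst hr ha
  have hbd : s(b, d) ∈ T' := by rw [hTT']; simp
  have hpac := isPrimitive_mk.1 (hT.isEdge _ h5).primitive
  have hpbd := (hT'.isEdge _ hbd).primitive
  have hline : ¬ (area a c b = 0 ∧ area a c d = 0) := by
    rintro ⟨z1, z2⟩
    apply hcol
    obtain ⟨k, k1, k2⟩ := exists_mul_of_parallel hpac z1
    obtain ⟨l, l1, l2⟩ := exists_mul_of_parallel hpac z2
    have k1' : (b.1 - a.1 : ℝ) = k * (c.1 - a.1) := by exact_mod_cast k1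
    have k2' : (b.2 - a.2 : ℝ) = k * (c.2 - a.2) := by exact_mod_cast k2
    have l1' : (d.1 - a.1 : ℝ) = l * (c.1 - a.1) := by exact_mod_cast l1
    have l2' : (d.2 - a.2 : ℝ) = l * (c.2 - a.2) := by exact_mod_cast l2
    rw [collinear_iff_of_mem (p₀ := pt a) (by simp)]
    refine ⟨pt c - pt a, ?_⟩
    rintro p (rfl | rfl | rfl | rfl)
    · exact ⟨0, by simp⟩
    · refine ⟨k, ?_⟩
      apply ext_coord <;>
        simp only [vadd_eq_add, map_add, map_sub, map_smul, smul_eq_mul, coordX_pt, coordY_pt] <;>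
        linarith
    · exact ⟨1, by simp⟩
    · refine ⟨l, ?_⟩
      apply ext_coord <;>
        simp only [vadd_eq_add, map_add, map_sub, map_smul, smul_eq_mul, coordX_pt, coordY_pt] <;>
        linarith
  -- If `ac` ran along the polygon, so would `bd`, as it meets `ac` inside. Then `bd` would already
  -- belong to `T`, where it crosses `ac`.
  have hdis : Disjoint (openSeg s(a, c)) (Ω.boundary ℝ) := by
    rcases (hT.isEdge _ h5).boundary with hb | hb
    · exfalso
      have hb' : openSeg s(b, d) ⊆ Ω.boundary ℝ := by
        rcases (hT'.isEdge _ hbd).boundary with hb' | hb'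
        · exact hb'
        · exact absurd (hb hy1) (Set.disjoint_left.1 hb' hy2)
      have hbdT := hT.mem_of_subset_boundary (hT'.isEdge _ hbd) hb'
      have := hT.isDrawing.eq_of_mem h5 hbdT hy1 hy2
      rcases Sym2.eq_iff.1 this with ⟨rfl, rfl⟩ | ⟨rfl, rfl⟩ <;> simp at hline
    · exact hb
  obtain ⟨s, t, hs, ht, hst, rfl⟩ := id hy2
  have hy0 := orient_eq_zero_of_mem_seg (openSeg_subset_seg s(a, c) hy1)
  rw [orient_comb _ _ _ _ hst, orient_pt, orient_pt] at hy0
  have core : ∀ b d : LatticePoint, ∀ s t : ℝ, 0 < s → 0 < t → s + t = 1 →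
      s * area a c b + t * area a c d = 0 → 0 < area a b c →
      s • pt b + t • pt d ∈ openSegment ℝ (pt a) (pt c) →
      (∀ e ∈ T, e ≠ s(a, c) →
        Disjoint (seg e) (interior (convexHull ℝ ({pt a, pt b, pt c, pt d} : Set ℂ)))) →
      s(a, b) ∈ T → s(b, c) ∈ T → s(c, d) ∈ T → s(d, a) ∈ T →
      Flip.Applies Ω T ⟨s(a, c), s(b, d)⟩ := by
    intro b d s t hs ht hst hy0 hpos hy1 hint h1 h2 h3 h4
    have eb : area a c b = - area a b c := by simp only [area]; ring
    have hdpos : 0 < area c d a := by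
      have ed : area c d a = area a c d := area_rotate _ _ _
      have : (0:ℝ) < area a b c := by exact_mod_cast hpos
      rw [ed]
      rw [eb] at hy0
      push_cast at hy0
      have : (0:ℝ) < area a c d := by
        by_contra hcon
        nlinarith
      exact_mod_cast this
    obtain ⟨z, hz⟩ := hT.exists_tri (a := c) (b := a) (by rwa [Sym2.eq_swap])
      (by rwa [Sym2.eq_swap])
    obtain ⟨w, hw⟩ := hT.exists_tri h5 hdis
    have hsub1 : ({pt a, pt b, pt c} : Set ℂ) ⊆ {pt a, pt b, pt c, pt d} := by
      intro v hv; simp only [Set.mem_insert_iff, Set.mem_singleton_iff] at hv ⊢; tauto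
    have hsub2 : ({pt c, pt d, pt a} : Set ℂ) ⊆ {pt a, pt b, pt c, pt d} := by
      intro v hv; simp only [Set.mem_insert_iff, Set.mem_singleton_iff] at hv ⊢; tauto
    obtain rfl := hw.eq_of_disjoint_interior hdpos (convexHull_mono hsub2)
      (by rwa [Sym2.eq_swap (a := c)])
    obtain rfl := hz.eq_of_disjoint_interior hpos (convexHull_mono hsub1) hint
    refine ⟨⟨a, z, c, w, ⟨?_, by rw [← area_rotate, ← area_rotate]; exact hz.area_eq⟩, rfl⟩, h5,
      sides_subset_iff.2 ⟨h1, h2, h3, h4⟩, hdis⟩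
    have hzc := hz.area_eq
    have hwc := hw.area_eq
    have e1 : area a c z = -1 := by rw [eb, ← area_rotate, ← area_rotate, hzc]
    rw [e1, hwc] at hy0
    push_cast at hy0
    -- Both facets on `ac` are unimodular, so `b` and `d` are at heights 1 and -1 and the crossing
    -- point is the midpoint of `bd`.
    obtain rfl : s = 1 / 2 := by linarith
    obtain rfl : t = 1 / 2 := by linarith
    obtain ⟨k, k1, k2⟩ := exists_mul_of_parallel hpac (m' := z.1 + w.1 - 2 * a.1)
      (n' := z.2 + w.2 - 2 * a.2) (by simp only [area] at e1 hwc; linarith)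
    obtain ⟨s', t', hs', ht', hst', hE⟩ := hy1
    have f1 := congrArg coordX hE
    have f2 := congrArg coordY hE
    simp only [map_add, map_smul, smul_eq_mul, coordX_pt, coordY_pt] at f1 f2
    obtain rfl : s' = 1 - t' := by linarith
    have k1' : (z.1 + w.1 - 2 * a.1 : ℝ) = k * (c.1 - a.1) := by exact_mod_cast k1
    have k2' : (z.2 + w.2 - 2 * a.2 : ℝ) = k * (c.2 - a.2) := by exact_mod_cast k2
    have hk : (k : ℝ) = 2 * t' := by
      obtain ⟨x, y, hxy⟩ := hpac
      have hxy' : (x:ℝ) * (c.1 - a.1) + y * (c.2 - a.2) = 1 := by exact_mod_cast hxy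
      linear_combination (2 * t' - k) * hxy' - x * k1' - y * k2' - 2 * x * f1 - 2 * y * f2
    have hk0 : 0 < k := by
      have : (0:ℝ) < k := by linarith
      exact_mod_cast this
    have hk2 : k < 2 := by
      have : (k:ℝ) < (2:ℤ) := by push_cast; linarith
      exact_mod_cast this
    -- `b + d - 2a = k (c - a)`, and the midpoint of `bd` lies strictly between `a` and `c`, which
    -- gives `0 < k < 2`. So the diagonals bisect each other.
    obtain rfl : k = 1 := by omega
    exact Prod.ext (by simp; linarith) (by simp; linarith)
  have eb : area a c b = - area a b c := by simp only [area]; ring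
  have ed : area a c d = - area a d c := by simp only [area]; ring
  rcases lt_trichotomy (area a b c) 0 with hneg | hz | hpos
  · rw [Sym2.eq_swap (a := b)]
    refine core d b t s ht hs (by linarith) (by linarith) ?_ (by rwa [add_comm]) ?_ ?_ ?_ ?_ ?_
    · have hneg' : (area a b c : ℝ) < 0 := by exact_mod_cast hneg
      rw [eb, ed] at hy0
      push_cast at hy0
      have : (0:ℝ) < area a d c := by
        by_contra hcon
        nlinarith
      exact_mod_cast this
    · have : ({pt a, pt d, pt c, pt b} : Set ℂ) = {pt a, pt b, pt c, pt d} := by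
        ext z; simp only [Set.mem_insert_iff, Set.mem_singleton_iff]; tauto
      rwa [this]
    · rwa [Sym2.eq_swap]
    · rwa [Sym2.eq_swap]
    · rwa [Sym2.eq_swap]
    · rwa [Sym2.eq_swap]
  · exfalso
    rw [eb, hz] at hy0
    refine hline ⟨by rw [eb, hz]; rfl, ?_⟩
    have : t * (area a c d : ℝ) = 0 := by simpa using hy0
    have := (mul_eq_zero.1 this).resolve_left ht.ne'
    exact_mod_cast this
  · exact core b d s t hs ht hst hy0 hpos hy1 hint h1 h2 h3 h4

lemma IsFlip.eq_perform {f : Flip} (h : IsFlip Ω T f T') : T' = f.perform T := h.eq_insert_erase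

/-! ### Lengths -/

/-- Twice the Euclidean inner product of lattice vectors. -/
def bil (u w : LatticePoint) : ℤ := 2 * u.1 * w.1 + u.1 * w.2 + u.2 * w.1 + 2 * u.2 * w.2

lemma bil_self_nonneg (u : LatticePoint) : 0 ≤ bil u u := by
  simp only [bil]; nlinarith [sq_nonneg (u.1 + u.2), sq_nonneg u.1, sq_nonneg u.2]

/-- The square of the length of an edge. -/
def sqLen (e : Sym2 LatticePoint) : ℤ :=
  Sym2.lift ⟨fun a b => (b.1 - a.1) ^ 2 + (b.1 - a.1) * (b.2 - a.2) + (b.2 - a.2) ^ 2,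
    fun a b => by ring⟩ e

@[simp] lemma sqLen_mk (a b : LatticePoint) : sqLen s(a, b) =
    (b.1 - a.1) ^ 2 + (b.1 - a.1) * (b.2 - a.2) + (b.2 - a.2) ^ 2 := rfl

lemma edgeLength_eq (e : Sym2 LatticePoint) : edgeLength e = Real.sqrt (sqLen e) := by
  induction e with | h a b =>
  change dist (pt a) (pt b) = _
  rw [Complex.dist_eq_re_im, pt_re, pt_re, pt_im, pt_im]
  congr 1
  have h3 : Real.sqrt 3 ^ 2 = 3 := Real.sq_sqrt (by norm_num)
  simp only [sqLen_mk]
  push_cast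
  linear_combination ((a.2:ℝ) - b.2) ^ 2 / 4 * h3

lemma sqLen_nonneg (e : Sym2 LatticePoint) : 0 ≤ sqLen e := by
  induction e with | h a b =>
  rw [sqLen_mk]
  nlinarith [sq_nonneg (b.1 - a.1 + (b.2 - a.2)), sq_nonneg (b.1 - a.1), sq_nonneg (b.2 - a.2)]

lemma sqLen_pos {e : Sym2 LatticePoint} (h : IsPrimitive e) : 0 < sqLen e := by
  refine (sqLen_nonneg e).lt_of_ne fun h0 => ?_
  induction e with | h x y =>
  rw [sqLen_mk] at h0
  have g1 : y.2 - x.2 = 0 := by nlinarith [sq_nonneg (2 * (y.1 - x.1) + (y.2 - x.2))]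
  have g2 : y.1 - x.1 = 0 := by nlinarith
  exact h.ne (Prod.ext (by linarith) (by linarith))

lemma edgeLength_lt {e f : Sym2 LatticePoint} (h : sqLen e < sqLen f) :
    edgeLength e < edgeLength f := by
  rw [edgeLength_eq, edgeLength_eq]
  exact Real.sqrt_lt_sqrt (by exact_mod_cast sqLen_nonneg e) (by exact_mod_cast h)

lemma sqLen_eq {e f : Sym2 LatticePoint} (h : edgeLength e = edgeLength f) :
    sqLen e = sqLen f := by
  rcases lt_trichotomy (sqLen e) (sqLen f) with h' | h' | h'
  · exact absurd h (edgeLength_lt h').ne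
  · exact h'
  · exact absurd h (edgeLength_lt h').ne'

/-- A primitive vector has at most one decomposition into a positively oriented basis with an
acute angle. -/
lemma eq_of_bil_pos {u w u' w' : LatticePoint} {δ : ℤ} (hδ : δ * δ = 1) (hs : u + w = u' + w')
    (h1 : u.1 * w.2 - u.2 * w.1 = δ) (h2 : u'.1 * w'.2 - u'.2 * w'.1 = δ) (b1 : 0 < bil u w)
    (b2 : 0 < bil u' w') : u = u' := by
  have s1 : w'.1 = u.1 + w.1 - u'.1 := by
    have := congrArg Prod.fst hs; simp at this; linarith
  have s2 : w'.2 = u.2 + w.2 - u'.2 := by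
    have := congrArg Prod.snd hs; simp at this; linarith
  have hcop : IsCoprime (u.1 + w.1) (u.2 + w.2) :=
    ⟨δ * w.2, - δ * w.1, by linear_combination δ * h1 + hδ⟩
  obtain ⟨k, k1, k2⟩ := exists_mul_of_parallel hcop (m' := u'.1 - u.1) (n' := u'.2 - u.2) (by
    rw [s1, s2] at h2; linarith)
  have e1 : u'.1 = u.1 + k * (u.1 + w.1) := by linarith
  have e2 : u'.2 = u.2 + k * (u.2 + w.2) := by linarith
  have hP := bil_self_nonneg u
  have hR := bil_self_nonneg w
  -- Equal sums and determinants force `u' = u + k (u + w)`. For an integer `k ≠ 0` this identity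
  -- makes the new inner product at most `(1 - 2 k²) * bil u w`, which is negative.
  have hb : bil u' w' = bil u w + k * (bil w w - bil u u) -
      k ^ 2 * (bil u u + bil w w + 2 * bil u w) := by
    simp only [bil, s1, s2, e1, e2]; ring
  generalize bil u u = P at *
  generalize bil w w = R at *
  generalize bil u w = b at *
  have hk : k = 0 := by
    rcases lt_trichotomy k 0 with hk | hk | hk
    · exfalso
      have g1 : 0 ≤ (-k) * R := mul_nonneg (by linarith) hR
      have g2 : 0 ≤ (-k) * (-k - 1) * P := mul_nonneg (mul_nonneg (by linarith) (by linarith)) hP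
      have g3 : 0 ≤ k ^ 2 * R := by positivity
      have g4 : 0 ≤ (k ^ 2 - 1) * b := mul_nonneg (by nlinarith) b1.le
      nlinarith
    · exact hk
    · exfalso
      have g1 : 0 ≤ k * P := mul_nonneg (by linarith) hP
      have g2 : 0 ≤ k * (k - 1) * R := mul_nonneg (mul_nonneg (by linarith) (by linarith)) hR
      have g3 : 0 ≤ k ^ 2 * P := by positivity
      have g4 : 0 ≤ (k ^ 2 - 1) * b := mul_nonneg (by nlinarith) b1.le
      nlinarith
  subst hk
  exact Prod.ext (by linarith) (by linarith)

lemma IsPar.sqLen_sub {a b c d : LatticePoint} (h : IsPar a b c d) :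
    sqLen s(b, d) - sqLen s(a, c) = 2 * bil (a - b) (c - b) := by
  simp only [sqLen_mk, bil, h.fst, h.snd, Prod.fst_sub, Prod.snd_sub]; ring

/-- A flip that replaces the shorter diagonal of a parallelogram by the longer one. -/
structure Flip.IsUp (f : Flip) : Prop where
  isPara : f.IsPara
  sqLen_lt : sqLen f.removed < sqLen f.added

/-- The reverse flip. -/
def Flip.symm (f : Flip) : Flip := ⟨f.added, f.removed⟩

@[simp] lemma Flip.symm_removed (f : Flip) : f.symm.removed = f.added := rfl

@[simp] lemma Flip.symm_added (f : Flip) : f.symm.added = f.removed := rfl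

lemma Flip.IsPara.symm {f : Flip} (h : f.IsPara) : f.symm.IsPara := by
  obtain ⟨a, b, c, d, h, rfl⟩ := h
  exact ⟨b, c, d, a, h.rotate, by rw [Flip.symm, Sym2.eq_swap (a := a)]⟩

lemma Flip.sides_symm (f : Flip) : f.symm.sides = f.sides := by
  ext e
  constructor <;> rintro ⟨x, hx, y, hy, rfl⟩ <;> exact ⟨y, hy, x, hx, Sym2.eq_swap⟩

lemma Flip.IsPara.removed_notMem_sides {f : Flip} (h : f.IsPara) : f.removed ∉ f.sides := by
  obtain ⟨a, b, c, d, h, rfl⟩ := h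
  rintro ⟨x, hx, y, hy, he⟩
  have : y ∈ s(a, c) := by change s(a, c) = _ at he; rw [he]; simp
  simp only [Sym2.mem_iff] at hy this
  have n1 := h.ne
  have n2 := h.rotate.ne
  have n3 := h.rotate.rotate.ne
  have n4 := h.rotate.rotate.rotate.ne
  rcases hy with rfl | rfl <;> rcases this with h' | h'
  · exact n1 h'.symm
  · exact n2 h'
  · exact n4 h'
  · exact n3 h'.symm

/-- Diagonals of equal length would make `bil` of the two sides zero, but `bil` has the parity of
their determinant, which is `±1`. -/
lemma Flip.IsPara.isUp_or {f : Flip} (h : f.IsPara) : f.IsUp ∨ f.symm.IsUp := by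
  rcases lt_trichotomy (sqLen f.removed) (sqLen f.added) with h' | h' | h'
  · exact Or.inl ⟨h, h'⟩
  · exfalso
    obtain ⟨a, b, c, d, hp, rfl⟩ := h
    have hs := hp.sqLen_sub
    have ha := hp.area_eq
    simp only [h', sub_self, bil, area, Prod.fst_sub, Prod.snd_sub] at hs ha
    have : 2 * ((a.1 - b.1) * (c.1 - b.1) + (a.2 - b.2) * (c.2 - b.2) +
      (a.2 - b.2) * (c.1 - b.1)) = 1 := by linarith
    omega
  · exact Or.inr ⟨h.symm, h'⟩

/-- An edge is generated by at most one flip that increases the length. -/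
lemma Flip.IsUp.eq_of_added_eq {f g : Flip} (hf : f.IsUp) (hg : g.IsUp)
    (h : f.added = g.added) : f = g := by
  obtain ⟨⟨a, b, c, d, hp, rfl⟩, hl⟩ := hf
  obtain ⟨⟨a', b', c', d', hp', rfl⟩, hl'⟩ := hg
  have core : ∀ a' b' c' d', IsPar a' b' c' d' → sqLen s(a', c') < sqLen s(b', d') → b = b' →
      d = d' → s(a, c) = s(a', c') := by
    rintro a' b' c' d' hp' hl' rfl rfl
    have hs := hp.sqLen_sub
    have hs' := hp'.sqLen_sub
    have f1 := hp.fst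
    have f2 := hp.snd
    have f3 := hp'.fst
    have f4 := hp'.snd
    have ha := hp.area_eq
    have ha' := hp'.area_eq
    -- That `bd` is the longer diagonal means that the angle at `b` is acute, so `d - b = (a - b) +
    -- (c - b)` is the acute decomposition of `d - b`.
    have := eq_of_bil_pos (u := a - b) (w := c - b) (u' := a' - b) (w' := c' - b) (δ := -1)
      (by norm_num) (Prod.ext (by simp; linarith) (by simp; linarith))
      (by simp only [area] at ha; simp only [Prod.fst_sub, Prod.snd_sub]; linarith)
      (by simp only [area] at ha'; simp only [Prod.fst_sub, Prod.snd_sub]; linarith)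
      (by simp only at hl; linarith) (by linarith)
    obtain rfl : a = a' := sub_left_injective this
    obtain rfl : c = c' := Prod.ext (by linarith) (by linarith)
    rfl
  simp only at h hl hl'
  rcases Sym2.eq_iff.1 h with ⟨h1, h2⟩ | ⟨h1, h2⟩
  · ext1
    · exact core _ _ _ _ hp' hl' h1 h2
    · exact h
  · ext1
    · change s(a, c) = s(a', c')
      rw [Sym2.eq_swap (a := a')]
      exact core c' d' a' b' hp'.rotate.rotate
        (by rwa [Sym2.eq_swap, Sym2.eq_swap (a := d')]) h1 h2
    · exact h

lemma Flip.Applies.added_notMem {f : Flip} (h : f.Applies Ω T) (hT : IsTriangulation Ω T) :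
    f.added ∉ T := by
  intro hmem
  obtain ⟨⟨a, b, c, d, hp, rfl⟩, h1, h2, h3⟩ := h
  exact hp.diag_ne (hT.isDrawing.eq_of_mid_eq h1 hmem hp.mid_eq)

lemma Flip.Applies.symm {f : Flip} (h : f.Applies Ω T) (hT : IsTriangulation Ω T) :
    f.symm.Applies Ω (f.perform T) ∧ f.symm.perform (f.perform T) = T := by
  have hne : f.added ≠ f.removed := fun he => h.added_notMem hT (he ▸ h.removed_mem)
  refine ⟨⟨h.isPara.symm, by simp [Flip.perform], ?_, h.disjoint_added hT⟩, ?_⟩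
  · rw [Flip.sides_symm]
    intro e he
    have hne' : e ≠ f.removed := by
      rintro rfl; exact h.isPara.removed_notMem_sides he
    have := h.sides_subset he
    simp only [Flip.perform, Finset.coe_insert, Finset.coe_erase]
    exact Or.inr ⟨this, hne'⟩
  · simp only [Flip.perform, Flip.symm_added, Flip.symm_removed]
    rw [Finset.erase_insert (fun hm => h.added_notMem hT (Finset.mem_of_mem_erase hm)),
      Finset.insert_erase h.removed_mem]

/-- Stated without subtraction so that it serves sums in `ℕ`, `ℤ` and `ℝ` alike. -/
lemma sum_perform {M : Type*} [AddCommMonoid M] (φ : Sym2 LatticePoint → M) {f : Flip}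
    (h1 : f.removed ∈ T) (h2 : f.added ∉ T) :
    ∑ e ∈ f.perform T, φ e + φ f.removed = ∑ e ∈ T, φ e + φ f.added := by
  rw [Flip.perform, Finset.sum_insert (fun hm => h2 (Finset.mem_of_mem_erase hm)), add_assoc,
    Finset.sum_erase_add _ _ h1, add_comm]

/-! ### Unit edges -/

/-- The conclusion says that the angle at `c`, opposite a longest side, is obtuse. With `P`, `R` the
squares of the other sides and `t` the value of `bil`, unimodularity reads `4PR - t² = 3`. If `t ≤
0`, maximality gives `-t ≤ P` and `-t ≤ R`, hence `t² ≤ 1`; `t = 0` is impossible, and `t = -1`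
gives the unit triangle. -/
lemma Tri.bil_pos {a b c : LatticePoint} (h : Tri T a b c) (h1 : sqLen s(b, c) ≤ sqLen s(a, b))
    (h2 : sqLen s(c, a) ≤ sqLen s(a, b)) (h3 : sqLen s(a, b) ≠ 1) : 0 < bil (c - a) (b - c) := by
  by_contra hcon
  have ha := h.area_eq
  have e1 : 2 * sqLen s(c, a) = bil (c - a) (c - a) := by
    simp only [sqLen_mk, bil, Prod.fst_sub, Prod.snd_sub]; ring
  have e2 : 2 * sqLen s(b, c) = bil (b - c) (b - c) := by
    simp only [sqLen_mk, bil, Prod.fst_sub, Prod.snd_sub]; ring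
  have e3 : sqLen s(a, b) = sqLen s(c, a) + sqLen s(b, c) + bil (c - a) (b - c) := by
    simp only [sqLen_mk, bil, Prod.fst_sub, Prod.snd_sub]; ring
  have e4 : bil (c - a) (c - a) * bil (b - c) (b - c) - bil (c - a) (b - c) ^ 2 = 3 := by
    have : (area a b c) ^ 2 = 1 := by rw [ha]; norm_num
    rw [← mul_one 3, ← this]
    simp only [area, bil, Prod.fst_sub, Prod.snd_sub]; ring
  generalize bil (c - a) (b - c) = t at *
  generalize sqLen s(a, b) = E at *
  rw [← e1, ← e2] at e4
  have p1 := sqLen_nonneg s(c, a)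
  have p2 := sqLen_nonneg s(b, c)
  generalize sqLen s(c, a) = P at *
  generalize sqLen s(b, c) = R at *
  have m1 : -t ≤ P := by linarith
  have m2 : -t ≤ R := by linarith
  have t0 : 0 ≤ -t := by linarith
  have m3 : (-t) * (-t) ≤ P * R := mul_le_mul m1 m2 t0 p1
  have t1 : -t ≤ 1 := by nlinarith
  have t2 : -t = 0 ∨ -t = 1 := by omega
  rcases t2 with t2 | t2
  · have : t = 0 := by linarith
    subst this
    have : 4 * (P * R) = 3 := by linarith
    omega
  · have : t = -1 := by linarith
    subst this
    have h4 : P * R = 1 := by linarith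
    have : P = 1 := by nlinarith
    subst this
    apply h3; linarith

lemma unit_cases {m n : ℤ} (h : m ^ 2 + m * n + n ^ 2 = 1) : (m = 1 ∧ n = 0) ∨ (m = -1 ∧ n = 0) ∨
    (m = 0 ∧ n = 1) ∨ (m = 0 ∧ n = -1) ∨ (m = 1 ∧ n = -1) ∨ (m = -1 ∧ n = 1) := by
  have h1 : -1 ≤ m := by nlinarith [sq_nonneg (2 * n + m)]
  have h2 : m ≤ 1 := by nlinarith [sq_nonneg (2 * n + m)]
  have h3 : -1 ≤ n := by nlinarith [sq_nonneg (2 * m + n)]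
  have h4 : n ≤ 1 := by nlinarith [sq_nonneg (2 * m + n)]
  interval_cases m <;> interval_cases n <;> simp_all

/-- A midpoint determines the difference of the ends modulo 2, and the six unit vectors are, up to
sign, distinct modulo 2. -/
lemma eq_of_mid_eq_of_unit {e f : Sym2 LatticePoint} (he : sqLen e = 1) (hf : sqLen f = 1)
    (h : mid e = mid f) : e = f := by
  induction e with | h a b =>
  induction f with | h c d =>
  have h1 := congrArg coordX h
  have h2 := congrArg coordY h
  simp only [mid_mk, map_add, map_smul, smul_eq_mul, coordX_pt, coordY_pt] at h1 h2
  have k1 : a.1 + b.1 = c.1 + d.1 := by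
    have : (a.1 + b.1 : ℝ) = c.1 + d.1 := by linarith
    exact_mod_cast this
  have k2 : a.2 + b.2 = c.2 + d.2 := by
    have : (a.2 + b.2 : ℝ) = c.2 + d.2 := by linarith
    exact_mod_cast this
  rw [sqLen_mk] at he hf
  have key : (a.1 = c.1 ∧ a.2 = c.2 ∧ b.1 = d.1 ∧ b.2 = d.2) ∨
      (a.1 = d.1 ∧ a.2 = d.2 ∧ b.1 = c.1 ∧ b.2 = c.2) := by
    have c1 := unit_cases he
    have c2 := unit_cases hf
    omega
  rw [Sym2.eq_iff]
  rcases key with ⟨q1, q2, q3, q4⟩ | ⟨q1, q2, q3, q4⟩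
  · exact Or.inl ⟨Prod.ext q1 q2, Prod.ext q3 q4⟩
  · exact Or.inr ⟨Prod.ext q1 q2, Prod.ext q3 q4⟩

lemma IsTriangulation.subset_of_unit (hT : IsTriangulation Ω T) (hT' : IsTriangulation Ω T')
    (h : ∀ e ∈ T, sqLen e = 1) (h' : ∀ e ∈ T', sqLen e = 1) : T ⊆ T' := by
  intro e he
  obtain ⟨a, b, c, ht, hm⟩ := hT'.exists_mid_eq (hT.isEdge e he)
  rw [eq_of_mid_eq_of_unit (h e he) (h' _ ht.mem_ab) hm]
  exact ht.mem_ab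

/-- If the common length were not 1, `Tri.bil_pos` would give an equilateral facet an obtuse angle.
-/
lemma IsEquilateralTriangulation.sqLen_eq_one (h : IsEquilateralTriangulation Ω T) :
    ∀ e ∈ T, sqLen e = 1 := by
  obtain ⟨hT, l, hl⟩ := h
  intro e he
  obtain ⟨a, b, c, ht, -⟩ := hT.exists_mid_eq (hT.isEdge e he)
  have h1 : sqLen s(b, c) = sqLen e := sqLen_eq (by rw [hl _ ht.mem_bc, hl _ he])
  have h2 : sqLen s(c, a) = sqLen e := sqLen_eq (by rw [hl _ ht.mem_ca, hl _ he])
  have h3 : sqLen s(a, b) = sqLen e := sqLen_eq (by rw [hl _ ht.mem_ab, hl _ he])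
  by_contra hne
  have hpos := ht.bil_pos (by rw [h1, h3]) (by rw [h2, h3]) (by rwa [h3])
  have e3 : sqLen s(a, b) = sqLen s(c, a) + sqLen s(b, c) + bil (c - a) (b - c) := by
    simp only [sqLen_mk, bil, Prod.fst_sub, Prod.snd_sub]; ring
  have := sqLen_nonneg e
  linarith

/-! ### Shortening flips -/

/-- Edges along the polygon belong to every triangulation, in particular to the unit one. Hence
every longer edge has a facet on each side and is a candidate for a flip. -/
lemma IsTriangulation.disjoint_boundary_of_sqLen (hT : IsTriangulation Ω T)
    (hu : ∀ e ∈ T, sqLen e = 1) {e : Sym2 LatticePoint} (he : IsEdge Ω e) (h : sqLen e ≠ 1) :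
    Disjoint (openSeg e) (Ω.boundary ℝ) := by
  rcases he.boundary with hb | hb
  · exact absurd (hu e (hT.mem_of_subset_boundary he hb)) h
  · exact hb

/-- The longest edge of a triangulation can be flipped to a shorter one, unless it has unit
length. -/
lemma IsTriangulation.exists_down (hT : IsTriangulation Ω T) {T₀ : Finset (Sym2 LatticePoint)}
    (hT₀ : IsTriangulation Ω T₀) (hu : ∀ e ∈ T₀, sqLen e = 1) (h : ∃ e ∈ T, sqLen e ≠ 1) :
    ∃ f : Flip, f.Applies Ω T ∧ f.symm.IsUp := by
  obtain ⟨e₀, he₀, hne₀⟩ := h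
  obtain ⟨e, he, hmax⟩ := T.exists_max_image sqLen ⟨e₀, he₀⟩
  have hne : sqLen e ≠ 1 := by
    intro h1
    have h2 := hmax e₀ he₀
    rw [h1] at h2
    have h3 := sqLen_pos (hT.isEdge _ he₀).primitive
    omega
  have hdis := hT₀.disjoint_boundary_of_sqLen hu (hT.isEdge e he) hne
  induction e with | h p q =>
  obtain ⟨r, hr⟩ := hT.exists_tri he hdis
  obtain ⟨r', hr'⟩ := hT.exists_tri (a := q) (b := p) (by rwa [Sym2.eq_swap])
    (by rwa [Sym2.eq_swap])
  have b1 := hr.bil_pos (hmax _ hr.mem_bc) (hmax _ hr.mem_ca) hne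
  have b2 := hr'.bil_pos (by rw [Sym2.eq_swap (a := q)]; exact hmax _ hr'.mem_bc)
    (by rw [Sym2.eq_swap (a := q)]; exact hmax _ hr'.mem_ca) (by rwa [Sym2.eq_swap])
  have a1 := hr.area_eq
  have a2 := hr'.area_eq
  -- Both triangles on the longest edge have an obtuse angle opposite it, so both split `q - p` into
  -- a basis of the same orientation with positive inner product. Uniqueness of that splitting makes
  -- them a parallelogram.
  have huw : r - p = q - r' := by
    refine eq_of_bil_pos (w := q - r) (w' := r' - p) (δ := -1) (by norm_num)
      (by abel) ?_ ?_ b1 ?_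
    · simp only [area] at a1; simp only [Prod.fst_sub, Prod.snd_sub]; linarith
    · simp only [area] at a2; simp only [Prod.fst_sub, Prod.snd_sub]; linarith
    · convert b2 using 1
      simp only [bil, Prod.fst_sub, Prod.snd_sub]; ring
  have hpar : IsPar p r' q r := by
    refine ⟨?_, by rw [← area_rotate, ← area_rotate]; exact a2⟩
    rw [sub_eq_sub_iff_add_eq_add] at huw
    rw [add_comm p, add_comm r', huw]
  have hpara : Flip.IsPara ⟨s(p, q), s(r', r)⟩ := ⟨p, r', q, r, hpar, rfl⟩
  refine ⟨⟨s(p, q), s(r', r)⟩, ⟨hpara, he, sides_subset_iff.2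
    ⟨hr'.mem_bc, hr'.mem_ca, hr.mem_bc, hr.mem_ca⟩, hdis⟩, hpara.symm, ?_⟩
  change sqLen s(r', r) < sqLen s(p, q)
  have hs := hpar.sqLen_sub
  have : bil (p - r') (q - r') = - bil (r - p) (q - r) := by
    have f1 := hpar.fst
    have f2 := hpar.snd
    simp only [bil, Prod.fst_sub, Prod.snd_sub, f1, f2]; ring
  rw [this] at hs
  linarith

/-! ### Generating an edge -/

lemma exists_comb_of_orient_eq_zero {p q : LatticePoint} (h : IsPrimitive s(p, q)) {z : ℂ}
    (hz : orient p q z = 0) : ∃ t : ℝ, z = (1 - t) • pt p + t • pt q := by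
  obtain ⟨x, y, hxy⟩ := isPrimitive_mk.1 h
  have hxy' : (x:ℝ) * (q.1 - p.1) + y * (q.2 - p.2) = 1 := by exact_mod_cast hxy
  refine ⟨x * (coordX z - p.1) + y * (coordY z - p.2), ?_⟩
  simp only [orient] at hz
  apply ext_coord <;> simp only [map_add, map_smul, smul_eq_mul, coordX_pt, coordY_pt]
  · linear_combination -(coordX z - p.1) * hxy' - y * hz
  · linear_combination -(coordY z - p.2) * hxy' + x * hz

/-- A segment that enters an empty lattice triangle through the side `PQ` leaves it through `zQ`
if its line separates `Q` from the other corners. -/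
lemma not_disjoint_of_enter {p q P Q z : LatticePoint} (hpq : IsPrimitive s(p, q)) {K : Set ℂ}
    (hK : Convex ℝ K) (hP : pt P ∈ K) (hQ : pt Q ∈ K) (hz : pt z ∈ K)
    (hempty : ∀ v, pt v ∈ K → v = P ∨ v = Q ∨ v = z)
    (hcross : ¬ Disjoint (openSeg s(p, q)) (openSeg s(P, Q))) (h1 : 0 < area p q P)
    (h2 : area p q Q < 0) (h3 : 0 < area p q z) :
    ¬ Disjoint (openSeg s(p, q)) (openSeg s(z, Q)) := by
  obtain ⟨y, hy1, hy2⟩ := Set.not_disjoint_iff.1 hcross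
  have hyK : y ∈ K := hK.segment_subset hP hQ (openSeg_subset_seg s(P, Q) hy2)
  obtain ⟨s₀, t₀, hs₀, ht₀, hst₀, hy, -⟩ := exists_comb_of_mem_openSeg hy1
  have h2' : (area p q Q : ℝ) < 0 := by exact_mod_cast h2
  have h3' : (0:ℝ) < area p q z := by exact_mod_cast h3
  have hr : (0:ℝ) < area p q z - area p q Q := by linarith
  -- The point where the segment from `z` to `Q` meets the line `pq`.
  set w : ℂ := (-(area p q Q) / (area p q z - area p q Q) : ℝ) • pt z +
    (area p q z / (area p q z - area p q Q) : ℝ) • pt Q with hw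
  have hst : (-(area p q Q) / (area p q z - area p q Q) : ℝ) +
    (area p q z / (area p q z - area p q Q) : ℝ) = 1 := by field_simp; ring
  have hwseg : w ∈ openSeg s(z, Q) :=
    ⟨_, _, div_pos (by linarith) hr, div_pos h3' hr, hst, rfl⟩
  have hwK : w ∈ K := hK.segment_subset hz hQ (openSeg_subset_seg s(z, Q) hwseg)
  have hw0 : orient p q w = 0 := by
    rw [hw, orient_comb _ _ _ _ hst, orient_pt, orient_pt]; field_simp; ring
  obtain ⟨t, ht⟩ := exists_comb_of_orient_eq_zero hpq hw0
  have hnot : ∀ v, area p q v = 0 → pt v ∉ K := by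
    intro v hv hvK
    rcases hempty v hvK with rfl | rfl | rfl <;> omega
  obtain rfl : s₀ = 1 - t₀ := by linarith
  -- If `w` were not strictly between `p` and `q`, one of these would lie on the segment from `y` to
  -- `w`, hence in `K`; but the lattice points of `K` are all off the line `pq`.
  rcases le_or_gt t 0 with htle | htpos
  · exfalso
    refine hnot p (area_left _ _) (hK.segment_subset hyK hwK
      ⟨-t / (t₀ - t), t₀ / (t₀ - t), div_nonneg (by linarith) (by linarith),
        div_nonneg (by linarith) (by linarith), ?_, ?_⟩)
    · have : t₀ - t ≠ 0 := by linarith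
      field_simp; ring
    · have : t₀ - t ≠ 0 := by linarith
      rw [hy, ht]
      apply ext_coord <;> simp only [map_add, map_smul, smul_eq_mul, coordX_pt, coordY_pt] <;>
        field_simp <;> ring
  rcases le_or_gt 1 t with htge | htlt
  · exfalso
    refine hnot q (area_right _ _) (hK.segment_subset hyK hwK
      ⟨(t - 1) / (t - t₀), (1 - t₀) / (t - t₀), div_nonneg (by linarith) (by linarith),
        div_nonneg (by linarith) (by linarith), ?_, ?_⟩)
    · have : t - t₀ ≠ 0 := by linarith
      field_simp; ring
    · have : t - t₀ ≠ 0 := by linarith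
      rw [hy, ht]
      apply ext_coord <;> simp only [map_add, map_smul, smul_eq_mul, coordX_pt, coordY_pt] <;>
        field_simp <;> ring
  · exact Set.not_disjoint_iff.2 ⟨w, ⟨1 - t, t, by linarith, htpos, by ring, ht.symm⟩, hwseg⟩

/-- The third corner of a triangle on a crossed edge of greatest width lies below the upper end
of this edge. -/
lemma area_lt_of_enter {p q P Q z : LatticePoint} (hpq : IsPrimitive s(p, q)) {K : Set ℂ}
    (hK : Convex ℝ K) (hP : pt P ∈ K) (hQ : pt Q ∈ K) (hz : pt z ∈ K)
    (hempty : ∀ v, pt v ∈ K → v = P ∨ v = Q ∨ v = z)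
    (hcross : ¬ Disjoint (openSeg s(p, q)) (openSeg s(P, Q))) (h1 : 0 < area p q P)
    (h2 : area p q Q < 0) (harea : area P Q z = 1 ∨ area P Q z = -1)
    (hmax : ¬ Disjoint (openSeg s(p, q)) (openSeg s(z, Q)) →
      |area p q z - area p q Q| ≤ area p q P - area p q Q) : area p q z < area p q P := by
  by_contra hcon
  push Not at hcon
  have hle := hmax (not_disjoint_of_enter hpq hK hP hQ hz hempty hcross h1 h2 (by omega))
  rw [abs_of_nonneg (by omega)] at hle
  -- In the extreme case `z - P` is a multiple of `q - p`, so the width of `PQ` divides `area P Q z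
  -- = ±1`. But this width is at least 2, since `P` and `Q` are strictly on opposite sides.
  have heq : area p q z = area p q P := by omega
  obtain ⟨k, k1, k2⟩ := exists_mul_of_parallel (isPrimitive_mk.1 hpq) (m' := z.1 - P.1)
    (n' := z.2 - P.2) (by simp only [area] at heq; linarith)
  have : area P Q z = k * (area p q P - area p q Q) := by
    simp only [area]; linear_combination (Q.1 - P.1) * k2 - (Q.2 - P.2) * k1
  have hdvd : (area p q P - area p q Q) ∣ 1 := by
    rcases harea with h | h
    · exact ⟨k, by rw [← h, this]; ring⟩
    · exact ⟨-k, by linear_combination h - this⟩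
  have := Int.le_of_dvd (by norm_num) hdvd
  omega

/-- The width of an edge in the direction transverse to `pq`, if it crosses `pq`. -/
noncomputable def crossWidth (p q : LatticePoint) (f : Sym2 LatticePoint) : ℕ :=
  open Classical in
  if Disjoint (openSeg s(p, q)) (openSeg f) then 0 else
    Sym2.lift ⟨fun x y => (area p q x - area p q y).natAbs, fun x y => by
      change Int.natAbs _ = Int.natAbs _; omega⟩ f

lemma crossWidth_of_not_disjoint {p q x y : LatticePoint}
    (h : ¬ Disjoint (openSeg s(p, q)) (openSeg s(x, y))) :
    crossWidth p q s(x, y) = (area p q x - area p q y).natAbs := by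
  unfold crossWidth; rw [if_neg h]; rfl

lemma crossWidth_le (p q x y : LatticePoint) :
    crossWidth p q s(x, y) ≤ (area p q x - area p q y).natAbs := by
  unfold crossWidth
  split_ifs
  · exact Nat.zero_le _
  · exact le_rfl

/-- If an edge is not in the triangulation, then a widest edge that crosses it can be flipped. -/
lemma IsTriangulation.exists_flip_of_notMem (hT : IsTriangulation Ω T) {p q : LatticePoint}
    (he : IsEdge Ω s(p, q)) (hn : s(p, q) ∉ T) : ∃ f : Flip, f.Applies Ω T ∧
      ¬ Disjoint (openSeg s(p, q)) (openSeg f.removed) ∧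
      crossWidth p q f.added < crossWidth p q f.removed := by
  classical
  obtain ⟨a, b, c, ht, hm⟩ := hT.exists_mid_eq he
  obtain ⟨f, hf, hmax⟩ := (T.filter fun f => ¬ Disjoint (openSeg s(p, q)) (openSeg f)).exists_max_image
    (crossWidth p q) ⟨s(a, b), by
      rw [Finset.mem_filter]
      exact ⟨ht.mem_ab, Set.not_disjoint_iff.2 ⟨_, mid_mem _, hm ▸ mid_mem _⟩⟩⟩
  rw [Finset.mem_filter] at hf
  obtain ⟨hfT, hfc⟩ := hf
  have hmax' : ∀ g ∈ T, ¬ Disjoint (openSeg s(p, q)) (openSeg g) →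
      crossWidth p q g ≤ crossWidth p q f := fun g hg hgc =>
    hmax g (by rw [Finset.mem_filter]; exact ⟨hg, hgc⟩)
  have hdis : Disjoint (openSeg f) (Ω.boundary ℝ) := by
    rcases (hT.isEdge f hfT).boundary with hb | hb
    · exfalso
      obtain ⟨y, hy1, hy2⟩ := Set.not_disjoint_iff.1 hfc
      rcases he.boundary with hb' | hb'
      · exact hn (hT.mem_of_subset_boundary he hb')
      · exact Set.disjoint_left.1 hb' hy1 (hb hy2)
    · exact hb
  have core : ∀ P Q, s(P, Q) = f → 0 < area p q P → area p q Q < 0 → ∃ f : Flip, f.Applies Ω T ∧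
      ¬ Disjoint (openSeg s(p, q)) (openSeg f.removed) ∧
      crossWidth p q f.added < crossWidth p q f.removed := by
    rintro P Q rfl hP hQ
    have hqp : ∀ v, area q p v = - area p q v := fun v => area_swap _ _ _
    have hwf : crossWidth p q s(P, Q) = (area p q P - area p q Q).natAbs :=
      crossWidth_of_not_disjoint hfc
    have bound : ∀ x y, s(x, y) ∈ T → ¬ Disjoint (openSeg s(p, q)) (openSeg s(x, y)) →
        |area p q x - area p q y| ≤ area p q P - area p q Q := by
      intro x y hxy hc
      have h1 := hmax' _ hxy hc
      rw [hwf, crossWidth_of_not_disjoint hc] at h1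
      rw [abs_le]
      omega
    have height : ∀ (z : LatticePoint) (K : Set ℂ), Convex ℝ K → pt P ∈ K → pt Q ∈ K →
        pt z ∈ K → (∀ v, pt v ∈ K → v = P ∨ v = Q ∨ v = z) →
        (area P Q z = 1 ∨ area P Q z = -1) → s(z, Q) ∈ T → s(z, P) ∈ T →
        area p q z < area p q P ∧ area p q Q < area p q z := by
      intro z K hK h1 h2 h3 hempty ha hz1 hz2
      refine ⟨area_lt_of_enter he.primitive hK h1 h2 h3 hempty hfc hP hQ ha (bound z Q hz1), ?_⟩
      have := area_lt_of_enter (p := q) (q := p) (P := Q) (Q := P) (z := z)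
        (by rw [Sym2.eq_swap]; exact he.primitive) hK h2 h1 h3
        (fun v hv => by have := hempty v hv; tauto)
        (by rwa [Sym2.eq_swap (a := q), Sym2.eq_swap (a := Q)]) (by rw [hqp]; omega)
        (by rw [hqp]; omega) (by rw [area_swap]; omega)
        (by
          rw [Sym2.eq_swap (a := q), hqp, hqp, hqp]
          intro hc
          have := bound z P hz2 hc
          rw [abs_le] at this ⊢
          omega)
      rw [hqp, hqp] at this
      omega
    obtain ⟨z, hz⟩ := hT.exists_tri hfT hdis
    obtain ⟨w, hw⟩ := hT.exists_tri (a := Q) (b := P) (by rwa [Sym2.eq_swap])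
      (by rwa [Sym2.eq_swap])
    have za := hz.area_eq
    have wa := hw.area_eq
    have wa' : area P Q w = -1 := by rw [area_swap, wa]
    have corner : ∀ {x y v : LatticePoint}, Tri T x y v →
        pt x ∈ triSet x y v ∧ pt y ∈ triSet x y v ∧ pt v ∈ triSet x y v := by
      intro x y v h
      rw [← convexHull_eq_triSet (by rw [h.area_eq]; norm_num)]
      refine ⟨?_, ?_, ?_⟩ <;> exact subset_convexHull ℝ _ (by simp)
    obtain ⟨c1, c2, c3⟩ := corner hz
    obtain ⟨d1, d2, d3⟩ := corner hw
    obtain ⟨z1, z2⟩ := height z _ (convex_triSet P Q z) c1 c2 c3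
      (fun v hv => eq_corner_of_mem_triSet za hv) (Or.inl za)
      (by rw [Sym2.eq_swap]; exact hz.mem_bc) hz.mem_ca
    obtain ⟨w1, w2⟩ := height w _ (convex_triSet Q P w) d2 d1 d3
      (fun v hv => by have := eq_corner_of_mem_triSet wa hv; tauto) (Or.inr wa')
      hw.mem_ca (by rw [Sym2.eq_swap]; exact hw.mem_bc)
    obtain ⟨k, k1, k2⟩ := exists_mul_of_parallel
      (isPrimitive_mk.1 (hT.isEdge _ hfT).primitive) (m' := z.1 + w.1 - P.1 - Q.1)
      (n' := z.2 + w.2 - P.2 - Q.2) (by simp only [area] at za wa'; linarith)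
    have hk : area p q z + area p q w - area p q P - area p q Q =
        k * (area p q Q - area p q P) := by
      simp only [area]; linear_combination (q.1 - p.1) * k2 - (q.2 - p.2) * k1
    -- `z + w` differs from `P + Q` by `k (Q - P)`. As the heights of `z` and `w` are strictly
    -- between those of `Q` and `P`, `k` can only be 0, and the facets on `PQ` form a parallelogram.
    have hk0 : k = 0 := by
      have u1 : k < 1 := by nlinarith
      have u2 : -1 < k := by nlinarith
      omega
    rw [hk0, zero_mul] at k1 k2
    have hpar : IsPar P w Q z :=
      ⟨Prod.ext (by simp; linarith) (by simp; linarith),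
        by rw [← area_rotate, ← area_rotate]; exact wa⟩
    refine ⟨⟨s(P, Q), s(w, z)⟩, ⟨⟨P, w, Q, z, hpar, rfl⟩, hfT, sides_subset_iff.2
      ⟨hw.mem_bc, hw.mem_ca, hz.mem_bc, hz.mem_ca⟩, hdis⟩, hfc, ?_⟩
    refine (crossWidth_le p q w z).trans_lt ?_
    change _ < crossWidth p q s(P, Q)
    rw [hwf]
    omega
  induction f with | h P Q =>
  obtain ⟨y, hy1, hy2⟩ := Set.not_disjoint_iff.1 hfc
  obtain ⟨s, t, hs, ht', hst, -, ho⟩ := exists_comb_of_mem_openSeg hy2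
  have h0 := orient_eq_zero_of_mem_seg (openSeg_subset_seg _ hy1)
  rw [ho] at h0
  have hnz : ¬ (area p q P = 0 ∧ area p q Q = 0) := by
    rintro ⟨h1, h2⟩
    apply hn
    rw [eq_of_parallel he.primitive (hT.isEdge _ hfT).primitive
      (by simp only [area] at h1 h2; linarith) hy1 hy2]
    exact hfT
  rcases lt_trichotomy (area p q P) 0 with h | h | h
  · refine core Q P Sym2.eq_swap ?_ h
    have h' : (area p q P : ℝ) < 0 := by exact_mod_cast h
    have : (0:ℝ) < area p q Q := by by_contra hcon; nlinarith
    exact_mod_cast this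
  · exfalso
    rw [h] at h0
    have : t * (area p q Q : ℝ) = 0 := by simpa using h0
    exact hnz ⟨h, by exact_mod_cast (mul_eq_zero.1 this).resolve_left ht'.ne'⟩
  · refine core P Q rfl h ?_
    have h' : (0:ℝ) < area p q P := by exact_mod_cast h
    have : (area p q Q : ℝ) < 0 := by by_contra hcon; nlinarith
    exact_mod_cast this

/-- A constrained triangulation can be changed to contain one more constraint. -/
lemma IsTriangulation.exists_insert {E : Finset (Sym2 LatticePoint)} {e : Sym2 LatticePoint}
    (he : IsEdge Ω e) (hcr : ∀ g ∈ E, g ≠ e → Disjoint (openSeg e) (openSeg g)) :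
    ∀ T, IsTriangulation Ω T → E ⊆ T → ∃ T', IsTriangulation Ω T' ∧ insert e E ⊆ T' := by
  induction e with | h p q =>
  intro T
  -- The total width of the edges that cross `pq` drops with each flip. The removed edge crosses
  -- `pq`, so it is never one of the constraints.
  induction hN : ∑ f ∈ T, crossWidth p q f using Nat.strong_induction_on generalizing T with
  | _ N ih =>
  intro hT hE
  by_cases hn : s(p, q) ∈ T
  · exact ⟨T, hT, Finset.insert_subset hn hE⟩
  obtain ⟨f, hf, hfc, hlt⟩ := hT.exists_flip_of_notMem he hn
  have hsum := sum_perform (crossWidth p q) hf.removed_mem (hf.added_notMem hT)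
  refine ih _ (by omega) (f.perform T) rfl (hf.isTriangulation_perform hT) ?_
  intro g hg
  have hne : g ≠ f.removed := by
    rintro rfl
    exact hfc (hcr _ hg (fun h => hn (h ▸ hE hg)))
  exact Finset.mem_insert_of_mem (Finset.mem_erase.2 ⟨hne, hE hg⟩)

/-- Every set of constraints is contained in a triangulation. -/
lemma IsTriangulation.exists_constrained (hT : IsTriangulation Ω T)
    {E : Finset (Sym2 LatticePoint)} (hE : IsConstraintSet Ω E) :
    ∃ T', IsTriangulation Ω T' ∧ E ⊆ T' := by
  classical
  induction E using Finset.induction_on with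
  | empty => exact ⟨T, hT, Finset.empty_subset _⟩
  | insert e E heE ih =>
    obtain ⟨T₁, hT₁, hE₁⟩ := ih
      ⟨fun g hg => hE.isEdge g (Finset.mem_insert_of_mem hg), fun g hg h hh =>
        hE.nonCrossing g (Finset.mem_insert_of_mem hg) h (Finset.mem_insert_of_mem hh)⟩
    refine IsTriangulation.exists_insert (hE.isEdge e (Finset.mem_insert_self _ _)) ?_ T₁ hT₁ hE₁
    intro g hg hne
    exact hE.nonCrossing e (Finset.mem_insert_self _ _) g (Finset.mem_insert_of_mem hg) hne.symm

/-! ### Flip paths -/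

lemma FlipPath.source {L : List Flip} (h : FlipPath Ω T L T') : IsTriangulation Ω T := by
  cases h with
  | nil _ h => exact h
  | cons _ _ _ _ _ h _ => exact h.source

lemma FlipPath.target {L : List Flip} (h : FlipPath Ω T L T') : IsTriangulation Ω T' := by
  induction h with
  | nil _ h => exact h
  | cons _ _ _ _ _ _ _ ih => exact ih

lemma FlipPath.eq_of_nil (h : FlipPath Ω T [] T') : T' = T := by
  cases h; rfl

lemma flipPath_append {K M : List Flip} :
    FlipPath Ω T (K ++ M) T' ↔ ∃ S, FlipPath Ω T K S ∧ FlipPath Ω S M T' := by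
  induction K generalizing T with
  | nil =>
    constructor
    · exact fun h => ⟨T, .nil T h.source, h⟩
    · rintro ⟨S, h1, h2⟩
      obtain rfl := h1.eq_of_nil
      exact h2
  | cons f K ih =>
    constructor
    · intro h
      cases h with
      | cons _ T₁ _ _ _ h1 h2 =>
        obtain ⟨S, h3, h4⟩ := ih.1 h2
        exact ⟨S, .cons _ _ _ _ _ h1 h3, h4⟩
    · rintro ⟨S, h1, h2⟩
      cases h1 with
      | cons _ T₁ _ _ _ h1 h3 => exact .cons _ _ _ _ _ h1 (ih.2 ⟨S, h3, h2⟩)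

lemma flipPath_cons {f : Flip} {L : List Flip} :
    FlipPath Ω T (f :: L) T' ↔
      IsTriangulation Ω T ∧ f.Applies Ω T ∧ FlipPath Ω (f.perform T) L T' := by
  constructor
  · intro h
    cases h with
    | cons _ T₁ _ _ _ h1 h2 => exact ⟨h1.source, h1.applies, h1.eq_perform ▸ h2⟩
  · rintro ⟨h1, h2, h3⟩
    exact .cons _ _ _ _ _ (h2.isFlip h1) h3

lemma flipPath_concat {f : Flip} {K : List Flip} :
    FlipPath Ω T (K ++ [f]) T' ↔
      ∃ S, FlipPath Ω T K S ∧ f.Applies Ω S ∧ T' = f.perform S := by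
  rw [flipPath_append]
  constructor
  · rintro ⟨S, h1, h2⟩
    obtain ⟨h3, h4, h5⟩ := flipPath_cons.1 h2
    exact ⟨S, h1, h4, h5.eq_of_nil⟩
  · rintro ⟨S, h1, h2, rfl⟩
    exact ⟨S, h1, flipPath_cons.2 ⟨h1.target, h2, .nil _ (h2.isTriangulation_perform h1.target)⟩⟩

lemma Flip.IsPara.removed_ne_added {f : Flip} (h : f.IsPara) : f.removed ≠ f.added := by
  obtain ⟨a, b, c, d, h, rfl⟩ := h
  exact h.diag_ne

lemma mem_perform {f : Flip} {e : Sym2 LatticePoint} :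
    e ∈ f.perform T ↔ e = f.added ∨ e ≠ f.removed ∧ e ∈ T := by
  simp [Flip.perform]

lemma FlipPath.mem_of {L : List Flip} (h : FlipPath Ω T L T') {e : Sym2 LatticePoint}
    (h1 : e ∈ T ∨ ∃ f ∈ L, f.added = e) (h2 : ∀ f ∈ L, f.removed ≠ e) : e ∈ T' := by
  induction L using List.reverseRecOn generalizing T' with
  | nil => simpa [h.eq_of_nil] using h1
  | append_singleton K g ih =>
    obtain ⟨S, hS, hg, rfl⟩ := flipPath_concat.1 h
    rw [mem_perform]
    by_cases hge : e = g.added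
    · exact Or.inl hge
    refine Or.inr ⟨(h2 g (by simp)).symm, ih hS ?_ fun f hf => h2 f (by simp [hf])⟩
    rcases h1 with h1 | ⟨f, hf, rfl⟩
    · exact Or.inl h1
    · rw [List.mem_append, List.mem_singleton] at hf
      rcases hf with hf | rfl
      · exact Or.inr ⟨f, hf, rfl⟩
      · exact absurd rfl hge

lemma FlipPath.mem_or_added {L : List Flip} (h : FlipPath Ω T L T') {e : Sym2 LatticePoint}
    (he : e ∈ T') : e ∈ T ∨ ∃ f ∈ L, f.added = e := by
  induction L using List.reverseRecOn generalizing T' with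
  | nil => left; rwa [← h.eq_of_nil]
  | append_singleton K g ih =>
    obtain ⟨S, hS, hg, rfl⟩ := flipPath_concat.1 h
    rcases mem_perform.1 he with rfl | ⟨-, he⟩
    · exact Or.inr ⟨g, by simp, rfl⟩
    · rcases ih hS he with h' | ⟨f, hf, rfl⟩
      · exact Or.inl h'
      · exact Or.inr ⟨f, by simp [hf], rfl⟩

lemma FlipPath.removed_mem_or_added {L : List Flip} (h : FlipPath Ω T L T') {f : Flip}
    (hf : f ∈ L) : f.removed ∈ T ∨ ∃ g ∈ L, g.added = f.removed := by
  obtain ⟨K, M, rfl⟩ := List.append_of_mem hf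
  obtain ⟨S, hS, hM⟩ := flipPath_append.1 h
  rcases hS.mem_or_added (flipPath_cons.1 hM).2.1.removed_mem with h' | ⟨g, hg, he⟩
  · exact Or.inl h'
  · exact Or.inr ⟨g, by simp [hg], he⟩

lemma Flip.IsPara.isPrimitive_removed {f : Flip} (h : f.IsPara) : IsPrimitive f.removed := by
  obtain ⟨a, b, c, d, h, rfl⟩ := h
  exact isPrimitive_of_area (c := d) (by rw [← area_rotate]; exact h.rotate.rotate.area_eq)

lemma Flip.IsUp.sqLen_added_ne {f : Flip} (h : f.IsUp) : sqLen f.added ≠ 1 := by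
  have h1 := sqLen_pos h.isPara.isPrimitive_removed
  have h2 := h.sqLen_lt
  omega

/-! ### Flip paths that only lengthen edges -/

/-- A removed edge never returns. To be added again it must be longer than a unit, so its earlier
presence was also due to a flip; but only one up flip adds it, and no flip is repeated. -/
lemma FlipPath.removed_ne {L : List Flip} (h : FlipPath Ω T L T') (hu : ∀ e ∈ T, sqLen e = 1)
    (hup : ∀ f ∈ L, f.IsUp) (hnd : L.Nodup) {e : Sym2 LatticePoint} (he : e ∈ T') :
    ∀ f ∈ L, f.removed ≠ e := by
  induction L using List.reverseRecOn generalizing T' with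
  | nil => simp
  | append_singleton K g ih =>
    obtain ⟨S, hS, hg, rfl⟩ := flipPath_concat.1 h
    have hgup := hup g (by simp)
    have hKup : ∀ f ∈ K, f.IsUp := fun f hf => hup f (by simp [hf])
    have hgK : g ∉ K := fun hgK => by
      have := (List.nodup_append.1 hnd).2.2
      exact this g hgK g (by simp) rfl
    intro f hf
    rw [List.mem_append, List.mem_singleton] at hf
    rcases hf with hf | rfl
    · rcases mem_perform.1 he with rfl | ⟨-, he⟩
      · intro hrem
        rcases hS.removed_mem_or_added hf with h' | ⟨f', hf', h'⟩
        · rw [hrem] at h'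
          exact hgup.sqLen_added_ne (hu _ h')
        · rw [hrem] at h'
          exact hgK ((hKup f' hf').eq_of_added_eq hgup h' ▸ hf')
      · exact ih hS hKup (List.nodup_append.1 hnd).1 he f hf
    · rintro rfl
      rcases mem_perform.1 he with h' | ⟨h', -⟩
      · exact hgup.isPara.removed_ne_added h'
      · exact h' rfl

/-- The end of such a path depends only on the set of its flips. -/
lemma FlipPath.mem_iff {L : List Flip} (h : FlipPath Ω T L T') (hu : ∀ e ∈ T, sqLen e = 1)
    (hup : ∀ f ∈ L, f.IsUp) (hnd : L.Nodup) {e : Sym2 LatticePoint} :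
    e ∈ T' ↔ (e ∈ T ∨ ∃ f ∈ L, f.added = e) ∧ ∀ f ∈ L, f.removed ≠ e :=
  ⟨fun he => ⟨h.mem_or_added he, h.removed_ne hu hup hnd he⟩, fun he => h.mem_of he.1 he.2⟩

lemma FlipPath.target_unique {L L' : List Flip} {T'' : Finset (Sym2 LatticePoint)}
    (h : FlipPath Ω T L T') (h' : FlipPath Ω T L' T'') (hu : ∀ e ∈ T, sqLen e = 1)
    (hup : ∀ f ∈ L, f.IsUp) (hnd : L.Nodup) (hnd' : L'.Nodup) (hmem : ∀ f, f ∈ L ↔ f ∈ L') :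
    T' = T'' := by
  ext e
  rw [h.mem_iff hu hup hnd, h'.mem_iff hu (fun f hf => hup f ((hmem f).2 hf)) hnd']
  simp only [hmem]

/-- Every triangulation can be reached from the unit triangulation by lengthening flips. -/
lemma exists_up_path (hT₀ : IsTriangulation Ω T₀) (hu : ∀ e ∈ T₀, sqLen e = 1) :
    ∀ T, IsTriangulation Ω T → ∃ L, FlipPath Ω T₀ L T ∧ ∀ f ∈ L, f.IsUp := by
  intro T
  induction hN : ∑ e ∈ T, (sqLen e).toNat using Nat.strong_induction_on generalizing T with
  | _ N ih =>
  intro hT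
  by_cases h : ∃ e ∈ T, sqLen e ≠ 1
  · obtain ⟨f, hf, hup⟩ := hT.exists_down hT₀ hu h
    have hsum := sum_perform (fun e => (sqLen e).toNat) hf.removed_mem (hf.added_notMem hT)
    have hlt := hup.sqLen_lt
    simp only [Flip.symm_removed, Flip.symm_added] at hlt
    have h0 := sqLen_nonneg f.added
    obtain ⟨L, hL, hLup⟩ := ih _ (by omega) (f.perform T) rfl
      (hf.isTriangulation_perform hT)
    obtain ⟨h1, h2⟩ := hf.symm hT
    refine ⟨L ++ [f.symm], flipPath_concat.2 ⟨_, hL, h1, h2.symm⟩, ?_⟩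
    intro g hg
    rw [List.mem_append, List.mem_singleton] at hg
    rcases hg with hg | rfl
    · exact hLup g hg
    · exact hup
  · push Not at h
    obtain rfl : T₀ = T :=
      Finset.Subset.antisymm (hT₀.subset_of_unit hT hu h) (hT.subset_of_unit hT₀ h hu)
    exact ⟨[], .nil _ hT, by simp⟩

lemma Flip.IsPara.mid_eq {f : Flip} (h : f.IsPara) : mid f.removed = mid f.added := by
  obtain ⟨a, b, c, d, h, rfl⟩ := h
  exact h.mid_eq

-- The sum has one nonzero term. Speaking of the edge at a given midpoint through a sum lets
-- `sum_perform` track its length along a path.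
open Classical in
lemma IsTriangulation.sum_mid (hT : IsTriangulation Ω T) {e : Sym2 LatticePoint} (he : e ∈ T) :
    ∑ g ∈ T, (if mid g = mid e then sqLen g else 0) = sqLen e := by
  rw [Finset.sum_eq_single_of_mem e he, if_pos rfl]
  intro g hg hne
  rw [if_neg]
  exact fun h => hne (hT.isDrawing.eq_of_mid_eq hg he h)

-- Under up flips, the edge at each midpoint only grows.
open Classical in
lemma FlipPath.sqLen_le_sum_mid {L : List Flip} (h : FlipPath Ω T L T') (hup : ∀ f ∈ L, f.IsUp) :
    ∀ f ∈ L, sqLen f.added ≤ ∑ g ∈ T', (if mid g = mid f.added then sqLen g else 0) := by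
  induction L using List.reverseRecOn generalizing T' with
  | nil => simp
  | append_singleton K g ih =>
    obtain ⟨S, hS, hg, rfl⟩ := flipPath_concat.1 h
    intro f hf
    rw [List.mem_append, List.mem_singleton] at hf
    rcases hf with hf | rfl
    · have h1 := ih hS (fun f hf => hup f (by simp [hf])) f hf
      have h2 := sum_perform (fun e => if mid e = mid f.added then sqLen e else 0)
        hg.removed_mem (hg.added_notMem hS.target)
      have h3 := (hup g (by simp)).sqLen_lt
      simp only [hg.isPara.mid_eq] at h2
      split_ifs at h2 <;> linarith
    · exact ((hg.isTriangulation_perform hS.target).sum_mid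
        (mem_perform.2 (Or.inl rfl))).ge

/-- To perform `f` again, `f.removed` must be present, but the edge at its midpoint is already at
least as long as `f.added`. -/
lemma FlipPath.nodup {L : List Flip} (h : FlipPath Ω T L T') (hup : ∀ f ∈ L, f.IsUp) :
    L.Nodup := by
  induction L using List.reverseRecOn generalizing T' with
  | nil => simp
  | append_singleton K g ih =>
    obtain ⟨S, hS, hg, rfl⟩ := flipPath_concat.1 h
    have hKup : ∀ f ∈ K, f.IsUp := fun f hf => hup f (by simp [hf])
    rw [List.nodup_append]
    refine ⟨ih hS hKup, List.nodup_singleton g, ?_⟩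
    intro f hf g' hg' hfg
    rw [List.mem_singleton] at hg'
    subst hg' hfg
    have h1 := hS.sqLen_le_sum_mid hKup f hf
    rw [← hg.isPara.mid_eq, hS.target.sum_mid hg.removed_mem] at h1
    have := (hKup f hf).sqLen_lt
    omega

/-! ### The flips required to generate a set of edges -/

/-- The edges that must appear in the course of generating `E` from unit edges. -/
inductive Needed (E : Finset (Sym2 LatticePoint)) : Sym2 LatticePoint → Prop
  | base (e : Sym2 LatticePoint) : e ∈ E → Needed E e
  | removed (f : Flip) : f.IsUp → Needed E f.added → Needed E f.removed
  | side (f : Flip) (e : Sym2 LatticePoint) :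
      f.IsUp → Needed E f.added → e ∈ f.sides → Needed E e

lemma Needed.mono {E E' : Finset (Sym2 LatticePoint)} (hE : E ⊆ E') {e : Sym2 LatticePoint}
    (h : Needed E e) : Needed E' e := by
  induction h with
  | base e he => exact .base e (hE he)
  | removed f hf _ ih => exact .removed f hf ih
  | side f e hf _ he ih => exact .side f e hf ih he

lemma Needed.mem_of_unit (hu : ∀ e ∈ T, sqLen e = 1) {e : Sym2 LatticePoint}
    (h : Needed T e) : e ∈ T := by
  induction h with
  | base e he => exact he
  | removed f hf _ ih => exact absurd (hu _ ih) hf.sqLen_added_ne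
  | side f e hf _ he ih => exact absurd (hu _ ih) hf.sqLen_added_ne

/-- An up flip makes at most its added edge newly needed, since by uniqueness what that edge
requires is already in `T`. A down flip makes nothing newly needed: the reverse flip shows that the
old edge required the new one. -/
lemma Needed.of_perform {g : Flip} (hg : g.Applies Ω T) {e : Sym2 LatticePoint}
    (h : Needed (g.perform T) e) : Needed T e ∨ g.IsUp ∧ g.added = e := by
  induction h with
  | base e he =>
    rcases mem_perform.1 he with rfl | ⟨-, he⟩
    · rcases hg.isPara.isUp_or with h | h
      · exact Or.inr ⟨h, rfl⟩
      · exact Or.inl (.removed g.symm h (.base _ hg.removed_mem))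
    · exact Or.inl (.base e he)
  | removed f hf _ ih =>
    rcases ih with h | ⟨h, he⟩
    · exact Or.inl (.removed f hf h)
    · obtain rfl := h.eq_of_added_eq hf he
      exact Or.inl (.base _ hg.removed_mem)
  | side f e hf _ hs ih =>
    rcases ih with h | ⟨h, he⟩
    · exact Or.inl (.side f e hf h hs)
    · obtain rfl := h.eq_of_added_eq hf he
      exact Or.inl (.base _ (hg.sides_subset hs))

/-- A flip path from the unit triangulation contains all the flips required by its end. -/
lemma FlipPath.mem_of_needed {L : List Flip} (h : FlipPath Ω T₀ L T)
    (hu : ∀ e ∈ T₀, sqLen e = 1) {f : Flip} (hf : f.IsUp) (hn : Needed T f.added) : f ∈ L := by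
  induction L using List.reverseRecOn generalizing T with
  | nil =>
    rw [h.eq_of_nil] at hn
    exact absurd (hu _ (hn.mem_of_unit hu)) hf.sqLen_added_ne
  | append_singleton K g ih =>
    obtain ⟨S, hS, hg, rfl⟩ := flipPath_concat.1 h
    rw [List.mem_append, List.mem_singleton]
    rcases hn.of_perform hg with h' | ⟨h', he⟩
    · exact Or.inl (ih hS h')
    · exact Or.inr (hf.eq_of_added_eq h' he.symm)

lemma totalLength_perform {f : Flip} (h1 : f.removed ∈ T) (h2 : f.added ∉ T) :
    totalLength (f.perform T) + edgeLength f.removed = totalLength T + edgeLength f.added :=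
  sum_perform edgeLength h1 h2

open Classical in
/-- Dropping the flips that `E` does not require from a lengthening flip path leaves a flip
path. -/
lemma FlipPath.filter_needed (E : Finset (Sym2 LatticePoint)) {L : List Flip}
    (h : FlipPath Ω T₀ L T) (hup : ∀ f ∈ L, f.IsUp) :
    ∃ S, FlipPath Ω T₀ (L.filter fun f => Needed E f.added) S ∧
      (∀ e ∈ T, Needed E e → e ∈ S) ∧ totalLength S ≤ totalLength T := by
  induction L using List.reverseRecOn generalizing T with
  | nil => exact ⟨T, h, fun e he _ => he, le_rfl⟩
  | append_singleton K g ih =>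
    obtain ⟨T₁, hT₁, hg, rfl⟩ := flipPath_concat.1 h
    obtain ⟨S, hS, hTS, hlen⟩ := ih hT₁ fun f hf => hup f (by simp [hf])
    have hgup := hup g (by simp)
    have hlenT := totalLength_perform hg.removed_mem (hg.added_notMem hT₁.target)
    rw [List.filter_append]
    by_cases hn : Needed E g.added
    · have hgS : g.Applies Ω S := ⟨hg.isPara, hTS _ hg.removed_mem (.removed g hgup hn),
        fun e he => hTS e (hg.sides_subset he) (.side g e hgup hn he), hg.disjoint_boundary⟩
      have hlenS := totalLength_perform hgS.removed_mem (hgS.added_notMem hS.target)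
      refine ⟨g.perform S, ?_, ?_, by linarith⟩
      · rw [List.filter_singleton, decide_eq_true hn]
        exact flipPath_concat.2 ⟨S, hS, hgS, rfl⟩
      · intro e he hne
        rw [mem_perform] at he ⊢
        exact he.imp id fun h => ⟨h.1, hTS e h.2 hne⟩
    · refine ⟨S, ?_, ?_, ?_⟩
      · rw [List.filter_singleton, decide_eq_false hn]
        simpa using hS
      · intro e he hne
        rcases mem_perform.1 he with rfl | ⟨-, he⟩
        · exact absurd hne hn
        · exact hTS e he hne
      · have := edgeLength_lt hgup.sqLen_lt
        linarith

/-! ### Recovering a partial order from its linear orderings -/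

/-- `f` does not come after `g` in the list. -/
def NotAfter (L : List Flip) (f g : Flip) : Prop :=
  ∀ K M, L = K ++ g :: M → f = g ∨ f ∈ K

namespace FlipPoset

lemma exists_sort (π : FlipPoset) (D : Finset Flip) (hD : D ⊆ π.flips) :
    ∃ L : List Flip, L.Nodup ∧ (∀ f, f ∈ L ↔ f ∈ D) ∧ L.Pairwise fun f g => ¬ π.le g f := by
  classical
  induction D using Finset.strongInduction with
  | H D ih =>
  rcases D.eq_empty_or_nonempty with rfl | hne
  · exact ⟨[], by simp⟩
  obtain ⟨m, hm, hmin⟩ : ∃ m ∈ D, ∀ x ∈ D, π.le x m → x = m := by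
    by_contra hcon
    push Not at hcon
    -- An element with the fewest predecessors in `D` is minimal.
    obtain ⟨x, hx, hmax⟩ := D.exists_min_image (fun x => (D.filter fun y => π.le y x).card) hne
    obtain ⟨y, hy, hyx, hne⟩ := hcon x hx
    refine (hmax y hy).not_gt (Finset.card_lt_card ?_)
    rw [Finset.ssubset_iff_of_subset]
    · refine ⟨x, by simp [hx, π.le_refl x (hD hx)], ?_⟩
      intro h
      exact hne (π.le_antisymm _ _ hyx (Finset.mem_filter.1 h).2)
    · intro z hz
      rw [Finset.mem_filter] at hz ⊢
      exact ⟨hz.1, π.le_trans _ _ _ hz.2 hyx⟩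
  obtain ⟨L, h1, h2, h3⟩ := ih (D.erase m) (Finset.erase_ssubset hm)
    ((Finset.erase_subset _ _).trans hD)
  refine ⟨m :: L, ?_, ?_, ?_⟩
  · rw [List.nodup_cons]
    exact ⟨by rw [h2]; simp, h1⟩
  · intro f
    rw [List.mem_cons, h2, Finset.mem_erase]
    by_cases hf : f = m
    · simp [hf, hm]
    · simp [hf]
  · rw [List.pairwise_cons]
    refine ⟨fun f hf hle => ?_, h3⟩
    rw [h2, Finset.mem_erase] at hf
    exact hf.1 (hmin f hf.2 hle)

/-- A down-set can be listed first. -/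
lemma exists_linearOrdering (π : FlipPoset) {D : Finset Flip} (hD : D ⊆ π.flips)
    (hdown : ∀ f g, π.le f g → g ∈ D → f ∈ D) :
    ∃ K M : List Flip, π.IsLinearOrdering (K ++ M) ∧ ∀ f, f ∈ K ↔ f ∈ D := by
  classical
  obtain ⟨K, k1, k2, k3⟩ := π.exists_sort D hD
  obtain ⟨M, m1, m2, m3⟩ := π.exists_sort (π.flips \ D) Finset.sdiff_subset
  refine ⟨K, M, ⟨⟨?_, ?_⟩, ?_⟩, k2⟩
  · rw [List.nodup_append]
    refine ⟨k1, m1, ?_⟩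
    rintro f hf g hg rfl
    rw [k2] at hf
    rw [m2] at hg
    exact (Finset.mem_sdiff.1 hg).2 hf
  · intro f
    rw [List.mem_append, k2, m2, Finset.mem_sdiff]
    by_cases hf : f ∈ D
    · simp [hf, hD hf]
    · simp [hf]
  · rw [List.pairwise_append]
    refine ⟨k3, m3, ?_⟩
    intro f hf g hg hle
    rw [k2] at hf
    rw [m2, Finset.mem_sdiff] at hg
    exact hg.2 (hdown _ _ hle hf)

lemma exists_isLinearOrdering (π : FlipPoset) : ∃ L, π.IsLinearOrdering L := by
  obtain ⟨K, M, h, -⟩ := π.exists_linearOrdering (Finset.Subset.refl _)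
    fun f g h _ => (π.mem_of_le f g h).1
  exact ⟨_, h⟩

/-- If `f` is not below `g`, the down-set of `g` can be listed first, and then `f` comes after `g`.
So the linear orderings determine the order, whence the uniqueness of the plan. -/
lemma le_iff (π : FlipPoset) (f g : Flip) : π.le f g ↔
    f ∈ π.flips ∧ g ∈ π.flips ∧ ∀ L, π.IsLinearOrdering L → NotAfter L f g := by
  classical
  constructor
  · intro h
    obtain ⟨hf, hg⟩ := π.mem_of_le f g h
    refine ⟨hf, hg, ?_⟩
    rintro _ ⟨⟨hnd, hmem⟩, hpw⟩ K M rfl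
    have hfL := (hmem f).2 hf
    rw [List.mem_append, List.mem_cons] at hfL
    rcases hfL with h' | h' | h'
    · exact Or.inr h'
    · exact Or.inl h'
    · have := (List.pairwise_cons.1 (List.pairwise_append.1 hpw).2.1).1 f h'
      exact absurd h this
  · rintro ⟨hf, hg, h⟩
    by_contra hle
    obtain ⟨K, M, hKM, hK⟩ := π.exists_linearOrdering (D := π.flips.filter fun x => π.le x g)
      (Finset.filter_subset _ _) (by
        intro x y hxy hy
        rw [Finset.mem_filter] at hy ⊢
        exact ⟨(π.mem_of_le _ _ hxy).1, π.le_trans _ _ _ hxy hy.2⟩)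
    have hgK : g ∈ K := by
      rw [hK, Finset.mem_filter]; exact ⟨hg, π.le_refl g hg⟩
    obtain ⟨K₁, K₂, rfl⟩ := List.append_of_mem hgK
    have hfK : f ∉ K₁ ++ g :: K₂ := by
      rw [hK, Finset.mem_filter]; exact fun h' => hle h'.2
    rcases h _ hKM K₁ (K₂ ++ M) (by simp) with rfl | h'
    · exact hfK hgK
    · exact hfK (by simp [h'])

end FlipPoset

lemma notAfter_refl (L : List Flip) (f : Flip) : NotAfter L f f := fun _ _ _ => Or.inl rfl

/-- The middle flip must occur in the list, because `NotAfter L f g` is vacuous when `g` does not.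
-/
lemma NotAfter.trans {L : List Flip} {f g h : Flip} (hg : g ∈ L)
    (h1 : NotAfter L f g) (h2 : NotAfter L g h) : NotAfter L f h := by
  rintro K M rfl
  rcases h2 K M rfl with rfl | hgK
  · exact h1 K M rfl
  obtain ⟨K₁, K₂, rfl⟩ := List.append_of_mem hgK
  rcases h1 K₁ (K₂ ++ h :: M) (by simp) with rfl | h'
  · exact Or.inr hgK
  · exact Or.inr (by simp [h'])

lemma NotAfter.antisymm {L : List Flip} (hnd : L.Nodup) {f g : Flip} (hg : g ∈ L)
    (h1 : NotAfter L f g) (h2 : NotAfter L g f) : f = g := by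
  obtain ⟨K, M, rfl⟩ := List.append_of_mem hg
  rcases h1 K M rfl with h | hfK
  · exact h
  obtain ⟨K₁, K₂, rfl⟩ := List.append_of_mem hfK
  rcases h2 K₁ (K₂ ++ g :: M) (by simp) with h | hg'
  · exact h.symm
  · exfalso
    have := (List.nodup_append.1 hnd).2.2 g (by simp [hg']) g (by simp)
    exact this rfl

lemma NotAfter.pairwise {L : List Flip} (hnd : L.Nodup) :
    L.Pairwise fun f g => ¬ NotAfter L g f := by
  rw [List.pairwise_iff_forall_sublist]
  intro f g hsub hna
  obtain ⟨K, M, rfl⟩ := List.append_of_mem (hsub.subset (by simp : f ∈ [f, g]))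
  have hfg : f ≠ g := by
    have := hsub.nodup hnd
    simpa using this
  rcases hna K M rfl with rfl | hgK
  · exact hfg rfl
  · obtain ⟨K₁, K₂, rfl⟩ := List.append_of_mem hgK
    rw [List.sublist_append_iff] at hsub
    obtain ⟨l₁, l₂, hl, hl1, hl2⟩ := hsub
    have hnd' := List.nodup_append.1 hnd
    rcases l₁ with _ | ⟨x, l₁⟩
    · simp only [List.nil_append] at hl
      subst hl
      exact hnd'.2.2 g (by simp) g (hl2.subset (by simp)) rfl
    · simp only [List.cons_append, List.cons.injEq] at hl
      obtain ⟨rfl, hl⟩ := hl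
      exact hnd'.2.2 f (hl1.subset (by simp)) f (by simp) rfl

/-! ### The flip plan -/

/-- The recursion behind `Needed` yields finitely many flips because all of them occur in a single
path. -/
lemma exists_requiredFlips (hT₀ : IsTriangulation Ω T₀) (hu : ∀ e ∈ T₀, sqLen e = 1)
    {E : Finset (Sym2 LatticePoint)} (hE : IsConstraintSet Ω E) :
    ∃ F : Finset Flip, ∀ f, f ∈ F ↔ f.IsUp ∧ Needed E f.added := by
  obtain ⟨T, hT, hET⟩ := hT₀.exists_constrained hE
  obtain ⟨L, hL, -⟩ := exists_up_path hT₀ hu T hT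
  have hfin : {f : Flip | f.IsUp ∧ Needed E f.added}.Finite :=
    L.finite_toSet.subset fun f hf => hL.mem_of_needed hu hf.1 (hf.2.mono hET)
  exact ⟨hfin.toFinset, by simp⟩

/-- `L` is a flip path from `T₀` that generates `E` and consists of the flips in `F`, once
each. -/
structure IsPathListing (Ω : Polygon ℂ n) (T₀ E : Finset (Sym2 LatticePoint)) (F : Finset Flip)
    (L : List Flip) : Prop where
  nodup : L.Nodup
  mem_iff : ∀ f, f ∈ L ↔ f ∈ F
  generates : Generates Ω T₀ E L

section Plan

variable {E : Finset (Sym2 LatticePoint)} {F : Finset Flip}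

lemma Generates.mem {L : List Flip} (h : Generates Ω T₀ E L) (hu : ∀ e ∈ T₀, sqLen e = 1)
    (hF : ∀ f, f ∈ F ↔ f.IsUp ∧ Needed E f.added) {f : Flip} (hf : f ∈ F) : f ∈ L := by
  obtain ⟨T, hL, hET⟩ := h
  have hf' := (hF f).1 hf
  exact hL.mem_of_needed hu hf'.1 (hf'.2.mono hET)

/-- Every triangulation that contains `E` is at least as long as the end of some flip path that
lists the required flips. -/
lemma exists_isPathListing (hT₀ : IsTriangulation Ω T₀) (hu : ∀ e ∈ T₀, sqLen e = 1)
    (hF : ∀ f, f ∈ F ↔ f.IsUp ∧ Needed E f.added) (hT : IsTriangulation Ω T) (hET : E ⊆ T) :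
    ∃ L S, IsPathListing Ω T₀ E F L ∧ FlipPath Ω T₀ L S ∧ E ⊆ S ∧
      totalLength S ≤ totalLength T := by
  classical
  obtain ⟨L, hL, hup⟩ := exists_up_path hT₀ hu T hT
  obtain ⟨S, hS, hsub, hlen⟩ := hL.filter_needed E hup
  have hES : E ⊆ S := fun e he => hsub e (hET he) (.base e he)
  refine ⟨_, S, ⟨(hL.nodup hup).filter _, ?_, S, hS, hES⟩, hS, hES, hlen⟩
  intro f
  rw [List.mem_filter, decide_eq_true_iff, hF]
  exact ⟨fun h => ⟨hup f h.1, h.2⟩, fun h => ⟨hL.mem_of_needed hu h.1 (h.2.mono hET), h.2⟩⟩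

lemma IsPathListing.isUp {L : List Flip} (h : IsPathListing Ω T₀ E F L)
    (hF : ∀ f, f ∈ F ↔ f.IsUp ∧ Needed E f.added) : ∀ f ∈ L, f.IsUp :=
  fun f hf => ((hF f).1 ((h.mem_iff f).1 hf)).1

lemma IsPathListing.applies {K M : List Flip} {g : Flip}
    (h : IsPathListing Ω T₀ E F (K ++ g :: M)) :
    ∃ S, FlipPath Ω T₀ K S ∧ g.Applies Ω S := by
  obtain ⟨T, hT, -⟩ := h.generates
  obtain ⟨S, hS, hM⟩ := flipPath_append.1 hT
  exact ⟨S, hS, (flipPath_cons.1 hM).2.1⟩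

/-- A listing in an order that is compatible with all the generating flip paths is itself a flip
path. -/
lemma flipPath_of_compatible (hu : ∀ e ∈ T₀, sqLen e = 1)
    (hF : ∀ f, f ∈ F ↔ f.IsUp ∧ Needed E f.added) {L₀ : List Flip}
    (hL₀ : IsPathListing Ω T₀ E F L₀) {L : List Flip} (hmem : ∀ f, f ∈ L ↔ f ∈ F)
    (hpw : L.Pairwise fun f g => ¬ ∀ L', IsPathListing Ω T₀ E F L' → NotAfter L' g f) :
    ∃ S, FlipPath Ω T₀ L S := by
  have hT₀ : IsTriangulation Ω T₀ := by
    obtain ⟨T, hT, -⟩ := hL₀.generates; exact hT.source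
  suffices ∀ K M, L = K ++ M → ∃ S, FlipPath Ω T₀ K S from this L [] (by simp)
  intro K
  induction K using List.reverseRecOn with
  | nil => exact fun M _ => ⟨T₀, .nil _ hT₀⟩
  | append_singleton K g ih =>
    rintro M rfl
    rw [List.append_assoc, List.singleton_append] at hmem hpw ih
    obtain ⟨S, hS⟩ := ih (g :: M) rfl
    have hgF : g ∈ F := (hmem g).1 (by simp)
    rw [List.pairwise_append, List.pairwise_cons] at hpw
    obtain ⟨-, ⟨hpw1, -⟩, hpw2⟩ := hpw
    -- An edge present just before `g` in every listing is also present after `K`: its creation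
    -- precedes `g` and its removal, if any, follows `g` in every listing, so the compatible order
    -- respects both.
    have hstate : ∀ s, (∀ L' K' M' S', IsPathListing Ω T₀ E F L' → L' = K' ++ g :: M' →
        FlipPath Ω T₀ K' S' → g.Applies Ω S' → s ∈ S') → s ∈ S := by
      intro s hs
      apply hS.mem_of
      · by_cases hsT : s ∈ T₀
        · exact Or.inl hsT
        right
        obtain ⟨K₀, M₀, rfl⟩ := List.append_of_mem ((hL₀.mem_iff g).2 hgF)
        obtain ⟨S₀, hS₀, hg₀⟩ := hL₀.applies
        obtain ⟨f, hfK, rfl⟩ :=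
          (hS₀.mem_or_added (hs _ _ _ _ hL₀ rfl hS₀ hg₀)).resolve_left hsT
        have hfup := hL₀.isUp hF f (by simp [hfK])
        have hfF : f ∈ F := (hL₀.mem_iff f).1 (by simp [hfK])
        -- Every listing must create `s` before `g`, and by uniqueness always by the same flip `f`.
        have hle : ∀ L', IsPathListing Ω T₀ E F L' → NotAfter L' f g := by
          rintro L' hL' K' M' rfl
          obtain ⟨S', hS', hg'⟩ := hL'.applies
          obtain ⟨f', hf', he⟩ :=
            (hS'.mem_or_added (hs _ _ _ _ hL' rfl hS' hg')).resolve_left hsT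
          rw [← (hL'.isUp hF f' (by simp [hf'])).eq_of_added_eq hfup he]
          exact Or.inr hf'
        have hfL := (hmem f).2 hfF
        rw [List.mem_append, List.mem_cons] at hfL
        rcases hfL with h | rfl | h
        · exact ⟨f, h, rfl⟩
        · exfalso
          have := (List.nodup_append.1 hL₀.nodup).2.2 f hfK f (by simp)
          exact this rfl
        · exact absurd hle (hpw1 f h)
      · rintro f hfK rfl
        -- A flip `f` in `K` that removes `s` contradicts the order, because `g` precedes `f` in
        -- every listing: otherwise `s` would be gone for good before `g` uses it.
        refine hpw2 f hfK g (by simp) ?_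
        rintro L' hL' K' M' rfl
        right
        obtain ⟨A, B, hAB⟩ := List.append_of_mem ((hL'.mem_iff g).2 hgF)
        by_contra hgK'
        by_cases hfg : g = f
        · subst hfg
          exact hpw2 g hfK g (by simp) fun L' _ => notAfter_refl L' g
        have hfA : f ∈ A := by
          rw [List.append_eq_append_iff] at hAB
          rcases hAB with ⟨C, rfl, hC⟩ | ⟨C, rfl, hC⟩
          · rcases C with _ | ⟨x, C⟩
            · simp only [List.nil_append, List.cons.injEq] at hC
              exact absurd hC.1.symm hfg
            · simp only [List.cons_append, List.cons.injEq] at hC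
              simp [hC.1]
          · rcases C with _ | ⟨x, C⟩
            · simp only [List.nil_append, List.cons.injEq] at hC
              exact absurd hC.1 hfg
            · simp only [List.cons_append, List.cons.injEq] at hC
              exact absurd (by simp [hC.1]) hgK'
        rw [hAB] at hL'
        obtain ⟨S', hS', hg'⟩ := hL'.applies
        exact hS'.removed_ne hu (fun f hf => hL'.isUp hF f (by simp [hf]))
          (List.nodup_append.1 hL'.nodup).1 (hs _ _ _ _ hL' rfl hS' hg') f hfA rfl
    have hg : g.Applies Ω S := by
      obtain ⟨K₀, M₀, rfl⟩ := List.append_of_mem ((hL₀.mem_iff g).2 hgF)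
      obtain ⟨S₀, -, hg₀⟩ := hL₀.applies
      exact ⟨hg₀.isPara, hstate _ fun _ _ _ _ _ _ _ h => h.removed_mem,
        fun e he => hstate e fun _ _ _ _ _ _ _ h => h.sides_subset he, hg₀.disjoint_boundary⟩
    exact ⟨_, flipPath_concat.2 ⟨S, hS, hg, rfl⟩⟩

/-- The flips in `F`, ordered by precedence in all generating flip paths. -/
def flipPlan (Ω : Polygon ℂ n) (T₀ E : Finset (Sym2 LatticePoint)) (F : Finset Flip)
    (hne : ∃ L, IsPathListing Ω T₀ E F L) : FlipPoset where
  flips := F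
  le f g := f ∈ F ∧ g ∈ F ∧ ∀ L, IsPathListing Ω T₀ E F L → NotAfter L f g
  mem_of_le f g h := ⟨h.1, h.2.1⟩
  le_refl f hf := ⟨hf, hf, fun L _ => notAfter_refl L f⟩
  le_trans f g h h1 h2 := ⟨h1.1, h2.2.1, fun L hL =>
    (h1.2.2 L hL).trans ((hL.mem_iff g).2 h1.2.1) (h2.2.2 L hL)⟩
  le_antisymm f g h1 h2 := by
    -- Without any listing the relation would hold between all flips in `F`.
    obtain ⟨L, hL⟩ := hne
    exact (h1.2.2 L hL).antisymm hL.nodup ((hL.mem_iff g).2 h1.2.1) (h2.2.2 L hL)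

/-- A linear ordering is a path by `flipPath_of_compatible`, and it generates `E` since its end
agrees with that of any other path listing the same up flips. -/
lemma flipPlan_isLinearOrdering_iff (hu : ∀ e ∈ T₀, sqLen e = 1)
    (hF : ∀ f, f ∈ F ↔ f.IsUp ∧ Needed E f.added) (hne : ∃ L, IsPathListing Ω T₀ E F L)
    (L : List Flip) :
    (flipPlan Ω T₀ E F hne).IsLinearOrdering L ↔ IsPathListing Ω T₀ E F L := by
  constructor
  · rintro ⟨⟨hnd, hmem⟩, hpw⟩
    obtain ⟨L₀, hL₀⟩ := id hne
    obtain ⟨S, hS⟩ := flipPath_of_compatible hu hF hL₀ hmem (hpw.imp_of_mem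
      fun hf hg h h' => h ⟨(hmem _).1 hg, (hmem _).1 hf, h'⟩)
    refine ⟨hnd, hmem, S, hS, ?_⟩
    obtain ⟨T, hT, hET⟩ := hL₀.generates
    rwa [← hT.target_unique hS hu (hL₀.isUp hF) hL₀.nodup hnd
      fun f => (hL₀.mem_iff f).trans (hmem f).symm]
  · intro h
    refine ⟨⟨h.nodup, h.mem_iff⟩, (NotAfter.pairwise h.nodup).imp ?_⟩
    exact fun hna hle => hna (hle.2.2 L h)

lemma flipPlan_isMinimumFlipPlan (hu : ∀ e ∈ T₀, sqLen e = 1)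
    (hF : ∀ f, f ∈ F ↔ f.IsUp ∧ Needed E f.added) (hne : ∃ L, IsPathListing Ω T₀ E F L) :
    (flipPlan Ω T₀ E F hne).IsMinimumFlipPlan Ω T₀ E := by
  refine ⟨fun L hL => ?_, fun L hL L' hL' => ?_⟩
  · rw [flipPlan_isLinearOrdering_iff hu hF]
    exact ⟨fun h => h.generates, fun h => ⟨hL.1, hL.2, h⟩⟩
  · have h := (flipPlan_isLinearOrdering_iff hu hF hne L).1 hL
    exact (h.nodup.subperm fun f hf => hL'.mem hu hF ((h.mem_iff f).1 hf)).length_le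

/-- A linear ordering of a minimum plan contains all required flips and is no longer than a listing
of them, so it has exactly these flips. The plan condition then fixes its linear orderings, and
these fix its order. -/
lemma eq_flipPlan (hu : ∀ e ∈ T₀, sqLen e = 1)
    (hF : ∀ f, f ∈ F ↔ f.IsUp ∧ Needed E f.added) (hne : ∃ L, IsPathListing Ω T₀ E F L)
    {π : FlipPoset} (hπ : π.IsMinimumFlipPlan Ω T₀ E) : π = flipPlan Ω T₀ E F hne := by
  classical
  obtain ⟨L, hL⟩ := π.exists_isLinearOrdering
  have hgen := (hπ.1 L hL.1).1 hL
  obtain ⟨L₀, hL₀⟩ := id hne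
  have hlen := hπ.2 L hL L₀ hL₀.generates
  have hsub : L₀.Subperm L :=
    hL₀.nodup.subperm fun f hf => hgen.mem hu hF ((hL₀.mem_iff f).1 hf)
  have hperm := hsub.perm_of_length_le hlen
  have hflips : π.flips = F := by
    ext f
    rw [← hL.1.2 f, ← hperm.mem_iff, hL₀.mem_iff]
  have hlin : ∀ L, π.IsLinearOrdering L ↔ IsPathListing Ω T₀ E F L := by
    intro L
    constructor
    · intro h
      exact ⟨h.1.1, fun f => by rw [h.1.2, hflips], (hπ.1 L h.1).1 h⟩
    · intro h
      exact (hπ.1 L ⟨h.nodup, fun f => by rw [h.mem_iff, hflips]⟩).2 h.generates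
  ext f g
  · rw [hflips]; rfl
  · rw [π.le_iff, hflips]
    simp only [hlin]
    rfl

end Plan

end LatticeFlip

theorem mainTheorem7 {n : ℕ} (Ω : Polygon ℂ n) (hΩ : IsSimpleLatticePolygon Ω)
    (T₀ : Finset (Sym2 LatticePoint)) (hT₀ : IsEquilateralTriangulation Ω T₀)
    (E : Finset (Sym2 LatticePoint)) (hE : IsConstraintSet Ω E) :
    (∃! π : FlipPoset, π.IsMinimumFlipPlan Ω T₀ E) ∧
      ∀ π : FlipPoset, π.IsMinimumFlipPlan Ω T₀ E →
        ∃ T : Finset (Sym2 LatticePoint), π.Yields Ω T₀ T ∧ IsMinimumTriangulation Ω E T := by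
  have hu := hT₀.sqLen_eq_one
  obtain ⟨F, hF⟩ := exists_requiredFlips hT₀.1 hu hE
  obtain ⟨T, hT, hET⟩ := hT₀.1.exists_constrained hE
  obtain ⟨L₀, S, hL₀, hS, hES, -⟩ := exists_isPathListing hT₀.1 hu hF hT hET
  have hunique : ∀ {L S'}, IsPathListing Ω T₀ E F L → FlipPath Ω T₀ L S' → S = S' := by
    intro L S' hL hS'
    exact hS.target_unique hS' hu (hL₀.isUp hF) hL₀.nodup hL.nodup
      fun f => (hL₀.mem_iff f).trans (hL.mem_iff f).symm
  refine ⟨⟨flipPlan Ω T₀ E F ⟨L₀, hL₀⟩, flipPlan_isMinimumFlipPlan hu hF _,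
    fun π hπ => eq_flipPlan hu hF _ hπ⟩, fun π hπ => ⟨S, ?_, hS.target, hES, ?_⟩⟩
  · intro L hL
    rw [eq_flipPlan hu hF ⟨L₀, hL₀⟩ hπ, flipPlan_isLinearOrdering_iff hu hF] at hL
    obtain ⟨S', hS', -⟩ := hL.generates
    rwa [hunique hL hS']
  · intro T' hT' hET'
    obtain ⟨L, S', hL, hS', -, hlen⟩ := exists_isPathListing hT₀.1 hu hF hT' hET'
    rwa [hunique hL hS']
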